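/- Let $\Omega\subset\mathbb R^3$ be open and let $\lambda,\mu:\mathbb R^3\to\mathbb R$ be bounded measurable Lamé parameters (density $1$) that are smooth off a closed null set $\Gamma\subset\overline\Omega$ and for which $\mu$ and $3\lambda+2\mu$ are bounded below by a positive constant. Put $Lu=\nabla\cdot\big(\lambda(\operatorname{div}u)\,\mathrm{Id}+2\mu\,\varepsilon(u)\big)$ with $\varepsilon(u)=\tfrac12(\nabla u+\nabla u^{\mathsf T})$, $c_P=\sqrt{\lambda+2\mu}$, $c_S=\sqrt\mu$, and let $d_P,d_S$ be the distance functions of the metrics $c_P^{-2}dx^2$, $c_S^{-2}dx^2$ (infima of lengths of piecewise smooth paths). For $h=(f_0,f_1)\in H^1(\mathbb R^3;\mathbb C^3)\oplus L^2(\mathbb R^3;\mathbb C^3)$ let $R_sh=(u(s),\partial_tu(s))$, where $u\in C(\mathbb R;H^1)\cap C^1(\mathbb R;L^2)$ is the weak solution of $\partial_t^2u-Lu=0$ with $u(0)=f_0$, $\partial_tu(0)=f_1$. Assume the elastic unique continuation principle: whenever such a solution $u$ vanishes in a neighbourhood of $(t_0,t_1)\times\{x_0\}$, $t_0<t_1$,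 it vanishes on $\{(t,x): d_S(x,x_0)+|t-\tfrac{t_0+t_1}2|\le\tfrac{t_1-t_0}2\}$. Let $\Theta\supset\Omega$ and $\Upsilon\supset\overline\Theta$ be open sets with Lipschitz boundary, $\Upsilon$ bounded, $\mathbb R^3\setminus\overline\Theta$ connected, and let $0<T<\tfrac12\operatorname{diam}_P\Theta$ and $d_P(\partial\Upsilon,\overline\Theta)>2T$. Put $\Theta^\star=\Upsilon\setminus\overline\Theta$. Let $\pi^\star$ be the orthogonal projection onto $H^1_0(\Theta^\star)\oplus L^2(\Theta^\star)$ with respect to the energy inner product $$\langle (f_0,f_1),(g_0,g_1)\rangle=\int_{\mathbb R^3}\big(f_1\cdot\overline{g_1}+\lambda\operatorname{div}f_0\operatorname{div}\overline{g_0}+2\mu\,\varepsilon(f_0):\varepsilon(\overline{g_0})\big)\,dx,$$ let $\bar\pi=\mathrm{Id}-\pi^\star$, $\nu(f_0,f_1)=(f_0,-f_1)$ and $R=\nu R_{2T}$. Let $h_0\in H^1_0(\Theta)\oplus L^2(\Theta)$, and let $h_\infty\in H^1_0(\Upsilon)\oplus L^2(\Upsilon)$ solve the scattering control equation $(I-\pi^\star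 R\pi^\star R)h_\infty=h_0$. Then $(v_0,v_1):=R_{-T}\,\bar\pi\,R_{2T}h_\infty$ is stationary on the slow domain of influence $U=\{x\in\mathbb R^3: d_S(x,\partial\Theta)<T\}$: $v_1=0$ almost everywhere on $U$, and $Lv_0=0$ weakly on $U$. -/

import Mathlib

open MeasureTheory Set Filter Topology
open scoped ContDiff ENNReal ComplexConjugate

noncomputable section

namespace ElasticControl

/-- Physical space `ℝ³` with the Euclidean metric. -/
abbrev Pos : Type := EuclideanSpace ℝ (Fin 3)

/-- The values of displacement fields. -/
abbrev C3 : Type := EuclideanSpace ℂ (Fin 3)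

/-- `L²(ℝ³; ℂ³)`. -/
abbrev L2 : Type := Lp C3 2 (volume : Measure Pos)

/-- Pairs `(f₀, f₁)` of Cauchy data. The regularity of `f₀` is expressed by `MemH1` below. -/
abbrev CauchyData : Type := L2 × L2

/-! ### Sobolev spaces -/

/-- The `i`-th standard basis vector of `ℝ³`. -/
def basisVec (i : Fin 3) : Pos := EuclideanSpace.single i (1 : ℝ)

/-- `g` is the weak partial derivative `∂ᵢ f` on `ℝ³`. -/
def HasWeakPartial (i : Fin 3) (f g : L2) : Prop :=
  ∀ φ : Pos → ℝ, ContDiff ℝ ∞ φ → HasCompactSupport φ →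
    ∫ x, (fderiv ℝ φ x (basisVec i)) • f x = -∫ x, φ x • g x

/-- `f ∈ H¹(ℝ³; ℂ³)`. -/
def MemH1 (f : L2) : Prop := ∀ i, ∃ g : L2, HasWeakPartial i f g

/-- The weak partial derivative `∂ᵢ f` of `f ∈ H¹` (it is unique in `L²`). -/
def weakPartial (i : Fin 3) (f : L2) : L2 := Classical.epsilon (HasWeakPartial i f)

/-- `f ∈ H¹₀(U; ℂ³)`, regarded as a function on `ℝ³` by extension by zero: `f` lies in the closure
in `H¹(ℝ³)` of the smooth fields with compact support in `U`. -/
def MemH10 (U : Set Pos) (f : L2) : Prop :=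
  MemH1 f ∧ ∀ ε : ℝ≥0∞, 0 < ε → ∃ φ : Pos → C3,
    ContDiff ℝ ∞ φ ∧ HasCompactSupport φ ∧ tsupport φ ⊆ U ∧
    eLpNorm (fun x => f x - φ x) 2 volume < ε ∧
    ∀ i, eLpNorm (fun x => weakPartial i f x - fderiv ℝ φ x (basisVec i)) 2 volume < ε

/-- `f = 0` almost everywhere on `U`. -/
def VanishesOn (U : Set Pos) (f : L2) : Prop := ∀ᵐ x ∂(volume : Measure Pos), x ∈ U → f x = 0

/-- The space `H¹₀(U) ⊕ L²(U)` of Cauchy data supported in `U`. -/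
def DataIn (U : Set Pos) : Set CauchyData := {h | MemH10 U h.1 ∧ VanishesOn Uᶜ h.2}

/-! ### The elastic operator and the energy -/

/-- `div f`. -/
def divergence (f : L2) (x : Pos) : ℂ := ∑ i, weakPartial i f x i

/-- The symmetric gradient of `f`. -/
def strain (f : L2) (x : Pos) (i j : Fin 3) : ℂ := (weakPartial i f x j + weakPartial j f x i) / 2

/-- The form `a(f, g) = ∫ λ div f div ḡ + 2 μ ε(f) : ε(ḡ) = ⟨-L f, g⟩` of the elastic operator
`L f = ∇ · (λ (div f) Id + 2 μ ε(f))`. -/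
def elasticForm (lam mu : Pos → ℝ) (f g : L2) : ℂ :=
  ∫ x, ((lam x : ℂ) * (divergence f x * conj (divergence g x)) +
    2 * (mu x : ℂ) * ∑ i, ∑ j, strain f x i j * conj (strain g x i j))

/-- The pairing `∫ f · ḡ`. -/
def pairing (f g : L2) : ℂ := ∫ x, ∑ j, f x j * conj (g x j)

/-- The elastic energy inner product of Cauchy data. -/
def energyInner (lam mu : Pos → ℝ) (h k : CauchyData) : ℂ :=
  pairing h.2 k.2 + elasticForm lam mu h.1 k.1

/-- `(f, g)` is stationary on the open set `U`: `g = 0` on `U` and `L f = 0` on `U`, weakly. -/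
def IsStationaryOn (lam mu : Pos → ℝ) (U : Set Pos) (h : CauchyData) : Prop :=
  MemH1 h.1 ∧ VanishesOn U h.2 ∧ ∀ φ : L2, MemH10 U φ → elasticForm lam mu h.1 φ = 0

/-! ### Lamé parameters, wave speeds and travel times -/

/-- `lam`, `mu` are Lamé parameters on `ℝ³` (density one) satisfying the strong convexity
condition: bounded, smooth off a closed null set `Γ ⊆ closure Ω` of interfaces, with `μ` and
`3 λ + 2 μ` bounded below by a positive constant. -/
structure IsLame (Ω : Set Pos) (lam mu : Pos → ℝ) : Prop where
  measurable_lam : Measurable lam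
  measurable_mu : Measurable mu
  smooth : ∃ Γ : Set Pos, IsClosed Γ ∧ Γ ⊆ closure Ω ∧ volume Γ = 0 ∧
    ContDiffOn ℝ ∞ lam Γᶜ ∧ ContDiffOn ℝ ∞ mu Γᶜ
  bounded : ∃ K : ℝ, ∀ x, |lam x| ≤ K ∧ |mu x| ≤ K
  convex : ∃ κ : ℝ, 0 < κ ∧ ∀ x, κ ≤ mu x ∧ κ ≤ 3 * lam x + 2 * mu x

/-- The `P`-wave speed. -/
def speedP (lam mu : Pos → ℝ) (x : Pos) : ℝ := √(lam x + 2 * mu x)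

/-- The `S`-wave speed. -/
def speedS (mu : Pos → ℝ) (x : Pos) : ℝ := √(mu x)

/-- `γ` restricted to `[0, 1]` is a continuous, piecewise smooth path. -/
def IsPiecewiseSmoothPath (γ : ℝ → Pos) : Prop :=
  ContinuousOn γ (Icc 0 1) ∧ ∃ F : Finset ℝ, ∀ a b : ℝ, a < b → Icc a b ⊆ Icc 0 1 →
    (∀ t ∈ Ioo a b, t ∉ F) → ContDiffOn ℝ ∞ γ (Icc a b)

/-- The length of `γ` in the metric `c⁻² dx²`. -/
def travelLength (c : Pos → ℝ) (γ : ℝ → Pos) : ℝ≥0∞ :=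
  ∫⁻ t in Icc (0 : ℝ) 1, ENNReal.ofReal (‖deriv γ t‖ / c (γ t))

/-- The distance function of the metric `c⁻² dx²`. -/
def travelDist (c : Pos → ℝ) (x y : Pos) : ℝ≥0∞ :=
  ⨅ γ : ℝ → Pos, ⨅ _ : IsPiecewiseSmoothPath γ ∧ γ 0 = x ∧ γ 1 = y, travelLength c γ

/-- The distance from a point to a set. -/
def distToSet (c : Pos → ℝ) (x : Pos) (A : Set Pos) : ℝ≥0∞ := ⨅ y ∈ A, travelDist c x y

/-- The distance between two sets. -/
def setDist (c : Pos → ℝ) (A B : Set Pos) : ℝ≥0∞ := ⨅ x ∈ A, distToSet c x B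

/-- The diameter of a set. -/
def travelDiam (c : Pos → ℝ) (A : Set Pos) : ℝ≥0∞ := ⨆ x ∈ A, ⨆ y ∈ A, travelDist c x y

/-- `U` is an open set with Lipschitz boundary: near every boundary point it is the region on one
side of the graph of a Lipschitz function `ψ` over the plane orthogonal to a unit vector `n`. -/
def IsLipschitzDomain (U : Set Pos) : Prop :=
  IsOpen U ∧ ∀ x ∈ frontier U, ∃ n : Pos, ‖n‖ = 1 ∧ ∃ (K : NNReal) (ψ : Pos → ℝ),
    LipschitzWith K ψ ∧ (∀ (y : Pos) (s : ℝ), ψ (y + s • n) = ψ y) ∧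
    ∃ W ∈ 𝓝 x, ∀ y ∈ W, (y ∈ U ↔ ψ y < inner ℝ n y)

/-! ### Elastic waves -/

/-- `u ∈ C(ℝ; H¹(ℝ³)) ∩ C¹(ℝ; L²(ℝ³))` is a weak solution of `∂ₜ² u - L u = 0` on `ℝ × ℝ³`. -/
structure IsElasticWave (lam mu : Pos → ℝ) (u : ℝ → L2) : Prop where
  memH1 : ∀ t, MemH1 (u t)
  continuous_weakPartial : ∀ i, Continuous fun t => weakPartial i (u t)
  contDiff : ContDiff ℝ 1 u
  equation : ∀ φ : L2, MemH1 φ → ∀ t,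
    HasDerivAt (fun s => pairing (deriv u s) φ) (-elasticForm lam mu (u t) φ) t

open Classical in
/-- The propagator `R_s`: it takes Cauchy data `h ∈ H¹ ⊕ L²` at time `0` to the Cauchy data at time
`s` of the unique elastic wave with the data `h` at time `0`. -/
def propagate (lam mu : Pos → ℝ) (s : ℝ) (h : CauchyData) : CauchyData :=
  if H : ∃ u : ℝ → L2, IsElasticWave lam mu u ∧ u 0 = h.1 ∧ deriv u 0 = h.2
  then (H.choose s, deriv H.choose s) else 0

/-- The time reversal `ν (f₀, f₁) = (f₀, -f₁)`. -/
def timeReversal (h : CauchyData) : CauchyData := (h.1, -h.2)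

/-- The operator `R = ν ∘ R_{2T}`. -/
def reflectOp (lam mu : Pos → ℝ) (T : ℝ) (h : CauchyData) : CauchyData :=
  timeReversal (propagate lam mu (2 * T) h)

/-- The elastic unique continuation principle: an elastic wave that vanishes in a neighbourhood of
`(t₀, t₁) × {x₀}` vanishes in the double cone
`d_S(x, x₀) + |t - (t₀ + t₁) / 2| ≤ (t₁ - t₀) / 2`. -/
def UniqueContinuation (lam mu : Pos → ℝ) : Prop :=
  ∀ (u : ℝ → L2) (t₀ t₁ : ℝ) (x₀ : Pos), IsElasticWave lam mu u → t₀ < t₁ →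
    (∃ N : Set (ℝ × Pos), IsOpen N ∧ Ioo t₀ t₁ ×ˢ {x₀} ⊆ N ∧
      ∀ t, VanishesOn {x | (t, x) ∈ N} (u t)) →
    ∀ t, VanishesOn {x | travelDist (speedS mu) x x₀ + ENNReal.ofReal |t - (t₀ + t₁) / 2| ≤
      ENNReal.ofReal ((t₁ - t₀) / 2)} (u t)

/-! ### Projections and the scattering control equation -/

/-- The region `Θ^⋆` of the points of `Υ` that lie outside the closure of `Θ`. -/
def outside (Θ Υ : Set Pos) : Set Pos := Υ \ closure Θ

/-- `p` is the orthogonal projection of `k`, in the energy inner product, onto the space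
`H¹₀(Θ^⋆) ⊕ L²(Θ^⋆)`. -/
def IsOuterProj (lam mu : Pos → ℝ) (Θ Υ : Set Pos) (k p : CauchyData) : Prop :=
  p ∈ DataIn (outside Θ Υ) ∧ ∀ q ∈ DataIn (outside Θ Υ), energyInner lam mu (k - p) q = 0

open Classical in
/-- The orthogonal projection `π^⋆` onto `H¹₀(Θ^⋆) ⊕ L²(Θ^⋆)` in the energy inner product. For `Υ`
bounded it is defined on all of `H¹(ℝ³) ⊕ L²(ℝ³)`. -/
def outerProj (lam mu : Pos → ℝ) (Θ Υ : Set Pos) (k : CauchyData) : CauchyData :=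
  if H : ∃ p, IsOuterProj lam mu Θ Υ k p then H.choose else 0

/-- The complementary operator `π̄ = Id - π^⋆`. -/
def innerProj (lam mu : Pos → ℝ) (Θ Υ : Set Pos) (k : CauchyData) : CauchyData :=
  k - outerProj lam mu Θ Υ k

/-- `h` solves the scattering control equation `(I - π^⋆ R π^⋆ R) h = h₀`. -/
def SolvesScatteringControl (lam mu : Pos → ℝ) (Θ Υ : Set Pos) (T : ℝ) (h₀ h : CauchyData) : Prop :=
  h - outerProj lam mu Θ Υ (reflectOp lam mu T
    (outerProj lam mu Θ Υ (reflectOp lam mu T h))) = h₀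

end ElasticControl

end

open MeasureTheory Set Filter Topology
open scoped ContDiff ENNReal ComplexConjugate

noncomputable section

namespace ElasticControl


open scoped Convolution

/-! ### Mollification in `L²` -/

/-! Let `w` be the wave with data `π̄ R_{2T} h_∞` at time `0` and put `v(t) = w(t - 2T)`, so that
the claim concerns `v` at time `T`. At time `2T` the data of `v` are orthogonal to the exterior data
on `Θ^⋆` by definition of `π̄`. The control equation gives the same at time `0`: since `ν` commutes
with `π^⋆` and reverses waves, `b = R π^⋆ R h_∞` is the state at time `-2T` of the wave with data
`π^⋆ R_{2T} h_∞`. Hence the state of `w` at `-2T` is `h_∞ - b = h₀ - (b - π^⋆ b)`, where `h₀` lives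
in `Θ` and the bracket is orthogonal by projection (`SolvesScatteringControl.energyInner_eq_zero`).
Orthogonality to all exterior data means stationarity on `Θ^⋆`
(`IsLame.isStationaryOn_of_orthogonal`).

Finite speed of propagation (`IsElasticWave.vanishesOn_of_eikonal`) keeps `v` constant in time from
either end. As `d_P(∂Υ, Θ) > 2T`, there is a shell of `Θ^⋆` slightly beyond `P`-distance `T` from
`Θ` where the window around `0` and the one around `2T` meet, so `v` is constant there during all of
`[0, 2T]`. Unique continuation, applied to the increments `v(t + h) - v(t)`, makes the set of such
points relatively closed in `Θ^⋆`; since the exterior is connected, it contains all exterior points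
within `P`-distance `T` of `Θ` (`UniqueContinuation.isConstantNear_exterior`). Lipschitz regularity
puts such points arbitrarily close to each point of `∂Θ`, and unique continuation from them makes
`v` constant near `(T, x)` whenever `d_S(x, ∂Θ) < T`. Then `∂ₜ v = 0` there, and differentiating
once more in time gives `L v = 0`.

Two analytic ingredients carry this. Finite speed and uniqueness come from the energy of the time
integral of `v - v(0)`: the role of velocity is then played by `v - v(0)`, which is in `H¹` and
hence, multiplied by a Lipschitz weight, is an admissible test field. The projection `π^⋆` exists by
Lax–Milgram, with coercivity from the first Korn inequality and the Poincaré inequality on bounded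
sets. -/

theorem exists_translation_close (f : L2) {ε : ℝ≥0∞} (hε : 0 < ε) :
    ∃ δ : ℝ, 0 < δ ∧ ∀ y : Pos, ‖y‖ < δ →
      eLpNorm (fun x => f (x - y) - f x) 2 volume ≤ ε := by
  let g : Pos → C(Pos, Pos) := fun y => ⟨fun x => x - y, by fun_prop⟩
  have hg : Continuous g :=
    ContinuousMap.continuous_of_continuous_uncurry _ (by
      change Continuous fun p : Pos × Pos => p.2 - p.1
      fun_prop)
  have hm : ∀ y, MeasurePreserving (g y) (volume : Measure Pos) volume :=
    fun y => measurePreserving_sub_right volume y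
  have hc : Continuous fun y => Lp.compMeasurePreserving (g y) (hm y) f :=
    continuous_const.compMeasurePreservingLp hg hm (by simp)
  have h0 : Lp.compMeasurePreserving (g 0) (hm 0) f = f := by
    apply Lp.ext
    filter_upwards [Lp.coeFn_compMeasurePreserving f (hm 0)] with x hx
    rw [hx]; simp [g]
  have h1 : Tendsto (fun y => edist (Lp.compMeasurePreserving (g y) (hm y) f) f) (𝓝 0) (𝓝 0) := by
    have := (hc.edist (continuous_const (y := f))).tendsto 0
    rwa [h0, edist_self] at this
  obtain ⟨δ, hδ, h2⟩ := Metric.eventually_nhds_iff.1 (h1.eventually (ge_mem_nhds hε))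
  refine ⟨δ, hδ, fun y hy => ?_⟩
  have h3 := h2 (show dist y 0 < δ by simpa using hy)
  rw [Lp.edist_def] at h3
  refine (le_of_eq (eLpNorm_congr_ae ?_)).trans h3
  filter_upwards [Lp.coeFn_compMeasurePreserving f (hm y)] with x hx
  rw [Pi.sub_apply, hx]; rfl

/-- The mollification of `f` by the normed bump function `φ`. -/
def mollify (φ : ContDiffBump (0 : Pos)) (f : Pos → C3) : Pos → C3 :=
  φ.normed volume ⋆[ContinuousLinearMap.lsmul ℝ ℝ, volume] f

theorem L2.locallyIntegrable (f : L2) : LocallyIntegrable f (volume : Measure Pos) :=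
  (Lp.memLp f).locallyIntegrable (by norm_num)

theorem mollify_apply (φ : ContDiffBump (0 : Pos)) (f : Pos → C3) (x : Pos) :
    mollify φ f x = ∫ y, φ.normed volume y • f (x - y) := rfl

theorem contDiff_mollify (φ : ContDiffBump (0 : Pos)) (f : L2) : ContDiff ℝ ∞ (mollify φ f) :=
  φ.hasCompactSupport_normed.contDiff_convolution_left _ φ.contDiff_normed (L2.locallyIntegrable f)

/-- The error is an average of `f(x - y) - f(x)` against the probability measure `η dy`. Its square
is bounded by the average of squares (`L¹ ≤ L²` for a probability measure), and Tonelli moves the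
`x`-integral inside, where the hypothesis applies for each `y` in the support of `η`. -/
theorem eLpNorm_mollify_sub_le (φ : ContDiffBump (0 : Pos)) (f : L2) {ε : ℝ≥0∞}
    (h : ∀ y : Pos, ‖y‖ < φ.rOut → eLpNorm (fun x => f (x - y) - f x) 2 volume ≤ ε) :
    eLpNorm (fun x => mollify φ f x - f x) 2 volume ≤ ε := by
  set η := φ.normed (volume : Measure Pos) with hη
  have hηm : Measurable fun y => ENNReal.ofReal (η y) :=
    φ.continuous_normed.measurable.ennreal_ofReal
  let ν : Measure Pos := volume.withDensity fun y => ENNReal.ofReal (η y)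
  have hν : IsProbabilityMeasure ν := by
    refine ⟨?_⟩
    rw [withDensity_apply _ MeasurableSet.univ, setLIntegral_univ,
      ← ofReal_integral_eq_lintegral_ofReal φ.integrable_normed
        (Eventually.of_forall φ.nonneg_normed), φ.integral_normed, ENNReal.ofReal_one]
  have hfm : Measurable f := (Lp.stronglyMeasurable f).measurable
  have hFm : Measurable fun p : Pos × Pos => ‖f (p.1 - p.2) - f p.1‖ₑ := by fun_prop
  have key : ∀ x, ‖mollify φ f x - f x‖ₑ ^ 2 ≤ ∫⁻ y, ‖f (x - y) - f x‖ₑ ^ 2 ∂ν := by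
    intro x
    have hi : Integrable (fun y => η y • f (x - y)) := by
      have : ConvolutionExistsAt η f x (ContinuousLinearMap.lsmul ℝ ℝ) volume :=
        (φ.hasCompactSupport_normed.convolutionExists_left _ φ.continuous_normed
          (L2.locallyIntegrable f)) x
      exact this
    have h1 : mollify φ f x - f x = ∫ y, η y • (f (x - y) - f x) := by
      simp_rw [smul_sub]
      rw [integral_sub hi (φ.integrable_normed.smul_const _), φ.integral_normed_smul, mollify_apply]
    have h2 : ‖mollify φ f x - f x‖ₑ ≤ ∫⁻ y, ‖f (x - y) - f x‖ₑ ∂ν := by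
      rw [h1, lintegral_withDensity_eq_lintegral_mul _ hηm (by fun_prop)]
      refine (enorm_integral_le_lintegral_enorm _).trans (le_of_eq (lintegral_congr fun y => ?_))
      rw [enorm_smul, Pi.mul_apply, Real.enorm_of_nonneg (φ.nonneg_normed y)]
    have h3 := eLpNorm_le_eLpNorm_of_exponent_le (μ := ν) (p := 1) (q := 2)
      (f := fun y => f (x - y) - f x) (by norm_num)
      (by have : Measurable fun y => f (x - y) - f x := by fun_prop
          exact this.aestronglyMeasurable)
    rw [eLpNorm_one_eq_lintegral_enorm, eLpNorm_eq_lintegral_rpow_enorm_toReal (by norm_num)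
      (by norm_num)] at h3
    calc _ ≤ _ := pow_le_pow_left' (h2.trans h3) 2
      _ = _ := by
        rw [← ENNReal.rpow_natCast, ← ENNReal.rpow_mul]
        norm_num
  have hsq : ∀ g : Pos → C3, eLpNorm g 2 volume ^ 2 = ∫⁻ x, ‖g x‖ₑ ^ 2 := by
    intro g
    rw [eLpNorm_eq_lintegral_rpow_enorm_toReal (by norm_num) (by norm_num), ← ENNReal.rpow_natCast,
      ← ENNReal.rpow_mul]
    norm_num
  refine (ENNReal.pow_le_pow_left_iff two_ne_zero).1 ?_
  rw [hsq]
  calc _ ≤ ∫⁻ x, ∫⁻ y, ‖f (x - y) - f x‖ₑ ^ 2 ∂ν := lintegral_mono key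
    _ = ∫⁻ y, (∫⁻ x, ‖f (x - y) - f x‖ₑ ^ 2) ∂ν :=
        lintegral_lintegral_swap (by exact (hFm.pow_const 2).aemeasurable)
    _ ≤ ∫⁻ y, ε ^ 2 ∂ν := by
        refine lintegral_mono_ae ?_
        rw [ae_withDensity_iff hηm]
        refine Eventually.of_forall fun y hy => ?_
        have hy' : y ∈ Function.support η := fun h0 => hy (by simp [h0])
        rw [hη, φ.support_normed_eq] at hy'
        rw [← hsq]
        exact pow_le_pow_left' (h y (by simpa using hy')) 2
    _ = ε ^ 2 := by simp

/-- Test the weak derivative with `z ↦ η(x - z)`: the sign from the chain rule cancels the one from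
integration by parts. -/
theorem hasWeakPartial_translate (φ : ContDiffBump (0 : Pos)) {i : Fin 3} {f g : L2}
    (h : HasWeakPartial i f g) (x : Pos) :
    ∫ z, fderiv ℝ (φ.normed volume) (x - z) (basisVec i) • f z =
      ∫ z, φ.normed volume (x - z) • g z := by
  have hd : ∀ z, fderiv ℝ (fun z => φ.normed volume (x - z)) z (basisVec i) =
      -fderiv ℝ (φ.normed volume) (x - z) (basisVec i) := by
    intro z
    have h2 : HasFDerivAt (fun z => φ.normed volume (x - z))
        ((fderiv ℝ (φ.normed volume) (x - z)).comp (-ContinuousLinearMap.id ℝ Pos)) z :=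
      (((φ.contDiff_normed (n := 1)).differentiable one_ne_zero _).hasFDerivAt).comp z
        ((hasFDerivAt_id z).const_sub x)
    rw [h2.fderiv]; simp
  have h3 := h (fun z => φ.normed volume (x - z))
    (φ.contDiff_normed.comp (contDiff_const.sub contDiff_id))
    ((φ.hasCompactSupport_normed (μ := volume)).comp_homeomorph (Homeomorph.subLeft x))
  simp_rw [hd, neg_smul, integral_neg, neg_inj] at h3
  exact h3

theorem hasFDerivAt_mollify (φ : ContDiffBump (0 : Pos)) (f : L2) (x : Pos) :
    HasFDerivAt (mollify φ f) ((fderiv ℝ (φ.normed volume)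
      ⋆[(ContinuousLinearMap.lsmul ℝ ℝ).precompL Pos, volume] f) x) x :=
  φ.hasCompactSupport_normed (μ := volume).hasFDerivAt_convolution_left
    (ContinuousLinearMap.lsmul ℝ ℝ) (φ.contDiff_normed (n := 1)) (L2.locallyIntegrable f) x

theorem fderiv_mollify_eq (φ : ContDiffBump (0 : Pos)) (f : L2) (x e : Pos) :
    fderiv ℝ (mollify φ f) x e = ∫ y, fderiv ℝ (φ.normed volume) y e • f (x - y) := by
  have hi := ((φ.hasCompactSupport_normed (μ := volume)).fderiv ℝ).convolutionExists_left
    ((ContinuousLinearMap.lsmul ℝ ℝ (E := C3)).precompL Pos)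
    ((φ.contDiff_normed (n := 1)).continuous_fderiv one_ne_zero) (L2.locallyIntegrable f) x
  rw [(hasFDerivAt_mollify φ f x).fderiv, convolution_def]
  refine (ContinuousLinearMap.integral_apply hi.integrable e).trans ?_
  simp only [ContinuousLinearMap.precompL_apply, ContinuousLinearMap.lsmul_apply]

theorem fderiv_mollify_apply (φ : ContDiffBump (0 : Pos)) {i : Fin 3} {f g : L2}
    (h : HasWeakPartial i f g) (x : Pos) :
    fderiv ℝ (mollify φ f) x (basisVec i) = mollify φ g x := by
  rw [fderiv_mollify_eq, mollify_apply,
    ← integral_sub_left_eq_self (fun y => fderiv ℝ (φ.normed volume) y (basisVec i) • f (x - y))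
      volume x, ← integral_sub_left_eq_self (fun y => φ.normed volume y • g (x - y)) volume x]
  simpa only [sub_sub_cancel] using hasWeakPartial_translate φ h x

theorem tsupport_mollify_subset (φ : ContDiffBump (0 : Pos)) {f : L2} {K : Set Pos}
    (hf : VanishesOn Kᶜ f) :
    tsupport (mollify φ f) ⊆ Metric.cthickening φ.rOut K := by
  refine closure_minimal (fun x hx => ?_) Metric.isClosed_cthickening
  by_contra hxK
  apply hx
  rw [mollify_apply]
  refine integral_eq_zero_of_ae ?_
  have h1 : ∀ᵐ y ∂(volume : Measure Pos), x - y ∈ Kᶜ → f (x - y) = 0 :=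
    (quasiMeasurePreserving_sub_left volume x).ae hf
  filter_upwards [h1] with y hy
  by_cases hyK : x - y ∈ K
  · have : y ∉ Function.support (φ.normed (volume : Measure Pos)) := by
      rw [φ.support_normed_eq]
      intro hy0
      apply hxK
      refine Metric.mem_cthickening_of_dist_le x (x - y) _ _ hyK ?_
      have : ‖y‖ < φ.rOut := by simpa using hy0
      simpa [dist_eq_norm] using this.le
    rw [Function.notMem_support.1 this, zero_smul]; rfl
  · rw [hy hyK, smul_zero]; rfl

/-- Smooth approximation in `H¹`. -/
theorem exists_smooth_approx {f : L2} {D : Fin 3 → L2} (hD : ∀ i, HasWeakPartial i f (D i))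
    {ε : ℝ≥0∞} (hε : 0 < ε) {δ : ℝ} (hδ : 0 < δ) :
    ∃ g : Pos → C3, ContDiff ℝ ∞ g ∧ eLpNorm (fun x => f x - g x) 2 volume ≤ ε ∧
      (∀ i, eLpNorm (fun x => D i x - fderiv ℝ g x (basisVec i)) 2 volume ≤ ε) ∧
      ∀ K, VanishesOn Kᶜ f → tsupport g ⊆ Metric.cthickening δ K := by
  obtain ⟨r, hr, h0⟩ := exists_translation_close f hε
  choose s hs h1 using fun i => exists_translation_close (D i) hε
  -- One radius has to serve `f`, its three derivatives and the support condition.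
  obtain ⟨ρ, hρ, hρ'⟩ : ∃ ρ : ℝ, 0 < ρ ∧ (ρ ≤ r ∧ ρ ≤ δ ∧ ∀ i, ρ ≤ s i) :=
    ⟨min r (min δ (Finset.univ.inf' Finset.univ_nonempty s)),
      lt_min hr (lt_min hδ ((Finset.lt_inf'_iff _).2 fun i _ => hs i)),
      min_le_left _ _, (min_le_right _ _).trans (min_le_left _ _), fun i =>
      ((min_le_right _ _).trans (min_le_right _ _)).trans (Finset.inf'_le _ (Finset.mem_univ i))⟩
  let φ : ContDiffBump (0 : Pos) := ⟨ρ / 2, ρ, half_pos hρ, half_lt_self hρ⟩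
  refine ⟨mollify φ f, contDiff_mollify φ f, ?_, fun i => ?_, fun K hf => ?_⟩
  · have := eLpNorm_mollify_sub_le φ f fun y hy => h0 y (hy.trans_le hρ'.1)
    rw [← eLpNorm_neg]
    refine (le_of_eq (congrArg (eLpNorm · 2 volume) (funext fun x => ?_))).trans this
    simp
  · have := eLpNorm_mollify_sub_le φ (D i) fun y hy => h1 i y (hy.trans_le (hρ'.2.2 i))
    rw [← eLpNorm_neg]
    refine (le_of_eq (congrArg (eLpNorm · 2 volume) (funext fun x => ?_))).trans this
    simp [fderiv_mollify_apply φ (hD i)]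
  · exact (tsupport_mollify_subset φ hf).trans (Metric.cthickening_mono hρ'.2.1 K)


/-! ### Weak derivatives -/

/-- Integration of an `L²` field against a scalar `L²` weight. -/
def weightPairing (a : Lp ℝ 2 (volume : Measure Pos)) : L2 →L[ℝ] C3 :=
  (ContinuousLinearMap.lsmul ℝ ℝ (E := C3)).lpPairing volume 2 2 a

theorem weightPairing_toLp {a : Pos → ℝ} (ha : MemLp a 2 volume) (f : L2) :
    weightPairing ha.toLp f = ∫ x, a x • f x := by
  rw [weightPairing, ContinuousLinearMap.lpPairing_eq_integral]
  refine integral_congr_ae ?_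
  filter_upwards [ha.coeFn_toLp] with x hx
  simp [hx]

theorem memLp_of_continuous_of_hasCompactSupport {F : Type*} [NormedAddCommGroup F] {φ : Pos → F}
    (h : Continuous φ) (h' : HasCompactSupport φ) (p : ℝ≥0∞) : MemLp φ p volume :=
  h.memLp_of_hasCompactSupport h'

theorem continuous_partial {F : Type*} [NormedAddCommGroup F] [NormedSpace ℝ F] {φ : Pos → F}
    (h : ContDiff ℝ ∞ φ) (e : Pos) : Continuous fun x => fderiv ℝ φ x e :=
  (h.continuous_fderiv (by simp)).clm_apply continuous_const

theorem hasCompactSupport_partial {F : Type*} [NormedAddCommGroup F] [NormedSpace ℝ F]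
    {φ : Pos → F} (h : HasCompactSupport φ) (e : Pos) :
    HasCompactSupport fun x => fderiv ℝ φ x e := h.fderiv_apply ℝ e

/-- Each test function gives an equation between continuous linear maps on `L²`. Closedness of the
graph of the weak derivative, and its additivity, can be read off from this form. -/
theorem hasWeakPartial_iff {i : Fin 3} {f g : L2} : HasWeakPartial i f g ↔
    ∀ (φ : Pos → ℝ) (h : ContDiff ℝ ∞ φ) (hc : HasCompactSupport φ),
      weightPairing (memLp_of_continuous_of_hasCompactSupport (continuous_partial h (basisVec i))
        (hasCompactSupport_partial hc _) 2).toLp f =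
      -weightPairing (memLp_of_continuous_of_hasCompactSupport h.continuous hc 2).toLp g := by
  simp_rw [weightPairing_toLp]; rfl

theorem HasWeakPartial.add {i : Fin 3} {f g f' g' : L2} (h : HasWeakPartial i f g)
    (h' : HasWeakPartial i f' g') : HasWeakPartial i (f + f') (g + g') := by
  rw [hasWeakPartial_iff] at *
  intro φ hφ hc
  rw [map_add, map_add, h φ hφ hc, h' φ hφ hc, neg_add]

theorem HasWeakPartial.smul {i : Fin 3} {f g : L2} (h : HasWeakPartial i f g) (c : ℂ) :
    HasWeakPartial i (c • f) (c • g) := by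
  intro φ hφ hc
  have h1 : ∀ (a : Pos → ℝ) (u : L2), ∫ x, a x • (c • u : L2) x = c • ∫ x, a x • u x := by
    intro a u
    rw [← integral_smul]
    refine integral_congr_ae ?_
    filter_upwards [Lp.coeFn_smul c u] with x hx
    rw [hx, Pi.smul_apply, smul_comm]
  rw [h1, h1, h φ hφ hc, smul_neg]

theorem HasWeakPartial.neg {i : Fin 3} {f g : L2} (h : HasWeakPartial i f g) :
    HasWeakPartial i (-f) (-g) := by simpa using h.smul (-1)

theorem HasWeakPartial.sub {i : Fin 3} {f g f' g' : L2} (h : HasWeakPartial i f g)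
    (h' : HasWeakPartial i f' g') : HasWeakPartial i (f - f') (g - g') := by
  simpa [sub_eq_add_neg] using h.add h'.neg

theorem HasWeakPartial.zero (i : Fin 3) : HasWeakPartial i 0 0 := by
  rw [hasWeakPartial_iff]; intros; simp

theorem HasWeakPartial.unique {i : Fin 3} {f g g' : L2} (h : HasWeakPartial i f g)
    (h' : HasWeakPartial i f g') : g = g' := by
  apply Lp.ext
  refine ae_eq_of_integral_contDiff_smul_eq (L2.locallyIntegrable g) (L2.locallyIntegrable g') ?_
  intro φ hφ hc
  exact neg_injective ((h φ hφ hc).symm.trans (h' φ hφ hc))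

theorem isClosed_hasWeakPartial (i : Fin 3) : IsClosed {p : L2 × L2 | HasWeakPartial i p.1 p.2} := by
  simp_rw [hasWeakPartial_iff, ofPred_forall]
  refine isClosed_iInter fun φ => isClosed_iInter fun h => isClosed_iInter fun hc => ?_
  exact isClosed_eq ((ContinuousLinearMap.continuous _).comp continuous_fst)
    ((ContinuousLinearMap.continuous _).comp continuous_snd).neg

theorem MemH1.hasWeakPartial {f : L2} (hf : MemH1 f) (i : Fin 3) :
    HasWeakPartial i f (weakPartial i f) := Classical.epsilon_spec (hf i)

/-- Uniqueness of weak derivatives turns the arbitrary choice made by `Classical.epsilon` into a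
genuine operator. -/
theorem HasWeakPartial.weakPartial_eq {i : Fin 3} {f g : L2} (h : HasWeakPartial i f g) :
    weakPartial i f = g :=
  HasWeakPartial.unique (Classical.epsilon_spec (⟨g, h⟩ : ∃ g, HasWeakPartial i f g)) h

theorem MemH1.sub {f g : L2} (hf : MemH1 f) (hg : MemH1 g) : MemH1 (f - g) :=
  fun i => ⟨_, (hf.hasWeakPartial i).sub (hg.hasWeakPartial i)⟩

theorem MemH1.zero : MemH1 0 := fun i => ⟨0, .zero i⟩

theorem weakPartial_sub {f g : L2} (hf : MemH1 f) (hg : MemH1 g) (i : Fin 3) :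
    weakPartial i (f - g) = weakPartial i f - weakPartial i g :=
  ((hf.hasWeakPartial i).sub (hg.hasWeakPartial i)).weakPartial_eq

@[simp] theorem weakPartial_zero (i : Fin 3) : weakPartial i 0 = 0 :=
  (HasWeakPartial.zero i).weakPartial_eq

/-! ### Test fields -/

/-- Smooth fields with compact support in `U`. -/
structure IsTestField (U : Set Pos) (φ : Pos → C3) : Prop where
  contDiff : ContDiff ℝ ∞ φ
  hasCompactSupport : HasCompactSupport φ
  tsupport_subset : tsupport φ ⊆ U

namespace IsTestField

variable {U : Set Pos} {φ : Pos → C3}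

theorem memLp (h : IsTestField U φ) : MemLp φ 2 volume :=
  memLp_of_continuous_of_hasCompactSupport h.contDiff.continuous h.hasCompactSupport 2

theorem memLp_partial (h : IsTestField U φ) (i : Fin 3) :
    MemLp (fun x => fderiv ℝ φ x (basisVec i)) 2 volume :=
  memLp_of_continuous_of_hasCompactSupport (continuous_partial h.contDiff _)
    (hasCompactSupport_partial h.hasCompactSupport _) 2

/-- A test field as an element of `L²`. -/
def toL2 (h : IsTestField U φ) : L2 := h.memLp.toLp

/-- The partial derivatives of a test field as elements of `L²`. -/
def partialL2 (h : IsTestField U φ) (i : Fin 3) : L2 := (h.memLp_partial i).toLp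

theorem integral_partial_smul {χ : Pos → ℝ} (hχ : ContDiff ℝ ∞ χ) (hc : HasCompactSupport χ)
    (h : ContDiff ℝ ∞ φ) (e : Pos) :
    ∫ x, fderiv ℝ χ x e • φ x = -∫ x, χ x • fderiv ℝ φ x e := by
  have h0 := integral_bilinear_fderiv_right_eq_neg_left_of_integrable (μ := (volume : Measure Pos))
    (f := χ) (g := φ) (v := e) (B := ContinuousLinearMap.lsmul ℝ ℝ)
    (((continuous_partial hχ e).smul h.continuous).integrable_of_hasCompactSupport
      (hasCompactSupport_partial hc e).smul_right)
    ((hχ.continuous.smul (continuous_partial h e)).integrable_of_hasCompactSupport hc.smul_right)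
    ((hχ.continuous.smul h.continuous).integrable_of_hasCompactSupport hc.smul_right)
    (fun x _ => hχ.differentiable (by simp) x) (fun x _ => h.differentiable (by simp) x)
  simp only [ContinuousLinearMap.lsmul_apply] at h0
  rw [h0, neg_neg]

theorem hasWeakPartial (h : IsTestField U φ) (i : Fin 3) :
    HasWeakPartial i h.toL2 (h.partialL2 i) := by
  intro χ hχ hc
  have h1 : ∫ x, fderiv ℝ χ x (basisVec i) • h.toL2 x = ∫ x, fderiv ℝ χ x (basisVec i) • φ x :=
    integral_congr_ae (by filter_upwards [h.memLp.coeFn_toLp] with x hx; rw [toL2, hx])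
  have h2 : ∫ x, χ x • h.partialL2 i x = ∫ x, χ x • fderiv ℝ φ x (basisVec i) :=
    integral_congr_ae (by
      filter_upwards [(h.memLp_partial i).coeFn_toLp] with x hx; rw [partialL2, hx])
  rw [h1, h2, integral_partial_smul hχ hc h.contDiff]

theorem memH1 (h : IsTestField U φ) : MemH1 h.toL2 := fun i => ⟨_, h.hasWeakPartial i⟩

theorem weakPartial_toL2 (h : IsTestField U φ) (i : Fin 3) :
    weakPartial i h.toL2 = h.partialL2 i := (h.hasWeakPartial i).weakPartial_eq

theorem add {ψ : Pos → C3} (h : IsTestField U φ) (h' : IsTestField U ψ) :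
    IsTestField U (φ + ψ) :=
  ⟨h.contDiff.add h'.contDiff, h.hasCompactSupport.add h'.hasCompactSupport,
    (tsupport_add φ ψ).trans (union_subset h.tsupport_subset h'.tsupport_subset)⟩

theorem smul (h : IsTestField U φ) (c : ℂ) : IsTestField U (c • φ) :=
  ⟨h.contDiff.const_smul c, h.hasCompactSupport.smul_left (f := fun _ => c),
    (tsupport_smul_subset_right (fun _ => c) φ).trans h.tsupport_subset⟩

theorem zero (U : Set Pos) : IsTestField U 0 :=
  ⟨contDiff_const, HasCompactSupport.zero, by simp [tsupport]⟩

theorem sub {ψ : Pos → C3} (h : IsTestField U φ) (h' : IsTestField U ψ) :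
    IsTestField U (φ - ψ) := by
  have := h.add (h'.smul (-1))
  simpa [sub_eq_add_neg] using this

theorem partialL2_add {ψ : Pos → C3} (h : IsTestField U φ) (h' : IsTestField U ψ) (i : Fin 3) :
    (h.add h').partialL2 i = h.partialL2 i + h'.partialL2 i := by
  rw [partialL2, partialL2, partialL2, ← MemLp.toLp_add]
  congr 1
  funext x
  simp [fderiv_add (h.contDiff.differentiable (by simp) x)
    (h'.contDiff.differentiable (by simp) x)]

theorem partialL2_smul (h : IsTestField U φ) (c : ℂ) (i : Fin 3) :
    (h.smul c).partialL2 i = c • h.partialL2 i := by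
  rw [partialL2, partialL2, ← MemLp.toLp_const_smul]
  congr 1
  funext x
  simp [fderiv_const_smul (h.contDiff.differentiable (by simp) x)]

theorem toL2_sub {ψ : Pos → C3} (h : IsTestField U φ) (h' : IsTestField U ψ) :
    (h.sub h').toL2 = h.toL2 - h'.toL2 := by
  rw [toL2, toL2, toL2, ← MemLp.toLp_sub]

theorem partialL2_sub {ψ : Pos → C3} (h : IsTestField U φ) (h' : IsTestField U ψ) (i : Fin 3) :
    (h.sub h').partialL2 i = h.partialL2 i - h'.partialL2 i := by
  rw [partialL2, partialL2, partialL2, ← MemLp.toLp_sub]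
  congr 1
  funext x
  simp [fderiv_sub (h.contDiff.differentiable (by simp) x)
    (h'.contDiff.differentiable (by simp) x)]

theorem toL2_eq_zero (h : IsTestField U φ) : ∀ᵐ x, x ∉ U → h.toL2 x = 0 := by
  filter_upwards [h.memLp.coeFn_toLp] with x hx hxU
  rw [toL2, hx]
  exact image_eq_zero_of_notMem_tsupport fun h' => hxU (h.tsupport_subset h')

theorem partialL2_eq_zero (h : IsTestField U φ) (i : Fin 3) :
    ∀ᵐ x, x ∉ U → h.partialL2 i x = 0 := by
  filter_upwards [(h.memLp_partial i).coeFn_toLp] with x hx hxU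
  have h0 : fderiv ℝ φ x = 0 := image_eq_zero_of_notMem_tsupport
    fun h' => hxU (h.tsupport_subset (tsupport_fderiv_subset ℝ h'))
  rw [partialL2, hx, h0, zero_apply]

end IsTestField

/-! ### The spaces `H¹₀(U)` -/

/-- An `L²`-convergent sequence has an almost everywhere convergent subsequence. -/
theorem VanishesOn.isClosed (A : Set Pos) : IsClosed {f : L2 | VanishesOn A f} := by
  refine IsSeqClosed.isClosed fun f g hf hfg => ?_
  obtain ⟨ns, -, hns⟩ := (tendstoInMeasure_of_tendsto_Lp hfg).exists_seq_tendsto_ae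
  have h1 : ∀ᵐ x ∂(volume : Measure Pos), ∀ n, x ∈ A → f n x = 0 := ae_all_iff.2 hf
  filter_upwards [hns, h1] with x hx hx1 hxA
  refine tendsto_nhds_unique hx ?_
  simp [hx1 _ hxA]

theorem VanishesOn.add {A : Set Pos} {f g : L2} (hf : VanishesOn A f) (hg : VanishesOn A g) :
    VanishesOn A (f + g) := by
  filter_upwards [hf, hg, Lp.coeFn_add f g] with x h1 h2 h3 hx
  rw [h3, Pi.add_apply, h1 hx, h2 hx, add_zero]

theorem VanishesOn.neg {A : Set Pos} {f : L2} (hf : VanishesOn A f) : VanishesOn A (-f) := by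
  filter_upwards [hf, Lp.coeFn_neg f] with x h1 h3 hx
  rw [h3, Pi.neg_apply, h1 hx, neg_zero]

theorem VanishesOn.sub {A : Set Pos} {f g : L2} (hf : VanishesOn A f) (hg : VanishesOn A g) :
    VanishesOn A (f - g) := by simpa [sub_eq_add_neg] using hf.add hg.neg

theorem VanishesOn.zero (A : Set Pos) : VanishesOn A 0 := by
  filter_upwards [Lp.coeFn_zero C3 2 (volume : Measure Pos)] with x hx _
  rw [hx]; rfl

theorem VanishesOn.mono {A B : Set Pos} {f : L2} (hf : VanishesOn A f) (h : B ⊆ A) :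
    VanishesOn B f := by
  filter_upwards [hf] with x hx hxB using hx (h hxB)

theorem memH10_iff {U : Set Pos} {f : L2} : MemH10 U f ↔ MemH1 f ∧
    ∃ (φ : ℕ → Pos → C3) (h : ∀ n, IsTestField U (φ n)),
      Tendsto (fun n => (h n).toL2) atTop (𝓝 f) ∧
      ∀ i, Tendsto (fun n => (h n).partialL2 i) atTop (𝓝 (weakPartial i f)) := by
  have e1 : ∀ {φ : Pos → C3} (h : IsTestField U φ), edist h.toL2 f =
      eLpNorm (fun x => f x - φ x) 2 volume := by
    intro φ h
    rw [edist_comm, Lp.edist_def]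
    refine eLpNorm_congr_ae ?_
    filter_upwards [h.memLp.coeFn_toLp] with x hx
    rw [Pi.sub_apply, IsTestField.toL2, hx]
  have e2 : ∀ {φ : Pos → C3} (h : IsTestField U φ) (i), edist (h.partialL2 i) (weakPartial i f) =
      eLpNorm (fun x => weakPartial i f x - fderiv ℝ φ x (basisVec i)) 2 volume := by
    intro φ h i
    rw [edist_comm, Lp.edist_def]
    refine eLpNorm_congr_ae ?_
    filter_upwards [(h.memLp_partial i).coeFn_toLp] with x hx
    rw [Pi.sub_apply, IsTestField.partialL2, hx]
  refine and_congr_right fun hf => ⟨fun h => ?_, ?_⟩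
  · obtain ⟨u, -, hu, hu0⟩ := exists_seq_strictAnti_tendsto' (α := ℝ≥0∞) zero_lt_one
    choose φ h1 h2 h3 h4 h5 using fun n => h (u n) (hu n).1
    refine ⟨φ, fun n => ⟨h1 n, h2 n, h3 n⟩, ?_, fun i => ?_⟩
    · rw [tendsto_iff_edist_tendsto_0]
      refine tendsto_of_tendsto_of_tendsto_of_le_of_le tendsto_const_nhds hu0
        (fun n => zero_le) fun n => ?_
      rw [e1]; exact (h4 n).le
    · rw [tendsto_iff_edist_tendsto_0]
      refine tendsto_of_tendsto_of_tendsto_of_le_of_le tendsto_const_nhds hu0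
        (fun n => zero_le) fun n => ?_
      rw [e2]; exact (h5 n i).le
  · rintro ⟨φ, h, h1, h2⟩ ε hε
    rw [tendsto_iff_edist_tendsto_0] at h1
    have h3 : ∀ᶠ n in atTop, ∀ i, edist ((h n).partialL2 i) (weakPartial i f) < ε :=
      eventually_all.2 fun i => (tendsto_iff_edist_tendsto_0.1 (h2 i)).eventually (gt_mem_nhds hε)
    obtain ⟨n, hn, hn'⟩ := ((h1.eventually (gt_mem_nhds hε)).and h3).exists
    refine ⟨φ n, (h n).contDiff, (h n).hasCompactSupport, (h n).tsupport_subset, ?_, fun i => ?_⟩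
    · rw [← e1 (h n)]; exact hn
    · rw [← e2 (h n)]; exact hn' i

theorem MemH10.memH1 {U : Set Pos} {f : L2} (h : MemH10 U f) : MemH1 f := h.1

theorem MemH10.sub {U : Set Pos} {f g : L2} (hf : MemH10 U f) (hg : MemH10 U g) :
    MemH10 U (f - g) := by
  rw [memH10_iff] at *
  obtain ⟨hf1, φ, hφ, h1, h2⟩ := hf
  obtain ⟨hg1, ψ, hψ, h3, h4⟩ := hg
  refine ⟨hf1.sub hg1, fun n => φ n - ψ n, fun n => (hφ n).sub (hψ n), ?_, fun i => ?_⟩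
  · exact (h1.sub h3).congr fun n => ((hφ n).toL2_sub (hψ n)).symm
  · rw [weakPartial_sub hf1 hg1]
    exact ((h2 i).sub (h4 i)).congr fun n => ((hφ n).partialL2_sub (hψ n) i).symm

theorem MemH10.zero (U : Set Pos) : MemH10 U 0 :=
  ⟨MemH1.zero, fun ε hε => ⟨0, contDiff_const, HasCompactSupport.zero, by simp [tsupport], by
    have : eLpNorm (fun x => (0 : L2) x - (0 : Pos → C3) x) 2 volume = 0 := by
      rw [eLpNorm_congr_ae (g := 0), eLpNorm_zero]
      filter_upwards [Lp.coeFn_zero C3 2 (volume : Measure Pos)] with x hx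
      rw [hx]; simp
    rwa [this], fun i => by
    have : eLpNorm (fun x => weakPartial i 0 x - fderiv ℝ (0 : Pos → C3) x (basisVec i)) 2
        volume = 0 := by
      rw [weakPartial_zero, eLpNorm_congr_ae (g := 0), eLpNorm_zero]
      filter_upwards [Lp.coeFn_zero C3 2 (volume : Measure Pos)] with x hx
      rw [hx]; simp
    rwa [this]⟩⟩

theorem MemH10.vanishesOn {U : Set Pos} {f : L2} (hf : MemH10 U f) : VanishesOn Uᶜ f := by
  obtain ⟨hf1, φ, hφ, h1, h2⟩ := memH10_iff.1 hf
  exact (VanishesOn.isClosed Uᶜ).mem_of_tendsto h1 (Eventually.of_forall fun n => (hφ n).toL2_eq_zero)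

theorem MemH10.vanishesOn_partial {U : Set Pos} {f : L2} (hf : MemH10 U f) (i : Fin 3) :
    VanishesOn Uᶜ (weakPartial i f) := by
  obtain ⟨hf1, φ, hφ, h1, h2⟩ := memH10_iff.1 hf
  exact (VanishesOn.isClosed Uᶜ).mem_of_tendsto (h2 i)
    (Eventually.of_forall fun n => (hφ n).partialL2_eq_zero i)

/-- Mollify at a radius so small that the thickening of `K` stays in `U`. This makes cut-off
differences of waves admissible in the weak stationarity condition. -/
theorem MemH1.memH10_of_isCompact {f : L2} (hf : MemH1 f) {K U : Set Pos} (hK : IsCompact K)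
    (hU : IsOpen U) (hKU : K ⊆ U) (hfK : VanishesOn Kᶜ f) : MemH10 U f := by
  refine ⟨hf, fun ε hε => ?_⟩
  obtain ⟨ε', h0, h1⟩ := exists_between hε
  obtain ⟨δ, hδ, hδU⟩ := hK.exists_cthickening_subset_open hU hKU
  obtain ⟨g, hg, h2, h3, h4⟩ := exists_smooth_approx hf.hasWeakPartial h0 hδ
  have h5 := h4 K hfK
  exact ⟨g, hg, hK.cthickening.of_isClosed_subset (isClosed_tsupport g) h5, h5.trans hδU,
    h2.trans_lt h1, fun i => (h3 i).trans_lt h1⟩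

theorem DataIn.zero (U : Set Pos) : (0 : CauchyData) ∈ DataIn U := ⟨MemH10.zero U, VanishesOn.zero _⟩

theorem DataIn.sub {U : Set Pos} {p q : CauchyData} (hp : p ∈ DataIn U) (hq : q ∈ DataIn U) :
    p - q ∈ DataIn U := ⟨hp.1.sub hq.1, hp.2.sub hq.2⟩


/-! ### Multiplication by bounded functions -/

/-- Multiplication by a bounded real function as an operator on `L²`. -/
def mulOp (m : Pos → ℝ) (hm : MemLp m ∞ volume) : L2 →L[ℂ] L2 :=
  LinearMap.mkContinuous
    { toFun := fun f => ((Lp.memLp f).smul (r := 2) hm).toLp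
      map_add' := fun f g => by
        apply Lp.ext
        filter_upwards [MemLp.coeFn_toLp ((Lp.memLp (f + g)).smul (r := 2) hm),
          MemLp.coeFn_toLp ((Lp.memLp f).smul (r := 2) hm),
          MemLp.coeFn_toLp ((Lp.memLp g).smul (r := 2) hm), Lp.coeFn_add f g,
          Lp.coeFn_add ((Lp.memLp f).smul (r := 2) hm).toLp ((Lp.memLp g).smul (r := 2) hm).toLp]
          with x h1 h2 h3 h4 h5
        rw [h1, h5, Pi.add_apply, h2, h3, Pi.smul_apply', Pi.smul_apply', Pi.smul_apply', h4,
          Pi.add_apply, smul_add]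
      map_smul' := fun c f => by
        apply Lp.ext
        filter_upwards [MemLp.coeFn_toLp ((Lp.memLp (c • f)).smul (r := 2) hm),
          MemLp.coeFn_toLp ((Lp.memLp f).smul (r := 2) hm), Lp.coeFn_smul c f,
          Lp.coeFn_smul c ((Lp.memLp f).smul (r := 2) hm).toLp] with x h1 h2 h3 h4
        rw [h1, RingHom.id_apply, h4, Pi.smul_apply, h2, Pi.smul_apply', Pi.smul_apply', h3,
          Pi.smul_apply, smul_comm] }
    (eLpNorm m ∞ volume).toReal fun f => by
      change ‖((Lp.memLp f).smul (r := 2) hm).toLp‖ ≤ _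
      rw [Lp.norm_toLp, Lp.norm_def, ← ENNReal.toReal_mul]
      exact ENNReal.toReal_mono (ENNReal.mul_ne_top hm.2.ne (Lp.memLp f).2.ne)
        (eLpNorm_smul_le_mul_eLpNorm (Lp.memLp f).1 hm.1)

theorem coeFn_mulOp (m : Pos → ℝ) (hm : MemLp m ∞ volume) (f : L2) :
    mulOp m hm f =ᵐ[volume] fun x => m x • f x :=
  MemLp.coeFn_toLp ((Lp.memLp f).smul (r := 2) hm)

theorem memLp_top_lineDeriv {χ : Pos → ℝ} {C : NNReal} (h : LipschitzWith C χ) (e : Pos) :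
    MemLp (fun x => lineDeriv ℝ χ x e) ∞ (volume : Measure Pos) := h.memLp_lineDeriv e

theorem memLp_top_of_continuous {χ : Pos → ℝ} (h : Continuous χ) {B : ℝ} (hB : ∀ x, |χ x| ≤ B) :
    MemLp χ ∞ (volume : Measure Pos) :=
  memLp_top_of_bound h.aestronglyMeasurable B (Eventually.of_forall hB)

/-- The product rule for a Lipschitz function and a smooth field, tested against `φ`. -/
theorem integral_lipschitz_product {χ : Pos → ℝ} {C : NNReal} (hχ : LipschitzWith C χ)
    {φ : Pos → ℝ} (hφ : ContDiff ℝ ∞ φ) (hc : HasCompactSupport φ)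
    {g : Pos → C3} (hg : ContDiff ℝ ∞ g) (e : Pos) :
    ∫ x, ((fderiv ℝ φ x e * χ x + φ x * lineDeriv ℝ χ x e) • g x +
      (φ x * χ x) • fderiv ℝ g x e) = 0 := by
  have hd : ∀ x, HasFDerivAt φ (fderiv ℝ φ x) x := fun x =>
    (hφ.differentiable (by simp) x).hasFDerivAt
  have hd' : ∀ x, HasFDerivAt g (fderiv ℝ g x) x := fun x =>
    (hg.differentiable (by simp) x).hasFDerivAt
  have hmeas : AEStronglyMeasurable (fun x => lineDeriv ℝ χ x e) (volume : Measure Pos) :=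
    (memLp_top_lineDeriv hχ e).1
  have hint1 : Integrable fun x => lineDeriv ℝ χ x e • (φ x • g x) :=
    ((hφ.continuous.smul hg.continuous).integrable_of_hasCompactSupport
      (hc.smul_right (f' := g))).bdd_smul (C * ‖e‖) hmeas
      (Eventually.of_forall fun x => norm_lineDeriv_le_of_lipschitz ℝ hχ)
  have hint2 : Integrable fun x => χ x • (fderiv ℝ φ x e • g x + φ x • fderiv ℝ g x e) := by
    refine (hχ.continuous.smul (((continuous_partial hφ e).smul hg.continuous).add
      (hφ.continuous.smul (continuous_partial hg e)))).integrable_of_hasCompactSupport ?_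
    exact (((hasCompactSupport_partial hc e).smul_right (f' := g)).add
      (hc.smul_right (f' := fun x => fderiv ℝ g x e))).smul_left (f := χ)
  have e1 : ∀ x, (fderiv ℝ φ x e * χ x + φ x * lineDeriv ℝ χ x e) • g x +
      (φ x * χ x) • fderiv ℝ g x e =
      lineDeriv ℝ χ x e • (φ x • g x) +
        χ x • (fderiv ℝ φ x e • g x + φ x • fderiv ℝ g x e) := by
    intro x
    module
  simp_rw [e1]
  rw [integral_add hint1 hint2]
  -- Applying a real functional `ℓ` reduces the identity to scalar integration by parts between `χ`
  -- and the compactly supported function `ℓ(φ g)`.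
  refine (SeparatingDual.eq_zero_iff_forall_dual_eq_zero (R := ℝ) _).2 fun ℓ => ?_
  rw [map_add, ← ContinuousLinearMap.integral_comp_comm _ hint1,
    ← ContinuousLinearMap.integral_comp_comm _ hint2]
  have hG : ContDiff ℝ ∞ fun x => ℓ (φ x • g x) := ℓ.contDiff.comp (hφ.smul hg)
  have hGc : HasCompactSupport fun x => ℓ (φ x • g x) :=
    (hc.smul_right (f' := g)).comp_left (map_zero ℓ)
  obtain ⟨D, hD⟩ := hG.lipschitzWith_of_hasCompactSupport hGc (by simp)
  have h1 := hχ.integral_lineDeriv_mul_eq (μ := volume) hD hGc e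
  have h2 : ∀ x, lineDeriv ℝ (fun x => ℓ (φ x • g x)) x (-e) =
      -ℓ (fderiv ℝ φ x e • g x + φ x • fderiv ℝ g x e) := by
    intro x
    have h3 := (ℓ.hasFDerivAt.comp x ((hd x).smul (hd' x)))
    have h4 : lineDeriv ℝ (fun x => ℓ (φ x • g x)) x (-e) = _ := (h3.hasLineDerivAt (-e)).lineDeriv
    rw [h4]
    simp [add_comm]
  simp_rw [h2] at h1
  simp only [map_smul, smul_eq_mul] at h1 ⊢
  rw [h1, ← integral_add]
  · refine integral_eq_zero_of_ae (Eventually.of_forall fun x => ?_)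
    simp only [Pi.zero_apply]; ring
  · have := (ℓ.integrable_comp hint2).neg
    refine this.congr (Eventually.of_forall fun x => ?_)
    simp; ring
  · have := (ℓ.integrable_comp hint2)
    refine this.congr (Eventually.of_forall fun x => ?_)
    simp; ring

/-- Smooth fields are dense in `H¹(ℝ³)`. No compact support is asked for, since the test functions
supply it in the product rule. -/
theorem HasWeakPartial.exists_seq {f : L2} {D : Fin 3 → L2} (hD : ∀ i, HasWeakPartial i f (D i)) :
    ∃ (g : ℕ → Pos → C3) (_ : ∀ n, ContDiff ℝ ∞ (g n)) (h : ∀ n, MemLp (g n) 2 volume)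
      (h' : ∀ n i, MemLp (fun x => fderiv ℝ (g n) x (basisVec i)) 2 volume),
      Tendsto (fun n => (h n).toLp) atTop (𝓝 f) ∧
      ∀ i, Tendsto (fun n => (h' n i).toLp) atTop (𝓝 (D i)) := by
  obtain ⟨u, -, hu, hu0⟩ := exists_seq_strictAnti_tendsto' (α := ℝ≥0∞) zero_lt_one
  choose g hg h1 h2 _ using fun n => exists_smooth_approx hD (hu n).1 zero_lt_one
  have aux : ∀ (n : ℕ) (f : L2) (v : Pos → C3), Continuous v →
      eLpNorm (fun x => f x - v x) 2 volume ≤ u n → MemLp v 2 volume := by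
    intro n f v hv h
    have : MemLp (fun x => f x - v x) 2 volume :=
      ⟨(Lp.aestronglyMeasurable f).sub hv.aestronglyMeasurable,
        h.trans_lt ((hu n).2.trans ENNReal.one_lt_top)⟩
    have h3 := (Lp.memLp f).sub this
    refine (memLp_congr_ae (Eventually.of_forall fun x => ?_)).1 h3
    simp
  have aux2 : ∀ (f : L2) (v : ℕ → Pos → C3) (hv : ∀ n, MemLp (v n) 2 volume),
      (∀ n, eLpNorm (fun x => f x - v n x) 2 volume ≤ u n) →
      Tendsto (fun n => (hv n).toLp) atTop (𝓝 f) := by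
    intro f v hv h
    rw [tendsto_iff_edist_tendsto_0]
    refine tendsto_of_tendsto_of_tendsto_of_le_of_le tendsto_const_nhds hu0
      (fun n => zero_le) fun n => ?_
    dsimp only
    rw [edist_comm, Lp.edist_def]
    refine (le_of_eq (eLpNorm_congr_ae ?_)).trans (h n)
    filter_upwards [(hv n).coeFn_toLp] with x hx
    rw [Pi.sub_apply, hx]
  exact ⟨g, hg, fun n => aux n f _ (hg n).continuous (h1 n),
    fun n i => aux n (D i) _ (continuous_partial (hg n) _) (h2 n i),
    aux2 f _ _ h1, fun i => aux2 (D i) _ _ fun n => h2 n i⟩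

/-- The product rule for a bounded Lipschitz function and an `H¹` field. -/
theorem MemH1.hasWeakPartial_mulOp {f : L2} (hf : MemH1 f) {χ : Pos → ℝ} {C : NNReal}
    (hχ : LipschitzWith C χ) (hb : MemLp χ ∞ (volume : Measure Pos)) (i : Fin 3) :
    HasWeakPartial i (mulOp χ hb f) (mulOp χ hb (weakPartial i f) +
      mulOp _ (memLp_top_lineDeriv hχ (basisVec i)) f) := by
  intro φ hφ hc
  set e := basisVec i
  have hφ2 : MemLp φ 2 volume := memLp_of_continuous_of_hasCompactSupport hφ.continuous hc 2
  have hdφ2 : MemLp (fun x => fderiv ℝ φ x e) 2 volume :=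
    memLp_of_continuous_of_hasCompactSupport (continuous_partial hφ e)
      (hasCompactSupport_partial hc e) 2
  have ha : MemLp (fun x => fderiv ℝ φ x e * χ x + φ x * lineDeriv ℝ χ x e) 2 volume :=
    (hb.mul (r := 2) hdφ2).add ((memLp_top_lineDeriv hχ e).mul (r := 2) hφ2)
  have hb' : MemLp (fun x => φ x * χ x) 2 volume := hb.mul (r := 2) hφ2
  have hprod : ∀ {a : Pos → ℝ} (ha : MemLp a 2 volume) {u : Pos → C3} (hu : MemLp u 2 volume),
      Integrable fun x => a x • u x := fun ha _ hu =>
    memLp_one_iff_integrable.1 (hu.smul (r := 1) ha)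
  obtain ⟨g, hg, h1, h2, h3, h4⟩ := HasWeakPartial.exists_seq hf.hasWeakPartial
  -- The product rule for smooth fields, written with `L²` weights so that both terms are continuous
  -- in `L²` and pass to the limit.
  have key : ∀ n, weightPairing ha.toLp (h1 n).toLp + weightPairing hb'.toLp (h2 n i).toLp = 0 := by
    intro n
    rw [weightPairing_toLp, weightPairing_toLp]
    have e1 : ∫ x, (fderiv ℝ φ x e * χ x + φ x * lineDeriv ℝ χ x e) • (h1 n).toLp (g n) x =
        ∫ x, (fderiv ℝ φ x e * χ x + φ x * lineDeriv ℝ χ x e) • g n x :=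
      integral_congr_ae (by filter_upwards [(h1 n).coeFn_toLp] with x hx; rw [hx])
    have e2 : ∫ x, (φ x * χ x) • (h2 n i).toLp _ x = ∫ x, (φ x * χ x) • fderiv ℝ (g n) x e :=
      integral_congr_ae (by filter_upwards [(h2 n i).coeFn_toLp] with x hx; rw [hx])
    rw [e1, e2, ← integral_add (hprod ha (h1 n)) (hprod hb' (h2 n i))]
    exact integral_lipschitz_product hχ hφ hc (hg n) e
  have hlim := (((weightPairing ha.toLp).continuous.tendsto f).comp h3).add
    (((weightPairing hb'.toLp).continuous.tendsto (weakPartial i f)).comp (h4 i))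
  have h0 : weightPairing ha.toLp f + weightPairing hb'.toLp (weakPartial i f) = 0 :=
    tendsto_nhds_unique hlim (tendsto_const_nhds.congr fun n => (key n).symm)
  rw [weightPairing_toLp, weightPairing_toLp,
    ← integral_add (hprod ha (Lp.memLp f)) (hprod hb' (Lp.memLp _))] at h0
  rw [← add_eq_zero_iff_eq_neg, ← integral_add (hprod hdφ2 (Lp.memLp _)) (hprod hφ2 (Lp.memLp _)),
    ← h0]
  refine integral_congr_ae ?_
  filter_upwards [coeFn_mulOp χ hb f, coeFn_mulOp χ hb (weakPartial i f),
    coeFn_mulOp _ (memLp_top_lineDeriv hχ e) f,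
    Lp.coeFn_add (mulOp χ hb (weakPartial i f)) (mulOp _ (memLp_top_lineDeriv hχ e) f)]
    with x e1 e2 e3 e4
  rw [e1, e4, Pi.add_apply, e2, e3]
  module

theorem MemH1.mulOp {f : L2} (hf : MemH1 f) {χ : Pos → ℝ} {C : NNReal}
    (hχ : LipschitzWith C χ) (hb : MemLp χ ∞ (volume : Measure Pos)) :
    MemH1 (mulOp χ hb f) := fun i => ⟨_, hf.hasWeakPartial_mulOp hχ hb i⟩

theorem MemH1.weakPartial_mulOp {f : L2} (hf : MemH1 f) {χ : Pos → ℝ} {C : NNReal}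
    (hχ : LipschitzWith C χ) (hb : MemLp χ ∞ (volume : Measure Pos)) (i : Fin 3) :
    weakPartial i (ElasticControl.mulOp χ hb f) = ElasticControl.mulOp χ hb (weakPartial i f) +
      ElasticControl.mulOp _ (memLp_top_lineDeriv hχ (basisVec i)) f :=
  (hf.hasWeakPartial_mulOp hχ hb i).weakPartial_eq


/-! ### Pointwise algebra of the stress -/

/-- The map `z ↦ z_j e_i` of `ℂ³`. -/
def coordMap (j i : Fin 3) : C3 →L[ℂ] C3 :=
  (EuclideanSpace.proj j : C3 →L[ℂ] ℂ).smulRight (EuclideanSpace.single i 1)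

theorem coordMap_apply (j i k : Fin 3) (z : C3) : coordMap j i z k = if k = i then z j else 0 := by
  simp [coordMap]

/-- The `i`-th row of the stress `l tr(F) Id + m (F + Fᵀ)` of a displacement gradient `F`. -/
def stressAt (l m : ℝ) (F : Fin 3 → C3) (i : Fin 3) : C3 :=
  l • ∑ k, coordMap k i (F k) + m • (F i + ∑ k, coordMap i k (F k))

theorem stressAt_apply (l m : ℝ) (F : Fin 3 → C3) (i j : Fin 3) :
    stressAt l m F i j = (if j = i then (l : ℂ) * ∑ k, F k k else 0) + m * (F i j + F j i) := by
  simp only [stressAt, PiLp.add_apply, PiLp.smul_apply, WithLp.ofLp_sum, Finset.sum_apply,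
    coordMap_apply, Complex.real_smul]
  congr 1
  · split_ifs <;> simp
  · simp

/-- The pointwise elastic form. -/
def formAt (l m : ℝ) (F G : Fin 3 → C3) : ℂ := ∑ i, inner ℂ (G i) (stressAt l m F i)

theorem formAt_eq (l m : ℝ) (F G : Fin 3 → C3) :
    formAt l m F G = l * ((∑ k, F k k) * conj (∑ k, G k k)) +
      2 * m * ∑ i, ∑ j, (F i j + F j i) / 2 * conj ((G i j + G j i) / 2) := by
  simp only [formAt, PiLp.inner_apply, stressAt_apply, RCLike.inner_apply, Fin.sum_univ_three,
    map_add, map_div₀, Complex.conj_ofNat]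
  simp
  ring

theorem formAt_symm (l m : ℝ) (F G : Fin 3 → C3) :
    formAt l m F G = conj (formAt l m G F) := by
  simp only [formAt_eq, map_add, map_mul, Complex.conj_conj, Complex.conj_ofReal,
    Complex.conj_ofNat, map_div₀, Fin.sum_univ_three]
  ring

theorem formAt_self_re (l m : ℝ) (F : Fin 3 → C3) :
    (formAt l m F F).re = l * ‖∑ k, F k k‖ ^ 2 + 2 * m * ∑ i, ∑ j, ‖(F i j + F j i) / 2‖ ^ 2 := by
  have : formAt l m F F =
      ((l * ‖∑ k, F k k‖ ^ 2 + 2 * m * ∑ i, ∑ j, ‖(F i j + F j i) / 2‖ ^ 2 : ℝ) : ℂ) := by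
    rw [formAt_eq]
    simp only [Complex.mul_conj']
    push_cast
    rfl
  rw [this, Complex.ofReal_re]

theorem norm_sum_three_sq_le (z : Fin 3 → ℂ) : ‖∑ k, z k‖ ^ 2 ≤ 3 * ∑ k, ‖z k‖ ^ 2 := by
  have h1 : ‖∑ k, z k‖ ≤ ∑ k, ‖z k‖ := norm_sum_le _ _
  have h2 : (∑ k, ‖z k‖) ^ 2 ≤ 3 * ∑ k, ‖z k‖ ^ 2 := by
    simpa using sq_sum_le_card_mul_sum_sq (s := Finset.univ) (f := fun k => ‖z k‖)
  exact (pow_le_pow_left₀ (norm_nonneg _) h1 2).trans h2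

/-- Coercivity of the elastic form on strains. -/
theorem le_formAt_self {l m κ : ℝ} (h1 : κ ≤ m) (hκ : 0 < κ) (h2 : κ ≤ 3 * l + 2 * m)
    (F : Fin 3 → C3) : κ * ∑ i, ∑ j, ‖(F i j + F j i) / 2‖ ^ 2 ≤ (formAt l m F F).re := by
  rw [formAt_self_re]
  have h3 := norm_sum_three_sq_le fun k => F k k
  have h4 : ∑ k, ‖F k k‖ ^ 2 ≤ ∑ i, ∑ j, ‖(F i j + F j i) / 2‖ ^ 2 := by
    refine Finset.sum_le_sum fun i _ => ?_
    have : ‖F i i‖ ^ 2 = ‖(F i i + F i i) / 2‖ ^ 2 := by congr 2; ring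
    rw [this]
    exact Finset.single_le_sum (f := fun j => ‖(F i j + F j i) / 2‖ ^ 2)
      (fun j _ => by positivity) (Finset.mem_univ i)
  have h5 : 0 ≤ ‖∑ k, F k k‖ ^ 2 := by positivity
  generalize ‖∑ k, F k k‖ ^ 2 = t at *
  generalize (∑ i, ∑ j, ‖(F i j + F j i) / 2‖ ^ 2) = S at *
  generalize (∑ k, ‖F k k‖ ^ 2) = r at *
  -- With `t = |tr F|²` and `S = |ε|²`, the form is `2m(S - t/3) + (3l + 2m) t/3`, the splitting
  -- into deviatoric and volumetric parts. Both brackets are nonnegative, as `t ≤ 3S`.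
  nlinarith [mul_nonneg (by linarith : 0 ≤ 2 * m - κ) (by linarith : 0 ≤ S - t / 3),
    mul_nonneg (by linarith : 0 ≤ 3 * l + 2 * m - κ) h5]

theorem formAt_self_nonneg {l m κ : ℝ} (h1 : κ ≤ m) (hκ : 0 < κ) (h2 : κ ≤ 3 * l + 2 * m)
    (F : Fin 3 → C3) : 0 ≤ (formAt l m F F).re :=
  (by positivity : 0 ≤ κ * ∑ i, ∑ j, ‖(F i j + F j i) / 2‖ ^ 2).trans (le_formAt_self h1 hκ h2 F)

/-- The elastic form of a rank one gradient `n ⊗ w`. -/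
theorem formAt_rank_one_le {l m κ : ℝ} (h1 : κ ≤ m) (hκ : 0 < κ) (h2 : κ ≤ 3 * l + 2 * m)
    (n : Fin 3 → ℝ) (w : C3) :
    (formAt l m (fun i => n i • w) (fun i => n i • w)).re ≤
      (l + 2 * m) * (∑ i, n i ^ 2) * ‖w‖ ^ 2 := by
  rw [formAt_self_re, EuclideanSpace.norm_sq_eq]
  simp only [PiLp.smul_apply, Complex.real_smul, Complex.sq_norm, Complex.normSq_apply,
    Fin.sum_univ_three, Complex.add_re, Complex.add_im, Complex.mul_re, Complex.mul_im,
    Complex.ofReal_re, Complex.ofReal_im, Complex.div_ofNat_re, Complex.div_ofNat_im]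
  generalize (w 0).re = a, (w 0).im = a', (w 1).re = b, (w 1).im = b', (w 2).re = c,
    (w 2).im = c'
  have h3 : 0 ≤ l + m := by linarith
  -- The defect is `(l + m) |n × w|²`, by Lagrange's identity for the real and the imaginary part of
  -- `w`.
  have h4 : 0 ≤ (l + m) * ((n 0 * b - n 1 * a) ^ 2 + (n 0 * c - n 2 * a) ^ 2 +
      (n 1 * c - n 2 * b) ^ 2 + (n 0 * b' - n 1 * a') ^ 2 + (n 0 * c' - n 2 * a') ^ 2 +
      (n 1 * c' - n 2 * b') ^ 2) := by positivity
  refine le_of_sub_nonneg (h4.trans (le_of_eq ?_))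
  ring

theorem formAt_sub_smul_re (l m τ : ℝ) (F G : Fin 3 → C3) :
    (formAt l m (fun k => F k - τ • G k) (fun k => F k - τ • G k)).re =
      (formAt l m F F).re - 2 * τ * (formAt l m F G).re + τ ^ 2 * (formAt l m G G).re := by
  have h : (formAt l m G F).re = (formAt l m F G).re := by
    rw [formAt_symm, Complex.conj_re]
  have e : formAt l m (fun k => F k - τ • G k) (fun k => F k - τ • G k) =
      formAt l m F F - τ * formAt l m F G - τ * formAt l m G F + τ ^ 2 * formAt l m G G := by
    simp only [formAt_eq, PiLp.sub_apply, PiLp.smul_apply, Complex.real_smul, Fin.sum_univ_three,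
      map_add, map_sub, map_mul, map_div₀, Complex.conj_ofReal, Complex.conj_ofNat]
    ring
  have h5 : (τ : ℂ) ^ 2 = ((τ ^ 2 : ℝ) : ℂ) := by push_cast; rfl
  rw [e, h5, Complex.add_re, Complex.sub_re, Complex.sub_re, Complex.re_ofReal_mul,
    Complex.re_ofReal_mul, Complex.re_ofReal_mul, h]
  ring

/-- The energy flux across a surface element is at most the `P`-wave speed times the energy. -/
theorem flux_le {l m κ : ℝ} (h1 : κ ≤ m) (hκ : 0 < κ) (h2 : κ ≤ 3 * l + 2 * m)
    (n : Fin 3 → ℝ) {s : ℝ} (hs : 0 ≤ s) (hn : (l + 2 * m) * ∑ i, n i ^ 2 ≤ s ^ 2)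
    (F : Fin 3 → C3) (w : C3) :
    2 * |(formAt l m F fun i => n i • w).re| ≤ s * (‖w‖ ^ 2 + (formAt l m F F).re) := by
  have hG := formAt_rank_one_le h1 hκ h2 n w
  have hG' : (formAt l m (fun i => n i • w) (fun i => n i • w)).re ≤ s ^ 2 * ‖w‖ ^ 2 :=
    hG.trans (by gcongr)
  rcases hs.eq_or_lt with rfl | hs
  · have h3 : ∑ i, n i ^ 2 ≤ 0 := by
      have : 0 < l + 2 * m := by linarith
      by_contra! h
      have := mul_pos this h
      norm_num at hn
      linarith
    have h4 : ∀ i, n i = 0 := fun i => by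
      have := Finset.single_le_sum (f := fun i => n i ^ 2) (fun j _ => sq_nonneg (n j))
        (Finset.mem_univ i)
      exact pow_eq_zero_iff two_ne_zero |>.1 (le_antisymm (this.trans h3) (sq_nonneg _))
    simp [h4, formAt]
  · have key : ∀ τ : ℝ, τ ^ 2 * s ^ 2 = 1 →
        2 * τ * (formAt l m F fun i => n i • w).re ≤ ‖w‖ ^ 2 + (formAt l m F F).re := by
      intro τ hτ
      have h3 := formAt_self_nonneg h1 hκ h2 fun k => F k - τ • (n k • w)
      rw [formAt_sub_smul_re l m τ F fun k => n k • w] at h3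
      have h4 := mul_le_mul_of_nonneg_left hG' (sq_nonneg τ)
      rw [← mul_assoc, hτ, one_mul] at h4
      linarith
    have k1 := key s⁻¹ (by field_simp)
    have k2 := key (-s⁻¹) (by field_simp)
    have k1' := mul_le_mul_of_nonneg_left k1 hs.le
    have k2' := mul_le_mul_of_nonneg_left k2 hs.le
    have e1 : ∀ r : ℝ, s * (2 * s⁻¹ * r) = 2 * r := fun r => by field_simp
    have e2 : ∀ r : ℝ, s * (2 * -s⁻¹ * r) = -(2 * r) := fun r => by field_simp
    rw [e1] at k1'
    rw [e2] at k2'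
    rw [← abs_of_pos (two_pos : (0 : ℝ) < 2), ← abs_mul]
    exact abs_le.2 ⟨by linarith, k1'⟩

/-! ### The stress operator -/

variable {lam mu : Pos → ℝ}

/-- The `i`-th row of the stress, as an operator from displacement gradients to `L²`. -/
def stress (hl : MemLp lam ∞ volume) (hm : MemLp mu ∞ volume) (i : Fin 3) :
    (Fin 3 → L2) →L[ℂ] L2 :=
  mulOp lam hl ∘L ∑ k, (coordMap k i).compLpL 2 volume ∘L ContinuousLinearMap.proj k +
    mulOp mu hm ∘L (ContinuousLinearMap.proj i +
      ∑ k, (coordMap i k).compLpL 2 volume ∘L ContinuousLinearMap.proj k)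

theorem coeFn_stress (hl : MemLp lam ∞ volume) (hm : MemLp mu ∞ volume) (i : Fin 3)
    (F : Fin 3 → L2) :
    stress hl hm i F =ᵐ[volume] fun x => stressAt (lam x) (mu x) (fun k => F k x) i := by
  have e : stress hl hm i F = mulOp lam hl (∑ k, (coordMap k i).compLpL 2 volume (F k)) +
      mulOp mu hm (F i + ∑ k, (coordMap i k).compLpL 2 volume (F k)) := by
    simp [stress]
  rw [e]
  have hs : ∀ u : Fin 3 → L2, ⇑(∑ k, u k : L2) =ᵐ[volume] fun x => ∑ k, u k x := by
    intro u
    filter_upwards [Lp.coeFn_fun_finsetSum Finset.univ u] with x hx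
    exact hx
  have h1 : ∀ᵐ x, ∀ k j, (coordMap k j).compLpL 2 volume (F k) x = coordMap k j (F k x) :=
    ae_all_iff.2 fun k => ae_all_iff.2 fun j =>
      ContinuousLinearMap.coeFn_compLpL (coordMap k j) (F k)
  have h1' : ∀ᵐ x, ∀ k j, (coordMap k j).compLpL 2 volume (F j) x = coordMap k j (F j x) :=
    ae_all_iff.2 fun k => ae_all_iff.2 fun j =>
      ContinuousLinearMap.coeFn_compLpL (coordMap k j) (F j)
  filter_upwards [Lp.coeFn_add (mulOp lam hl (∑ k, (coordMap k i).compLpL 2 volume (F k)))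
      (mulOp mu hm (F i + ∑ k, (coordMap i k).compLpL 2 volume (F k))),
    coeFn_mulOp lam hl (∑ k, (coordMap k i).compLpL 2 volume (F k)),
    coeFn_mulOp mu hm (F i + ∑ k, (coordMap i k).compLpL 2 volume (F k)),
    Lp.coeFn_add (F i) (∑ k, (coordMap i k).compLpL 2 volume (F k)),
    hs fun k => (coordMap k i).compLpL 2 volume (F k),
    hs fun k => (coordMap i k).compLpL 2 volume (F k), h1, h1'] with x a1 a2 a3 a4 a5 a6 a7 a8
  rw [a1, Pi.add_apply, a2, a3, a4, Pi.add_apply, a5, a6]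
  simp only [a7, a8, stressAt]

/-- The gradient of an `H¹` field. -/
def grad (f : L2) : Fin 3 → L2 := fun i => weakPartial i f

/-- The elastic form of gradients. -/
def gradForm (hl : MemLp lam ∞ volume) (hm : MemLp mu ∞ volume) (F G : Fin 3 → L2) : ℂ :=
  ∑ i, inner ℂ (G i) (stress hl hm i F)

theorem gradForm_integrand (hl : MemLp lam ∞ volume) (hm : MemLp mu ∞ volume)
    (F G : Fin 3 → L2) : (fun x => ∑ i, inner ℂ (G i x) (stress hl hm i F x)) =ᵐ[volume]
      fun x => formAt (lam x) (mu x) (fun k => F k x) (fun k => G k x) := by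
  have h : ∀ᵐ x, ∀ i, stress hl hm i F x = stressAt (lam x) (mu x) (fun k => F k x) i :=
    ae_all_iff.2 fun i => coeFn_stress hl hm i F
  filter_upwards [h] with x hx
  simp only [hx, formAt]

theorem integrable_formAt (hl : MemLp lam ∞ volume) (hm : MemLp mu ∞ volume)
    (F G : Fin 3 → L2) :
    Integrable fun x => formAt (lam x) (mu x) (fun k => F k x) (fun k => G k x) :=
  (integrable_finsetSum _ fun i _ => L2.integrable_inner (G i) (stress hl hm i F)).congr
    (gradForm_integrand hl hm F G)

theorem gradForm_eq_integral (hl : MemLp lam ∞ volume) (hm : MemLp mu ∞ volume)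
    (F G : Fin 3 → L2) : gradForm hl hm F G =
      ∫ x, formAt (lam x) (mu x) (fun k => F k x) (fun k => G k x) := by
  rw [← integral_congr_ae (gradForm_integrand hl hm F G), integral_finsetSum _ fun i _ =>
    L2.integrable_inner (G i) (stress hl hm i F)]
  rfl

/-- The form becomes a sum of `L²` inner products with bounded operators, so its continuity and its
time derivatives follow from those of the gradients. -/
theorem elasticForm_eq (hl : MemLp lam ∞ volume) (hm : MemLp mu ∞ volume) (f g : L2) :
    elasticForm lam mu f g = gradForm hl hm (grad f) (grad g) := by
  rw [gradForm_eq_integral]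
  refine integral_congr_ae (Eventually.of_forall fun x => ?_)
  simp only [formAt_eq, divergence, strain, grad]

theorem pairing_eq_inner (f g : L2) : pairing f g = inner ℂ g f := by
  rw [L2.inner_def]
  refine integral_congr_ae (Eventually.of_forall fun x => ?_)
  simp [PiLp.inner_apply, RCLike.inner_apply]

theorem gradForm_symm (hl : MemLp lam ∞ volume) (hm : MemLp mu ∞ volume) (F G : Fin 3 → L2) :
    gradForm hl hm F G = conj (gradForm hl hm G F) := by
  rw [gradForm_eq_integral, gradForm_eq_integral, ← integral_conj]
  exact integral_congr_ae (Eventually.of_forall fun x => formAt_symm _ _ _ _)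

theorem IsLame.memLp_lam {Ω : Set Pos} (h : IsLame Ω lam mu) : MemLp lam ∞ volume := by
  obtain ⟨K, hK⟩ := h.bounded
  exact memLp_top_of_bound h.measurable_lam.aestronglyMeasurable K
    (Eventually.of_forall fun x => (hK x).1)

theorem IsLame.memLp_mu {Ω : Set Pos} (h : IsLame Ω lam mu) : MemLp mu ∞ volume := by
  obtain ⟨K, hK⟩ := h.bounded
  exact memLp_top_of_bound h.measurable_mu.aestronglyMeasurable K
    (Eventually.of_forall fun x => (hK x).2)


/-! ### Weighted energies -/

section Energy

variable {lam mu : Pos → ℝ} (hl : MemLp lam ∞ volume) (hm : MemLp mu ∞ volume)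

theorem inner_real_smul_left (r : ℝ) (z w : C3) : inner ℂ (r • z) w = (r : ℂ) * inner ℂ z w := by
  rw [← Complex.coe_smul r z, inner_smul_left, Complex.conj_ofReal]

theorem inner_mulOp_integrand (χ : Pos → ℝ) (hχ : MemLp χ ∞ volume) (f g : L2) :
    (fun x => inner ℂ (mulOp χ hχ f x) (g x)) =ᵐ[volume]
      fun x => (χ x : ℂ) * inner ℂ (f x) (g x) := by
  filter_upwards [coeFn_mulOp χ hχ f] with x hx
  rw [hx, inner_real_smul_left]

theorem inner_mulOp (χ : Pos → ℝ) (hχ : MemLp χ ∞ volume) (f g : L2) :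
    inner ℂ (mulOp χ hχ f) g = ∫ x, (χ x : ℂ) * inner ℂ (f x) (g x) :=
  (L2.inner_def _ _).trans (integral_congr_ae (inner_mulOp_integrand χ hχ f g))

theorem inner_mulOp_symm_re (χ : Pos → ℝ) (hχ : MemLp χ ∞ volume) (f g : L2) :
    (inner ℂ (mulOp χ hχ f) g).re = (inner ℂ (mulOp χ hχ g) f).re := by
  have : inner ℂ (mulOp χ hχ f) g = conj (inner ℂ (mulOp χ hχ g) f) := by
    rw [inner_mulOp, inner_mulOp, ← integral_conj]
    refine integral_congr_ae (Eventually.of_forall fun x => ?_)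
    simp only [map_mul, Complex.conj_ofReal, inner_conj_symm]
  rw [this, Complex.conj_re]

theorem gradForm_mulOp_integrand (χ : Fin 3 → Pos → ℝ) (hχ : ∀ i, MemLp (χ i) ∞ volume)
    (F G : Fin 3 → L2) :
    (fun x => formAt (lam x) (mu x) (fun k => F k x) (fun k => mulOp (χ k) (hχ k) (G k) x))
      =ᵐ[volume]
    fun x => formAt (lam x) (mu x) (fun k => F k x) (fun k => χ k x • G k x) := by
  have : ∀ᵐ x, ∀ i, mulOp (χ i) (hχ i) (G i) x = χ i x • G i x :=
    ae_all_iff.2 fun i => coeFn_mulOp (χ i) (hχ i) (G i)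
  filter_upwards [this] with x hx
  simp only [hx]

theorem formAt_smul_right (l m r : ℝ) (F G : Fin 3 → C3) :
    formAt l m F (fun k => r • G k) = r * formAt l m F G := by
  simp only [formAt, inner_real_smul_left, Finset.mul_sum]

/-- The gradient multiplied by a scalar weight. -/
def weighted (χ : Pos → ℝ) (hχ : MemLp χ ∞ volume) (F : Fin 3 → L2) : Fin 3 → L2 :=
  fun i => mulOp χ hχ (F i)

theorem gradForm_weighted (χ : Pos → ℝ) (hχ : MemLp χ ∞ volume) (F G : Fin 3 → L2) :
    gradForm hl hm F (weighted χ hχ G) =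
      ∫ x, (χ x : ℂ) * formAt (lam x) (mu x) (fun k => F k x) (fun k => G k x) := by
  rw [gradForm_eq_integral]
  refine integral_congr_ae ((gradForm_mulOp_integrand (fun _ => χ) (fun _ => hχ) F G).trans ?_)
  exact Eventually.of_forall fun x => formAt_smul_right _ _ _ _ _

theorem gradForm_weighted_symm_re (χ : Pos → ℝ) (hχ : MemLp χ ∞ volume) (F G : Fin 3 → L2) :
    (gradForm hl hm F (weighted χ hχ G)).re = (gradForm hl hm G (weighted χ hχ F)).re := by
  have : gradForm hl hm F (weighted χ hχ G) = conj (gradForm hl hm G (weighted χ hχ F)) := by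
    rw [gradForm_weighted, gradForm_weighted, ← integral_conj]
    refine integral_congr_ae (Eventually.of_forall fun x => ?_)
    dsimp only
    rw [map_mul, Complex.conj_ofReal, ← formAt_symm]
  rw [this, Complex.conj_re]

theorem gradForm_add_right (F G G' : Fin 3 → L2) :
    gradForm hl hm F (G + G') = gradForm hl hm F G + gradForm hl hm F G' := by
  simp only [gradForm, Pi.add_apply, inner_add_left, Finset.sum_add_distrib]

theorem gradForm_sub_left (F F' G : Fin 3 → L2) :
    gradForm hl hm (F - F') G = gradForm hl hm F G - gradForm hl hm F' G := by
  simp only [gradForm, map_sub, inner_sub_right, Finset.sum_sub_distrib]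

theorem gradForm_zero_left (G : Fin 3 → L2) : gradForm hl hm 0 G = 0 := by
  simp [gradForm]

/-- Twice the energy with weight `χ` of a velocity `u` and a displacement gradient `F`. -/
def weightedEnergy (χ : Pos → ℝ) (hχ : MemLp χ ∞ volume) (u : L2) (F : Fin 3 → L2) : ℝ :=
  (inner ℂ (mulOp χ hχ u) u).re + (gradForm hl hm F (weighted χ hχ F)).re

/-- The pointwise energy density. -/
def density (lam mu : Pos → ℝ) (u : L2) (F : Fin 3 → L2) (x : Pos) : ℝ :=
  ‖u x‖ ^ 2 + (formAt (lam x) (mu x) (fun k => F k x) (fun k => F k x)).re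

include hl hm in
theorem integrable_weight_density {χ : Pos → ℝ} (hχ : MemLp χ ∞ volume) (u : L2)
    (F : Fin 3 → L2) : Integrable fun x => χ x * density lam mu u F x := by
  have h1 := (L2.integrable_inner (𝕜 := ℂ) (mulOp χ hχ u) u).congr (inner_mulOp_integrand χ hχ u u)
  have h2 := (integrable_formAt hl hm F (weighted χ hχ F)).congr
    (gradForm_mulOp_integrand (fun _ => χ) (fun _ => hχ) F F)
  refine (h1.re.add h2.re).congr (Eventually.of_forall fun x => ?_)
  simp only [Pi.add_apply, formAt_smul_right, density, RCLike.re_to_complex, Complex.re_ofReal_mul,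
    mul_add, inner_self_eq_norm_sq_to_K]
  norm_cast

theorem weightedEnergy_eq (χ : Pos → ℝ) (hχ : MemLp χ ∞ volume) (u : L2) (F : Fin 3 → L2) :
    weightedEnergy hl hm χ hχ u F = ∫ x, χ x * density lam mu u F x := by
  have h1 := (L2.integrable_inner (𝕜 := ℂ) (mulOp χ hχ u) u).congr (inner_mulOp_integrand χ hχ u u)
  have h2 := (integrable_formAt hl hm F (weighted χ hχ F)).congr
    (gradForm_mulOp_integrand (fun _ => χ) (fun _ => hχ) F F)
  simp only [formAt_smul_right] at h2
  have e1 := integral_re h1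
  have e2 := integral_re h2
  rw [weightedEnergy, inner_mulOp, gradForm_weighted]
  simp only [RCLike.re_to_complex] at e1 e2
  rw [← e1, ← e2]
  refine (integral_add h1.re h2.re).symm.trans ?_
  refine integral_congr_ae (Eventually.of_forall fun x => ?_)
  simp only [density, RCLike.re_to_complex, Complex.re_ofReal_mul,
    mul_add, inner_self_eq_norm_sq_to_K]
  norm_cast

theorem hasDerivAt_gradForm {F : ℝ → Fin 3 → L2} {F' : Fin 3 → L2} {t : ℝ}
    (hF : HasDerivAt F F' t) (G : Fin 3 → L2) :
    HasDerivAt (fun t => gradForm hl hm (F t) G) (gradForm hl hm F' G) t := by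
  unfold gradForm
  refine HasDerivAt.fun_sum fun i _ => ?_
  exact ((innerSL ℂ (G i) ∘L stress hl hm i).restrictScalars ℝ).hasFDerivAt.comp_hasDerivAt t hF

theorem hasDerivAt_clm_L2 {u : ℝ → L2} {u' : L2} {t : ℝ} (A : L2 →L[ℂ] L2)
    (hu : HasDerivAt u u' t) : HasDerivAt (fun t => A (u t)) (A u') t :=
  (A.restrictScalars ℝ).hasFDerivAt.comp_hasDerivAt t hu

/-- Both quadratic terms come from symmetric forms, so the two halves of each product rule have
equal real parts. In the application `u` is `v - f` and `F` is the gradient of its time integral. -/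
theorem hasDerivAt_weightedEnergy (χ : Pos → ℝ) (hχ : MemLp χ ∞ volume) {u : ℝ → L2} {u' : L2}
    {F : ℝ → Fin 3 → L2} {F' : Fin 3 → L2} {t : ℝ} (hu : HasDerivAt u u' t)
    (hF : HasDerivAt F F' t) :
    HasDerivAt (fun t => weightedEnergy hl hm χ hχ (u t) (F t))
      (2 * (inner ℂ (mulOp χ hχ (u t)) u').re +
        2 * (gradForm hl hm (F t) (weighted χ hχ F')).re) t := by
  have h1 := (hasDerivAt_clm_L2 (mulOp χ hχ) hu).inner ℂ hu
  have h2 : HasDerivAt (fun t => gradForm hl hm (F t) (weighted χ hχ (F t)))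
      (∑ i, (inner ℂ (mulOp χ hχ (F t i)) (stress hl hm i F') +
        inner ℂ (mulOp χ hχ (F' i)) (stress hl hm i (F t)))) t := by
    unfold gradForm
    refine HasDerivAt.fun_sum fun i _ => ?_
    exact (hasDerivAt_clm_L2 (mulOp χ hχ) (hasDerivAt_pi.1 hF i)).inner ℂ
      (((stress hl hm i).restrictScalars ℝ).hasFDerivAt.comp_hasDerivAt t hF)
  have h3 := (Complex.reCLM.hasFDerivAt.comp_hasDerivAt t h1).add
    (Complex.reCLM.hasFDerivAt.comp_hasDerivAt t h2)
  refine h3.congr_deriv ?_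
  have e : (∑ i, (inner ℂ (mulOp χ hχ (F t i)) (stress hl hm i F') +
        inner ℂ (mulOp χ hχ (F' i)) (stress hl hm i (F t)))) =
      gradForm hl hm F' (weighted χ hχ (F t)) + gradForm hl hm (F t) (weighted χ hχ F') := by
    rw [Finset.sum_add_distrib]; rfl
  rw [e]
  simp only [Complex.reCLM_apply, Complex.add_re]
  rw [inner_mulOp_symm_re χ hχ u' (u t), gradForm_weighted_symm_re hl hm χ hχ F' (F t)]
  ring

/-- The flux term of the energy identity. -/
theorem flux_integral_le {κ : ℝ} (hκ : 0 < κ) (hc : ∀ x, κ ≤ mu x ∧ κ ≤ 3 * lam x + 2 * mu x)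
    (χ : Fin 3 → Pos → ℝ) (hχ : ∀ i, MemLp (χ i) ∞ volume) {s : Pos → ℝ}
    (hs : MemLp s ∞ volume) (hs0 : ∀ x, 0 ≤ s x)
    (hle : ∀ᵐ x, (lam x + 2 * mu x) * ∑ i, χ i x ^ 2 ≤ s x ^ 2) (u : L2) (F : Fin 3 → L2) :
    2 * |(gradForm hl hm F fun i => mulOp (χ i) (hχ i) u).re| ≤
      ∫ x, s x * density lam mu u F x := by
  have h1 := (integrable_formAt hl hm F fun i => mulOp (χ i) (hχ i) u).congr
    (gradForm_mulOp_integrand χ hχ F fun _ => u)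
  have e1 := integral_re h1
  simp only [RCLike.re_to_complex] at e1
  rw [gradForm_eq_integral,
    integral_congr_ae (gradForm_mulOp_integrand χ hχ F fun _ => u), ← e1]
  have h2 : |∫ x, (formAt (lam x) (mu x) (fun k => F k x) fun k => χ k x • u x).re| ≤
      ∫ x, |(formAt (lam x) (mu x) (fun k => F k x) fun k => χ k x • u x).re| :=
    abs_integral_le_integral_abs
  refine (mul_le_mul_of_nonneg_left h2 zero_le_two).trans ?_
  rw [← integral_const_mul]
  refine integral_mono_ae (h1.re.abs.const_mul 2) (integrable_weight_density hl hm hs u F) ?_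
  filter_upwards [hle] with x hx
  exact flux_le (hc x).1 hκ (hc x).2 (fun i => χ i x) (hs0 x) hx _ _

end Energy

/-! ### Energy identities for elastic waves -/

section Wave

variable {lam mu : Pos → ℝ} (hl : MemLp lam ∞ volume) (hm : MemLp mu ∞ volume)

/-- The gradient of the time integral of `v - f`. -/
def gradInt (v : ℝ → L2) (f : L2) (t : ℝ) : Fin 3 → L2 :=
  fun i => ∫ s in (0 : ℝ)..t, (weakPartial i (v s) - weakPartial i f)

theorem gradInt_zero (v : ℝ → L2) (f : L2) : gradInt v f 0 = 0 := by
  funext i; simp [gradInt]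

variable {v : ℝ → L2} (hv : IsElasticWave lam mu v)
include hv

theorem IsElasticWave.hasDerivAt (t : ℝ) : HasDerivAt v (deriv v t) t :=
  (hv.contDiff.differentiable one_ne_zero t).hasDerivAt

theorem IsElasticWave.hasDerivAt_gradInt {f : L2} (hf : MemH1 f) (t : ℝ) :
    HasDerivAt (gradInt v f) (grad (v t - f)) t := by
  refine hasDerivAt_pi.2 fun i => ?_
  have h : Continuous fun s => weakPartial i (v s) - weakPartial i f :=
    (hv.continuous_weakPartial i).sub continuous_const
  have := (h.integral_hasStrictDerivAt 0 t).hasDerivAt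
  rwa [← weakPartial_sub (hv.memH1 t) hf] at this

/-- The wave equation integrated once in time. The datum `f` may be subtracted under the integral
because `a(f, φ) = 0`, and the constant of integration vanishes because `φ` is orthogonal to the
initial velocity. -/
theorem IsElasticWave.inner_deriv_eq {f φ : L2} (hf : MemH1 f) (hφ : MemH1 φ)
    (h0 : inner ℂ φ (deriv v 0) = 0) (hfφ : elasticForm lam mu f φ = 0) (t : ℝ) :
    inner ℂ φ (deriv v t) = -gradForm hl hm (gradInt v f t) (grad φ) := by
  have h1 : ∀ t, HasDerivAt (fun t => inner ℂ φ (deriv v t) +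
      gradForm hl hm (gradInt v f t) (grad φ)) 0 t := by
    intro t
    have h2 := (hv.equation φ hφ t)
    simp only [pairing_eq_inner] at h2
    refine (h2.add (hasDerivAt_gradForm hl hm (hv.hasDerivAt_gradInt hf t) (grad φ))).congr_deriv ?_
    rw [elasticForm_eq hl hm] at hfφ ⊢
    have : grad (v t - f) = grad (v t) - grad f := by
      funext i; exact weakPartial_sub (hv.memH1 t) hf i
    rw [this, gradForm_sub_left, hfφ]
    ring
  have h3 := is_const_of_deriv_eq_zero (fun t => (h1 t).differentiableAt) (fun t => (h1 t).deriv) t 0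
  simp only [h0, gradInt_zero, gradForm_zero_left, add_zero] at h3
  exact eq_neg_of_add_eq_zero_left h3

/-- The test field is `χ (v - f)`, which is in `H¹`; `χ ∂ₜ v` would be only in `L²`. In its gradient
the part `χ ∇(v - f)` cancels against the derivative of the elastic energy, and only the flux
through `∇χ ⊗ (v - f)` remains. -/
theorem IsElasticWave.hasDerivAt_energy {f : L2} (hf : MemH1 f) {χ : Pos → ℝ} {C : NNReal}
    (hχ : LipschitzWith C χ) (hb : MemLp χ ∞ volume) (t : ℝ)
    (h : inner ℂ (mulOp χ hb (v t - f)) (deriv v t) =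
      -gradForm hl hm (gradInt v f t) (grad (mulOp χ hb (v t - f)))) :
    HasDerivAt (fun t => weightedEnergy hl hm χ hb (v t - f) (gradInt v f t))
      (-2 * (gradForm hl hm (gradInt v f t) fun i =>
        mulOp _ (memLp_top_lineDeriv hχ (basisVec i)) (v t - f)).re) t := by
  refine (hasDerivAt_weightedEnergy hl hm χ hb ((hv.hasDerivAt t).sub_const f)
    (hv.hasDerivAt_gradInt hf t)).congr_deriv ?_
  have e : grad (mulOp χ hb (v t - f)) = weighted χ hb (grad (v t - f)) +
      fun i => mulOp _ (memLp_top_lineDeriv hχ (basisVec i)) (v t - f) := by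
    funext i
    exact ((hv.memH1 t).sub hf).weakPartial_mulOp hχ hb i
  rw [h, e, gradForm_add_right]
  simp only [Complex.neg_re, Complex.add_re]
  ring

end Wave

/-! ### Uniqueness and finite speed of propagation -/

variable {lam mu : Pos → ℝ}

theorem density_nonneg {κ : ℝ} (hκ : 0 < κ) (hc : ∀ x, κ ≤ mu x ∧ κ ≤ 3 * lam x + 2 * mu x)
    (u : L2) (F : Fin 3 → L2) (x : Pos) : 0 ≤ density lam mu u F x :=
  add_nonneg (by positivity) (formAt_self_nonneg (hc x).1 hκ (hc x).2 _)

theorem sq_norm_le_density {κ : ℝ} (hκ : 0 < κ)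
    (hc : ∀ x, κ ≤ mu x ∧ κ ≤ 3 * lam x + 2 * mu x) (u : L2) (F : Fin 3 → L2) (x : Pos) :
    ‖u x‖ ^ 2 ≤ density lam mu u F x :=
  le_add_of_nonneg_right (formAt_self_nonneg (hc x).1 hκ (hc x).2 _)

theorem mulOp_const_zero (h : MemLp (fun _ : Pos => (0 : ℝ)) ∞ volume) (f : L2) :
    mulOp (fun _ => 0) h f = 0 := by
  apply Lp.ext
  filter_upwards [coeFn_mulOp _ h f, Lp.coeFn_zero C3 2 (volume : Measure Pos)] with x h1 h2
  rw [h1, h2]; simp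

/-- With the constant weight `χ = 1` there is no flux, so the energy of the time integral of `v` is
conserved. It starts at zero and dominates `‖v‖²`. -/
theorem IsElasticWave.eq_zero {Ω : Set Pos} (hLame : IsLame Ω lam mu) {v : ℝ → L2}
    (hv : IsElasticWave lam mu v) (h0 : v 0 = 0) (h1 : deriv v 0 = 0) (t : ℝ) : v t = 0 := by
  obtain ⟨κ, hκ, hc⟩ := hLame.convex
  have hl := hLame.memLp_lam
  have hm := hLame.memLp_mu
  have hlip : LipschitzWith 0 fun _ : Pos => (1 : ℝ) := LipschitzWith.const 1
  have hb : MemLp (fun _ : Pos => (1 : ℝ)) ∞ volume := memLp_top_const 1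
  have hE : ∀ t, HasDerivAt (fun t => weightedEnergy hl hm _ hb (v t - 0) (gradInt v 0 t)) 0 t := by
    intro t
    have hφ : MemH1 (mulOp _ hb (v t - 0)) := ((hv.memH1 t).sub MemH1.zero).mulOp hlip hb
    refine (hv.hasDerivAt_energy hl hm MemH1.zero hlip hb t
      (hv.inner_deriv_eq hl hm MemH1.zero hφ (by simp [h1]) ?_ t)).congr_deriv ?_
    · rw [elasticForm_eq hl hm]
      have : grad 0 = 0 := by funext i; exact weakPartial_zero i
      rw [this, gradForm_zero_left]
    · have : ∀ (i : Fin 3) (f : L2), mulOp _ (memLp_top_lineDeriv hlip (basisVec i)) f = 0 := by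
        intro i f
        have h := mulOp_const_zero (memLp_top_const (0 : ℝ)) f
        convert h using 3
        funext x
        simp [lineDeriv]
      simp [this, gradForm]
  have h2 := is_const_of_deriv_eq_zero (fun t => (hE t).differentiableAt) (fun t => (hE t).deriv) t 0
  have h3 : weightedEnergy hl hm _ hb (v 0 - 0) (gradInt v 0 0) = 0 := by
    rw [h0, gradInt_zero]; simp [weightedEnergy, gradForm_zero_left]
  rw [h3, weightedEnergy_eq, sub_zero] at h2
  simp only [one_mul] at h2
  have h4 : Integrable (density lam mu (v t) (gradInt v 0 t)) := by
    have := integrable_weight_density hl hm hb (v t) (gradInt v 0 t)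
    simpa only [one_mul] using this
  have h5 := (integral_eq_zero_iff_of_nonneg (fun x => density_nonneg hκ hc _ _ x) h4).1 h2
  apply Lp.ext
  filter_upwards [h5, Lp.coeFn_zero C3 2 (volume : Measure Pos)] with x h6 h7
  have h8 := sq_norm_le_density hκ hc (v t) (gradInt v 0 t) x
  rw [h6] at h8
  rw [h7]
  simpa using h8

theorem IsElasticWave.sub {v w : ℝ → L2} (hl : MemLp lam ∞ volume) (hm : MemLp mu ∞ volume)
    (hv : IsElasticWave lam mu v)
    (hw : IsElasticWave lam mu w) : IsElasticWave lam mu fun t => v t - w t where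
  memH1 t := (hv.memH1 t).sub (hw.memH1 t)
  continuous_weakPartial i := by
    simp_rw [weakPartial_sub (hv.memH1 _) (hw.memH1 _)]
    exact (hv.continuous_weakPartial i).sub (hw.continuous_weakPartial i)
  contDiff := hv.contDiff.sub hw.contDiff
  equation φ hφ t := by
    have h1 : ∀ s, deriv (fun t => v t - w t) s = deriv v s - deriv w s := fun s =>
      ((hv.hasDerivAt s).sub (hw.hasDerivAt s)).deriv
    have h2 := (hv.equation φ hφ t).sub (hw.equation φ hφ t)
    simp only [pairing_eq_inner, h1, inner_sub_right] at h2 ⊢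
    refine h2.congr_deriv ?_
    have : grad (v t - w t) = grad (v t) - grad (w t) := by
      funext i; exact weakPartial_sub (hv.memH1 t) (hw.memH1 t) i
    simp only [elasticForm_eq hl hm, this, gradForm_sub_left]
    ring

theorem IsElasticWave.comp_add {v : ℝ → L2} (hv : IsElasticWave lam mu v) (a : ℝ) :
    IsElasticWave lam mu fun t => v (t + a) where
  memH1 t := hv.memH1 _
  continuous_weakPartial i := (hv.continuous_weakPartial i).comp (by fun_prop)
  contDiff := hv.contDiff.comp (by fun_prop)
  equation φ hφ t := by
    simp only [deriv_comp_add_const]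
    exact (hv.equation φ hφ (t + a)).comp_add_const t a

theorem deriv_reverse (v : ℝ → L2) (t : ℝ) : deriv (fun t => v (-t)) t = -deriv v (-t) :=
  deriv_comp_neg v t

theorem IsElasticWave.reverse {v : ℝ → L2} (hv : IsElasticWave lam mu v) :
    IsElasticWave lam mu fun t => v (-t) where
  memH1 t := hv.memH1 _
  continuous_weakPartial i := (hv.continuous_weakPartial i).comp continuous_neg
  contDiff := hv.contDiff.comp contDiff_neg
  equation φ hφ t := by
    simp only [deriv_reverse, pairing_eq_inner, inner_neg_right]
    have h := hv.equation φ hφ (-t)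
    simp only [pairing_eq_inner] at h
    have h2 := (HasDerivAt.scomp t (h := fun t : ℝ => -t) (by simpa using h) (hasDerivAt_neg t)).neg
    refine h2.congr_deriv ?_
    simp

/-- This makes the choice in `propagate` irrelevant: any wave with the right data computes it. -/
theorem IsElasticWave.ext {Ω : Set Pos} (hLame : IsLame Ω lam mu) {v w : ℝ → L2}
    (hv : IsElasticWave lam mu v) (hw : IsElasticWave lam mu w) (h0 : v 0 = w 0)
    (h1 : deriv v 0 = deriv w 0) : v = w := by
  funext t
  refine sub_eq_zero.1 ((hv.sub hLame.memLp_lam hLame.memLp_mu hw).eq_zero hLame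
    (sub_eq_zero.2 h0) ?_ t)
  have h2 : deriv (fun t => v t - w t) 0 = _ := ((hv.hasDerivAt 0).sub (hw.hasDerivAt 0)).deriv
  rw [h2, h1, sub_self]

/-- An exponential weight. -/
theorem lipschitzWith_exp_weight {ψ : Pos → ℝ} {K : NNReal} (hψ : LipschitzWith K ψ) {ρ B : ℝ}
    (hρ : 0 ≤ ρ) (hB : ∀ x, ψ x ≤ B) :
    ∃ C, LipschitzWith C fun x => Real.exp (ρ * ψ x) - 1 := by
  have key : ∀ a b : ℝ, a ≤ ρ * B → Real.exp a - Real.exp b ≤ Real.exp (ρ * B) * |a - b| := by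
    intro a b ha
    have h1 : Real.exp a * (b - a + 1) ≤ Real.exp b := by
      have := mul_le_mul_of_nonneg_left (Real.add_one_le_exp (b - a)) (Real.exp_pos a).le
      rwa [← Real.exp_add, add_sub_cancel] at this
    have h2 : Real.exp a - Real.exp b ≤ Real.exp a * (a - b) := by linarith
    have h3 : Real.exp a * (a - b) ≤ Real.exp a * |a - b| := by gcongr; exact le_abs_self _
    have h4 : Real.exp a * |a - b| ≤ Real.exp (ρ * B) * |a - b| := by gcongr
    linarith
  refine ⟨⟨Real.exp (ρ * B) * (ρ * K), by positivity⟩, LipschitzWith.of_dist_le_mul fun x y => ?_⟩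
  have hx : ρ * ψ x ≤ ρ * B := by gcongr; exact hB x
  have hy : ρ * ψ y ≤ ρ * B := by gcongr; exact hB y
  have h1 := key _ (ρ * ψ y) hx
  have h2 := key _ (ρ * ψ x) hy
  rw [abs_sub_comm] at h2
  have h3 : |ρ * ψ x - ρ * ψ y| ≤ ρ * (K * dist x y) := by
    rw [← mul_sub, abs_mul, abs_of_nonneg hρ]
    gcongr
    exact hψ.dist_le_mul x y
  have h4 : Real.exp (ρ * B) * |ρ * ψ x - ρ * ψ y| ≤ Real.exp (ρ * B) * (ρ * (K * dist x y)) := by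
    gcongr
  rw [Real.dist_eq]
  change _ ≤ Real.exp (ρ * B) * (ρ * K) * dist x y
  rw [abs_le]
  constructor <;> nlinarith

theorem lineDeriv_exp_weight {ψ : Pos → ℝ} {x : Pos} (h : DifferentiableAt ℝ ψ x) (ρ : ℝ)
    (e : Pos) : lineDeriv ℝ (fun x => Real.exp (ρ * ψ x) - 1) x e =
      ρ * Real.exp (ρ * ψ x) * lineDeriv ℝ ψ x e := by
  have h1 : HasFDerivAt (fun x => Real.exp (ρ * ψ x) - 1)
      (Real.exp (ρ * ψ x) • (ρ • fderiv ℝ ψ x)) x :=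
    ((h.hasFDerivAt.const_mul ρ).exp).sub_const 1
  rw [(h1.hasLineDerivAt e).lineDeriv, h.lineDeriv_eq_fderiv]
  simp; ring

/-- Grönwall's argument: `e^{-ρs} (G(s) + m)` is nonincreasing. -/
theorem exp_growth_bound {G M : ℝ → ℝ} {G' : ℝ → ℝ} {ρ m t : ℝ} (ht : 0 ≤ t)
    (hG : ∀ s, HasDerivAt G (G' s) s) (hρ : 0 ≤ ρ) (h0 : G 0 = 0)
    (hM : ∀ s ∈ Icc 0 t, M s ≤ m) (hle : ∀ s, G' s ≤ ρ * (G s + M s)) :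
    G t ≤ (Real.exp (ρ * t) - 1) * m := by
  have hd : ∀ s, HasDerivAt (fun s => Real.exp (-ρ * s) * (G s + m))
      (Real.exp (-ρ * s) * (G' s - ρ * (G s + m))) s := by
    intro s
    have h1 : HasDerivAt (fun s : ℝ => Real.exp (-ρ * s)) (Real.exp (-ρ * s) * (-ρ * 1)) s :=
      ((hasDerivAt_id s).const_mul (-ρ)).exp
    refine (h1.mul ((hG s).add_const m)).congr_deriv ?_
    ring
  have hanti : AntitoneOn (fun s => Real.exp (-ρ * s) * (G s + m)) (Icc 0 t) := by
    refine antitoneOn_of_deriv_nonpos (convex_Icc 0 t)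
      (fun s _ => (hd s).continuousAt.continuousWithinAt)
      (fun s _ => (hd s).differentiableAt.differentiableWithinAt) fun s hs => ?_
    rw [(hd s).deriv]
    rw [interior_Icc] at hs
    have h1 := hM s (Ioo_subset_Icc_self hs)
    have h2 := hle s
    have h3 : ρ * (G s + M s) ≤ ρ * (G s + m) := by gcongr
    exact mul_nonpos_of_nonneg_of_nonpos (Real.exp_pos _).le (by linarith)
  have h1 := hanti (left_mem_Icc.2 ht) (right_mem_Icc.2 ht) ht
  simp only [mul_zero, Real.exp_zero, h0, zero_add, one_mul] at h1
  have h2 := mul_le_mul_of_nonneg_left h1 (Real.exp_pos (ρ * t)).le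
  rw [← mul_assoc, ← Real.exp_add] at h2
  have h3 : ρ * t + -ρ * t = 0 := by ring
  rw [h3, Real.exp_zero] at h2
  linarith

theorem nonpos_of_exp_bound {J M t s : ℝ} (hts : t < s) (hM : 0 ≤ M)
    (h : ∀ ρ : ℝ, 0 ≤ ρ → (Real.exp (ρ * s) - 1) * J ≤ (Real.exp (ρ * t) - 1) * M) (ht : 0 ≤ t) :
    J ≤ 0 := by
  by_contra! hJ
  -- This choice gives `e^{ρ(s-t)} J ≥ (ρ(s - t) + 1) J = M + 2J`, which already contradicts the
  -- bound.
  obtain ⟨ρ, hρ⟩ : ∃ ρ : ℝ, ρ = (M + J) / (J * (s - t)) := ⟨_, rfl⟩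
  have hst : 0 < s - t := sub_pos.2 hts
  have hρ0 : 0 ≤ ρ := by rw [hρ]; positivity
  have h1 := h ρ hρ0
  have e : ρ * s = ρ * t + ρ * (s - t) := by ring
  have h2 : ρ * (s - t) * J = M + J := by rw [hρ]; field_simp
  have h3 := Real.add_one_le_exp (ρ * (s - t))
  have h4 : 1 ≤ Real.exp (ρ * t) := Real.one_le_exp (by positivity)
  rw [e, Real.exp_add] at h1
  have h5 : (ρ * (s - t) + 1) * J ≤ Real.exp (ρ * (s - t)) * J := by gcongr
  have h6 := mul_le_mul_of_nonneg_left h5 (by linarith : 0 ≤ Real.exp (ρ * t))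
  nlinarith

/-- Finite speed of propagation, with the domain of dependence described by a subsolution `ψ` of the
eikonal equation of the `P`-wave speed. -/
theorem IsElasticWave.vanishesOn_of_eikonal {Ω W : Set Pos} (hLame : IsLame Ω lam mu)
    {v : ℝ → L2} (hv : IsElasticWave lam mu v) (hW : IsOpen W)
    (hstat : IsStationaryOn lam mu W (v 0, deriv v 0)) {ψ : Pos → ℝ} {K : NNReal}
    (hψ : LipschitzWith K ψ) (hψ0 : ∀ x, 0 ≤ ψ x) (hc : HasCompactSupport ψ) (hψW : tsupport ψ ⊆ W)
    (heik : ∀ᵐ x, (lam x + 2 * mu x) * ∑ i, lineDeriv ℝ ψ x (basisVec i) ^ 2 ≤ 1) {t : ℝ}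
    (ht : 0 ≤ t) : VanishesOn {x | t < ψ x} (v t - v 0) := by
  obtain ⟨κ, hκ, hco⟩ := hLame.convex
  have hl := hLame.memLp_lam
  have hm := hLame.memLp_mu
  have hf := hv.memH1 0
  obtain ⟨B, hB⟩ : ∃ B, ∀ x, ψ x ≤ B := by
    obtain ⟨B, hB⟩ := hc.exists_bound_of_continuous hψ.continuous
    exact ⟨B, fun x => (le_abs_self _).trans (hB x)⟩
  have hone : MemLp (fun _ : Pos => (1 : ℝ)) ∞ volume := memLp_top_const 1
  -- the total energy is bounded on `[0, t]`
  have hMd : ∀ s, HasDerivAt (fun s => weightedEnergy hl hm _ hone (v s - v 0) (gradInt v (v 0) s))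
      _ s := fun s => hasDerivAt_weightedEnergy hl hm _ hone ((hv.hasDerivAt s).sub_const (v 0))
        (hv.hasDerivAt_gradInt hf s)
  set M : ℝ → ℝ := fun s => weightedEnergy hl hm _ hone (v s - v 0) (gradInt v (v 0) s) with hMdef
  have hMc : Continuous M := continuous_iff_continuousAt.2 fun s => (hMd s).continuousAt
  have hM : ∀ s, M s = ∫ x, density lam mu (v s - v 0) (gradInt v (v 0) s) x := by
    intro s; simp only [hMdef, weightedEnergy_eq, one_mul]
  have hdint : ∀ s, Integrable (density lam mu (v s - v 0) (gradInt v (v 0) s)) := by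
    intro s
    have := integrable_weight_density hl hm hone (v s - v 0) (gradInt v (v 0) s)
    simpa only [one_mul] using this
  obtain ⟨m, hm'⟩ : ∃ m, ∀ s ∈ Icc 0 t, M s ≤ m := by
    obtain ⟨m, hm'⟩ := isCompact_Icc.bddAbove_image (hMc.continuousOn (s := Icc 0 t))
    exact ⟨m, fun s hs => hm' (mem_image_of_mem _ hs)⟩
  have hm0 : 0 ≤ m := by
    refine le_trans ?_ (hm' 0 (left_mem_Icc.2 ht))
    rw [hM]; exact integral_nonneg fun x => density_nonneg hκ hco _ _ x
  -- the weighted energy estimate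
  have key : ∀ ρ : ℝ, 0 ≤ ρ → ∫ x, (Real.exp (ρ * ψ x) - 1) *
      density lam mu (v t - v 0) (gradInt v (v 0) t) x ≤ (Real.exp (ρ * t) - 1) * m := by
    intro ρ hρ
    obtain ⟨C, hC⟩ := lipschitzWith_exp_weight hψ hρ hB
    have hb : MemLp (fun x => Real.exp (ρ * ψ x) - 1) ∞ volume := by
      refine memLp_top_of_continuous hC.continuous (B := Real.exp (ρ * B)) fun x => ?_
      have h1 : 1 ≤ Real.exp (ρ * ψ x) := Real.one_le_exp (mul_nonneg hρ (hψ0 x))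
      have h2 : Real.exp (ρ * ψ x) ≤ Real.exp (ρ * B) := by
        gcongr; exact hB x
      rw [abs_le]; constructor <;> linarith
    have hsb : MemLp (fun x => ρ * Real.exp (ρ * ψ x)) ∞ volume := by
      refine ((hb.add hone).const_mul ρ).ae_eq (Eventually.of_forall fun x => ?_)
      simp
    have hG : ∀ s, HasDerivAt
        (fun s => weightedEnergy hl hm _ hb (v s - v 0) (gradInt v (v 0) s))
        (-2 * (gradForm hl hm (gradInt v (v 0) s) fun i =>
          mulOp _ (memLp_top_lineDeriv hC (basisVec i)) (v s - v 0)).re) s := by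
      intro s
      have hu : MemH1 (v s - v 0) := (hv.memH1 s).sub hf
      -- Subtracting `1` makes the weight vanish where `ψ = 0`. The weighted field is therefore
      -- supported in `W`, where stationarity of the initial data removes their contribution.
      have hφ : MemH10 W (mulOp _ hb (v s - v 0)) := by
        refine (hu.mulOp hC hb).memH10_of_isCompact hc hW hψW ?_
        filter_upwards [coeFn_mulOp _ hb (v s - v 0)] with x hx hx'
        rw [hx, image_eq_zero_of_notMem_tsupport hx']
        simp
      refine hv.hasDerivAt_energy hl hm hf hC hb s
        (hv.inner_deriv_eq hl hm hf hφ.memH1 ?_ (hstat.2.2 _ hφ) s)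
      rw [L2.inner_def]
      refine integral_eq_zero_of_ae ?_
      filter_upwards [hstat.2.1, hφ.vanishesOn] with x h1 h2
      by_cases hx : x ∈ W
      · rw [h1 hx, inner_zero_right]; rfl
      · rw [h2 hx, inner_zero_left]; rfl
    -- Here `G` is the energy with weight `e^{ρψ} - 1` and `M` the total energy, so `G + M` is the
    -- energy with weight `e^{ρψ}`, which controls the flux.
    have h1 := exp_growth_bound (M := M) ht hG hρ ?_ hm' ?_
    · rwa [weightedEnergy_eq] at h1
    · rw [sub_self, gradInt_zero]; simp [weightedEnergy, gradForm_zero_left]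
    · intro s
      have h2 := flux_integral_le hl hm hκ hco _
        (fun i => memLp_top_lineDeriv hC (basisVec i)) hsb (fun x => by positivity) ?_
        (v s - v 0) (gradInt v (v 0) s)
      · refine (le_trans ?_ h2).trans (le_of_eq ?_)
        · rw [← abs_of_pos (two_pos : (0 : ℝ) < 2), ← abs_mul, neg_mul,
            abs_of_pos (two_pos : (0 : ℝ) < 2)]
          exact neg_le_abs _
        · rw [weightedEnergy_eq, hM, ← integral_add
            (integrable_weight_density hl hm hb _ _) (hdint s), ← integral_const_mul]
          refine integral_congr_ae (Eventually.of_forall fun x => ?_)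
          dsimp only; ring
      -- Since `∇χ = ρ e^{ρψ} ∇ψ`, the eikonal inequality is exactly the hypothesis of the flux
      -- bound with `s = ρ e^{ρψ}`.
      · filter_upwards [heik, hψ.ae_differentiableAt] with x h3 h4
        simp only [lineDeriv_exp_weight h4, mul_pow, ← Finset.mul_sum]
        have h5 : 0 ≤ ρ ^ 2 * Real.exp (ρ * ψ x) ^ 2 := by positivity
        nlinarith [mul_le_mul_of_nonneg_left h3 h5]
  -- conclusion
  have hv0 : ∀ s, t < s → VanishesOn {x | s ≤ ψ x} (v t - v 0) := by
    intro s hs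
    have hSm : MeasurableSet {x | s ≤ ψ x} := measurableSet_le measurable_const hψ.continuous.measurable
    have hint : IntegrableOn (density lam mu (v t - v 0) (gradInt v (v 0) t)) {x | s ≤ ψ x} :=
      (hdint t).integrableOn
    -- Where `ψ ≥ s` the weight is at least `e^{ρs} - 1`, whereas the energy grows at most like
    -- `e^{ρt} - 1`. As `s > t`, letting `ρ` grow forces the energy there to vanish.
    have hJ : ∫ x in {x | s ≤ ψ x}, density lam mu (v t - v 0) (gradInt v (v 0) t) x ≤ 0 := by
      refine nonpos_of_exp_bound hs hm0 (fun ρ hρ => le_trans ?_ (key ρ hρ)) ht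
      obtain ⟨C, hC⟩ := lipschitzWith_exp_weight hψ hρ hB
      have hb : MemLp (fun x => Real.exp (ρ * ψ x) - 1) ∞ volume := by
        refine memLp_top_of_continuous hC.continuous (B := Real.exp (ρ * B)) fun x => ?_
        have h1 : 1 ≤ Real.exp (ρ * ψ x) := Real.one_le_exp (mul_nonneg hρ (hψ0 x))
        have h2 : Real.exp (ρ * ψ x) ≤ Real.exp (ρ * B) := by
          gcongr; exact hB x
        rw [abs_le]; constructor <;> linarith
      have hwi := integrable_weight_density hl hm hb (v t - v 0) (gradInt v (v 0) t)
      rw [← integral_const_mul]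
      refine (setIntegral_mono_on (hint.const_mul _) hwi.integrableOn hSm fun x hx => ?_).trans
        (setIntegral_le_integral hwi (Eventually.of_forall fun x => ?_))
      · have h1 : ρ * s ≤ ρ * ψ x := by gcongr; exact hx
        have := density_nonneg hκ hco (v t - v 0) (gradInt v (v 0) t) x
        gcongr
      · have h1 : 1 ≤ Real.exp (ρ * ψ x) := Real.one_le_exp (mul_nonneg hρ (hψ0 x))
        exact mul_nonneg (by linarith) (density_nonneg hκ hco _ _ x)
    have hJ' := le_antisymm hJ (setIntegral_nonneg hSm fun x _ => density_nonneg hκ hco _ _ x)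
    have h6 := (setIntegral_eq_zero_iff_of_nonneg_ae
      (Eventually.of_forall fun x => density_nonneg hκ hco _ _ x) hint).1 hJ'
    rw [EventuallyEq, ae_restrict_iff' hSm] at h6
    filter_upwards [h6] with x hx hxs
    have h8 := sq_norm_le_density hκ hco (v t - v 0) (gradInt v (v 0) t) x
    rw [hx hxs] at h8
    simpa using h8
  have h9 : ∀ᵐ x ∂(volume : Measure Pos), ∀ n : ℕ, t + 1 / ((n : ℝ) + 1) ≤ ψ x → (v t - v 0) x = 0 :=
    ae_all_iff.2 fun n => hv0 _ (by have : 0 < 1 / ((n : ℝ) + 1) := by positivity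
                                    linarith)
  filter_upwards [h9] with x hx hxt
  obtain ⟨n, hn⟩ := exists_nat_one_div_lt (sub_pos.2 hxt)
  exact hx n (by linarith)

/-- Times before `a` are reached by reversing the wave, which preserves stationarity. -/
theorem IsElasticWave.vanishesOn_of_eikonal_abs {Ω W : Set Pos} (hLame : IsLame Ω lam mu)
    {v : ℝ → L2} (hv : IsElasticWave lam mu v) (hW : IsOpen W) {a : ℝ}
    (hstat : IsStationaryOn lam mu W (v a, deriv v a)) {ψ : Pos → ℝ} {K : NNReal}
    (hψ : LipschitzWith K ψ) (hψ0 : ∀ x, 0 ≤ ψ x) (hc : HasCompactSupport ψ) (hψW : tsupport ψ ⊆ W)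
    (heik : ∀ᵐ x, (lam x + 2 * mu x) * ∑ i, lineDeriv ℝ ψ x (basisVec i) ^ 2 ≤ 1) (t : ℝ) :
    VanishesOn {x | |t - a| < ψ x} (v t - v a) := by
  have hva := hv.comp_add a
  have hd : deriv (fun t => v (t + a)) 0 = deriv v a := by rw [deriv_comp_add_const, zero_add]
  rcases le_total a t with h | h
  · have h1 := hva.vanishesOn_of_eikonal hLame hW (by rw [hd, zero_add]; exact hstat) hψ hψ0 hc hψW
      heik (sub_nonneg.2 h)
    rw [abs_of_nonneg (sub_nonneg.2 h)]
    simpa using h1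
  · have h2 : IsStationaryOn lam mu W (v (-0 + a), deriv (fun t => v (-t + a)) 0) := by
      have h3 : deriv (fun t => v (-t + a)) 0 = -deriv v a := by
        rw [← hd]; simpa using deriv_reverse (fun t => v (t + a)) 0
      rw [h3, neg_zero, zero_add]
      exact ⟨hstat.1, hstat.2.1.neg, hstat.2.2⟩
    have h1 := hva.reverse.vanishesOn_of_eikonal hLame hW h2 hψ hψ0 hc hψW heik (sub_nonneg.2 h)
    rw [abs_sub_comm, abs_of_nonneg (sub_nonneg.2 h)]
    simpa using h1


/-! ### Korn and Poincaré inequalities -/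

/-- Move the derivative off `a`, use the symmetry of the second derivative of `b`, and move it back.
Compact support of `a` alone removes the boundary terms. -/
theorem integral_partial_mul_partial_swap {a b : Pos → ℂ} (ha : ContDiff ℝ ∞ a)
    (hb : ContDiff ℝ ∞ b) (hac : HasCompactSupport a) (e e' : Pos) :
    ∫ x, fderiv ℝ a x e * fderiv ℝ b x e' = ∫ x, fderiv ℝ a x e' * fderiv ℝ b x e := by
  have hb' : ∀ e, ContDiff ℝ ∞ fun x => fderiv ℝ b x e := fun e =>
    (hb.fderiv_right (m := ∞) (by simp)).clm_apply contDiff_const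
  have step : ∀ e e', ∫ x, fderiv ℝ a x e * fderiv ℝ b x e' =
      -∫ x, a x * fderiv ℝ (fun x => fderiv ℝ b x e') x e := by
    intro e e'
    rw [integral_mul_fderiv_eq_neg_fderiv_mul_of_integrable (v := e), neg_neg]
    · exact ((continuous_partial ha e).mul (hb' e').continuous).integrable_of_hasCompactSupport
        (hasCompactSupport_partial hac e).mul_right
    · exact (ha.continuous.mul (continuous_partial (hb' e') e)).integrable_of_hasCompactSupport
        hac.mul_right
    · exact (ha.continuous.mul (hb' e').continuous).integrable_of_hasCompactSupport hac.mul_right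
    · exact fun x _ => ha.differentiable (by simp) x
    · exact fun x _ => (hb' e').differentiable (by simp) x
  rw [step, step]
  congr 2
  funext x
  congr 1
  have hs : IsSymmSndFDerivAt ℝ b x :=
    (hb.contDiffAt (x := x)).isSymmSndFDerivAt
      (by rw [minSmoothness_of_isRCLikeNormedField]; exact WithTop.coe_le_coe.2 (le_top (a := (2 : ℕ∞))))
  have hd : DifferentiableAt ℝ (fderiv ℝ b) x :=
    (hb.fderiv_right (m := ∞) (by simp)).differentiable (by simp) x
  have hval : ∀ e e', fderiv ℝ (fun x => fderiv ℝ b x e') x e = fderiv ℝ (fderiv ℝ b) x e e' := by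
    intro e e'
    rw [fderiv_clm_apply hd (differentiableAt_const e')]
    simp
  rw [hval, hval]
  exact hs e e'

theorem sum_sq_strain_eq (F : Fin 3 → C3) :
    ∑ i, ∑ j, ‖(F i j + F j i) / 2‖ ^ 2 =
      2⁻¹ * ∑ i, ‖F i‖ ^ 2 + 2⁻¹ * (∑ i, ∑ j, F i j * conj (F j i)).re := by
  simp only [EuclideanSpace.norm_sq_eq, Fin.sum_univ_three, Complex.sq_norm, Complex.normSq_apply,
    Complex.add_re, Complex.add_im, Complex.mul_re, Complex.conj_re, Complex.conj_im,
    Complex.div_ofNat_re, Complex.div_ofNat_im]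
  ring

variable {lam mu : Pos → ℝ} {U : Set Pos} {φ : Pos → C3}

theorem fderiv_coord (h : ContDiff ℝ ∞ φ) (x e : Pos) (j : Fin 3) :
    fderiv ℝ (fun x => φ x j) x e = fderiv ℝ φ x e j := by
  have h1 := (((EuclideanSpace.proj j : C3 →L[ℂ] ℂ).restrictScalars ℝ).hasFDerivAt.comp x
    (h.differentiable (by simp) x).hasFDerivAt)
  have h2 : fderiv ℝ (fun x => φ x j) x = _ := h1.fderiv
  rw [h2]; rfl

theorem fderiv_conj_coord (h : ContDiff ℝ ∞ φ) (x e : Pos) (j : Fin 3) :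
    fderiv ℝ (fun x => conj (φ x j)) x e = conj (fderiv ℝ φ x e j) := by
  have h1 := Complex.conjCLE.toContinuousLinearMap.hasFDerivAt.comp x
    (((EuclideanSpace.proj j : C3 →L[ℂ] ℂ).restrictScalars ℝ).hasFDerivAt.comp x
    (h.differentiable (by simp) x).hasFDerivAt)
  have h2 : fderiv ℝ (fun x => conj (φ x j)) x = _ := h1.fderiv
  rw [h2]; rfl

/-- Interchanging the two derivatives turns the integral into that of `|div φ|²`. -/
theorem IsTestField.integral_transpose_nonneg (h : IsTestField U φ) :
    0 ≤ ∫ x, (∑ i, ∑ j, fderiv ℝ φ x (basisVec i) j * conj (fderiv ℝ φ x (basisVec j) i)).re := by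
  have hcoord : ∀ j, ContDiff ℝ ∞ fun x => φ x j := fun j =>
    ((EuclideanSpace.proj j : C3 →L[ℂ] ℂ).restrictScalars ℝ).contDiff.comp h.contDiff
  have hconj : ∀ j, ContDiff ℝ ∞ fun x => conj (φ x j) := fun j =>
    Complex.conjCLE.contDiff.comp (hcoord j)
  have hsupp : ∀ j, HasCompactSupport fun x => φ x j := fun j =>
    h.hasCompactSupport.comp_left (g := fun z : C3 => z j) rfl
  have hint : ∀ (i j k l : Fin 3), Integrable fun x =>
      fderiv ℝ φ x (basisVec i) j * conj (fderiv ℝ φ x (basisVec k) l) := by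
    intro i j k l
    have h1 : ∀ i j, Continuous fun x => fderiv ℝ φ x (basisVec i) j := fun i j =>
      (EuclideanSpace.proj j : C3 →L[ℂ] ℂ).continuous.comp (continuous_partial h.contDiff _)
    have h2 : HasCompactSupport fun x => fderiv ℝ φ x (basisVec i) j :=
      (hasCompactSupport_partial h.hasCompactSupport (basisVec i)).comp_left
        (g := fun z : C3 => z j) rfl
    exact ((h1 i j).mul (Complex.continuous_conj.comp (h1 k l))).integrable_of_hasCompactSupport
      h2.mul_right
  have hswap : ∀ i j, ∫ x, fderiv ℝ φ x (basisVec i) j * conj (fderiv ℝ φ x (basisVec j) i) =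
      ∫ x, fderiv ℝ φ x (basisVec j) j * conj (fderiv ℝ φ x (basisVec i) i) := by
    intro i j
    have := integral_partial_mul_partial_swap (hcoord j) (hconj i) (hsupp j) (basisVec i)
      (basisVec j)
    simpa only [fderiv_coord h.contDiff, fderiv_conj_coord h.contDiff] using this
  have e1 : ∫ x, ∑ i, ∑ j, fderiv ℝ φ x (basisVec i) j * conj (fderiv ℝ φ x (basisVec j) i) =
      ∫ x, ∑ i, ∑ j, fderiv ℝ φ x (basisVec j) j * conj (fderiv ℝ φ x (basisVec i) i) := by
    rw [integral_finsetSum _ fun i _ => integrable_finsetSum _ fun j _ => hint i j j i,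
      integral_finsetSum _ fun i _ => integrable_finsetSum _ fun j _ => hint j j i i]
    refine Finset.sum_congr rfl fun i _ => ?_
    rw [integral_finsetSum _ fun j _ => hint i j j i, integral_finsetSum _ fun j _ => hint j j i i]
    exact Finset.sum_congr rfl fun j _ => hswap i j
  have e2 := integral_re (integrable_finsetSum Finset.univ fun i _ =>
    integrable_finsetSum Finset.univ fun j _ => hint i j j i)
  simp only [RCLike.re_to_complex] at e2
  rw [e2, e1]
  have e3 : ∀ x, ∑ i, ∑ j, fderiv ℝ φ x (basisVec j) j * conj (fderiv ℝ φ x (basisVec i) i) =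
      ((‖∑ i, fderiv ℝ φ x (basisVec i) i‖ ^ 2 : ℝ) : ℂ) := by
    intro x
    rw [Complex.ofReal_pow, ← Complex.mul_conj', map_sum, Finset.mul_sum]
    exact Finset.sum_congr rfl fun i _ => (Finset.sum_mul _ _ _).symm
  simp only [e3]
  rw [integral_complex_ofReal, Complex.ofReal_re]
  exact integral_nonneg fun x => by positivity

theorem norm_sq_eq_integral (f : L2) : ‖f‖ ^ 2 = ∫ x, ‖f x‖ ^ 2 := by
  have h := inner_self_eq_norm_sq (𝕜 := ℂ) f
  have e := integral_re (L2.integrable_inner (𝕜 := ℂ) f f)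
  rw [L2.inner_def, ← e] at h
  rw [← h]
  exact integral_congr_ae (Eventually.of_forall fun x => inner_self_eq_norm_sq (𝕜 := ℂ) _)

theorem integrable_norm_sq (f : L2) : Integrable fun x => ‖f x‖ ^ 2 := by
  refine (L2.integrable_inner (𝕜 := ℂ) f f).re.congr (Eventually.of_forall fun x => ?_)
  exact inner_self_eq_norm_sq (𝕜 := ℂ) _

/-- Pointwise `|ε|² = ½|∇φ|² + ½ Re Σ ∂ᵢφⱼ conj(∂ⱼφᵢ)`, and the last term has nonnegative integral.
This is the first Korn inequality, with a constant independent of the region. -/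
theorem IsTestField.korn (h : IsTestField U φ) (hl : MemLp lam ∞ volume) (hm : MemLp mu ∞ volume)
    {κ : ℝ} (hκ : 0 < κ) (hc : ∀ x, κ ≤ mu x ∧ κ ≤ 3 * lam x + 2 * mu x) :
    κ / 2 * ∑ i, ‖h.partialL2 i‖ ^ 2 ≤ (gradForm hl hm h.partialL2 h.partialL2).re := by
  have hform := integrable_formAt hl hm h.partialL2 h.partialL2
  have e0 := integral_re hform
  simp only [RCLike.re_to_complex] at e0
  rw [gradForm_eq_integral, ← e0]
  have hsq := integrable_finsetSum Finset.univ fun i _ => integrable_norm_sq (h.partialL2 i)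
  have hall : ∀ᵐ x, ∀ i, h.partialL2 i x = fderiv ℝ φ x (basisVec i) :=
    ae_all_iff.2 fun i => (h.memLp_partial i).coeFn_toLp
  have hpt : ∀ᵐ x, κ * (2⁻¹ * ∑ i, ‖h.partialL2 i x‖ ^ 2) + κ * (2⁻¹ * (∑ i, ∑ j,
      fderiv ℝ φ x (basisVec i) j * conj (fderiv ℝ φ x (basisVec j) i)).re) ≤
      (formAt (lam x) (mu x) (fun k => h.partialL2 k x) fun k => h.partialL2 k x).re := by
    filter_upwards [hall] with x hx
    have := le_formAt_self (hc x).1 hκ (hc x).2 fun k => h.partialL2 k x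
    rw [sum_sq_strain_eq, mul_add] at this
    simpa only [hx] using this
  have hint2 : Integrable fun x =>
      (∑ i, ∑ j, fderiv ℝ φ x (basisVec i) j * conj (fderiv ℝ φ x (basisVec j) i)).re := by
    refine Continuous.integrable_of_hasCompactSupport ?_ ?_
    · refine Complex.continuous_re.comp (continuous_finsetSum _ fun i _ =>
        continuous_finsetSum _ fun j _ => ?_)
      have hco : ∀ i j, Continuous fun x => fderiv ℝ φ x (basisVec i) j := fun i j =>
        (EuclideanSpace.proj j : C3 →L[ℂ] ℂ).continuous.comp (continuous_partial h.contDiff _)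
      exact (hco i j).mul (Complex.continuous_conj.comp (hco j i))
    · refine (h.hasCompactSupport.fderiv ℝ).comp_left
        (g := fun L : Pos →L[ℝ] C3 => (∑ i, ∑ j, L (basisVec i) j * conj (L (basisVec j) i)).re) ?_
      simp
  refine le_trans ?_ (integral_mono_ae (((hsq.const_mul _).const_mul _).add
    ((hint2.const_mul _).const_mul _)) hform.re hpt)
  rw [integral_add' ((hsq.const_mul _).const_mul _) ((hint2.const_mul _).const_mul _),
    integral_const_mul, integral_const_mul, integral_const_mul, integral_const_mul,
    integral_finsetSum _ fun i _ => integrable_norm_sq (h.partialL2 i)]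
  simp only [← norm_sq_eq_integral]
  have := h.integral_transpose_nonneg
  have h3 : 0 ≤ κ * (2⁻¹ * ∫ x, (∑ i, ∑ j,
      fderiv ℝ φ x (basisVec i) j * conj (fderiv ℝ φ x (basisVec j) i)).re) := by positivity
  linarith

theorem norm_le_sum_basis (A : Pos →L[ℝ] C3) : ‖A‖ ≤ ∑ i, ‖A (basisVec i)‖ := by
  refine A.opNorm_le_bound (by positivity) fun z => ?_
  have hz : z = ∑ i, z i • basisVec i := by
    ext k
    simp [basisVec, Finset.sum_apply, Pi.single_apply]
  conv_lhs => rw [hz]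
  rw [map_sum, Finset.sum_mul]
  refine (norm_sum_le _ _).trans (Finset.sum_le_sum fun i _ => ?_)
  rw [map_smul, norm_smul, mul_comm]
  gcongr
  exact PiLp.norm_apply_le z i

/-- The Gagliardo–Nirenberg–Sobolev inequality with both exponents `2`, for fields supported in a
bounded set. The operator norm of the derivative is bounded by the sum over the basis vectors. -/
theorem exists_poincare (hU : Bornology.IsBounded U) : ∃ C : ℝ, 0 ≤ C ∧
    ∀ (φ : Pos → C3) (h : IsTestField U φ), ‖h.toL2‖ ≤ C * ∑ i, ‖h.partialL2 i‖ := by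
  refine ⟨(eLpNormLESNormFDerivOfLeConst C3 (volume : Measure Pos) U 2 2 : ℝ), by positivity,
    fun φ h => ?_⟩
  have h1 := eLpNorm_le_eLpNorm_fderiv_of_le (μ := (volume : Measure Pos)) (F := C3) (u := φ)
    (s := U) (p := 2) (q := 2) (h.contDiff.of_le (by simp))
    ((subset_tsupport φ).trans h.tsupport_subset) (by norm_num) (by simp; norm_num) (by simp) hU
  have h2 : eLpNorm (fderiv ℝ φ) 2 volume ≤
      ∑ i, eLpNorm (fun x => fderiv ℝ φ x (basisVec i)) 2 volume := by
    have h3 : eLpNorm (fderiv ℝ φ) 2 volume ≤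
        eLpNorm (∑ i, fun x => ‖fderiv ℝ φ x (basisVec i)‖) 2 volume := by
      refine eLpNorm_mono_real fun x => ?_
      simpa using norm_le_sum_basis (fderiv ℝ φ x)
    refine h3.trans ((eLpNorm_sum_le (fun i _ => ?_) (by norm_num)).trans ?_)
    · exact (continuous_partial h.contDiff _).norm.aestronglyMeasurable
    · simp only [eLpNorm_norm]; rfl
  have e1 : ‖h.toL2‖ = (eLpNorm φ 2 volume).toReal := Lp.norm_toLp _ _
  have e2 : ∀ i, ‖h.partialL2 i‖ =
      (eLpNorm (fun x => fderiv ℝ φ x (basisVec i)) 2 volume).toReal := fun i => Lp.norm_toLp _ _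
  simp only [e1, e2]
  rw [← ENNReal.toReal_sum fun i _ => (h.memLp_partial i).2.ne, ← ENNReal.coe_toReal,
    ← ENNReal.toReal_mul]
  refine ENNReal.toReal_mono (ENNReal.mul_ne_top ENNReal.coe_ne_top
    (ENNReal.sum_ne_top.2 fun i _ => (h.memLp_partial i).2.ne)) ?_
  refine le_trans (by simpa using h1) ?_
  gcongr


/-! ### The orthogonal projection -/

section Projection

variable {lam mu : Pos → ℝ} {U : Set Pos}

/-- Displacement gradients with the Hilbert norm. -/
abbrev GradSpace : Type := PiLp 2 fun _ : Fin 3 => L2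

/-- The closed span of the gradients of test fields in `U`. -/
def gradClosure (U : Set Pos) : Submodule ℂ GradSpace :=
  Submodule.topologicalClosure
    { carrier := {E | ∃ (φ : Pos → C3) (h : IsTestField U φ), E = WithLp.toLp 2 h.partialL2}
      add_mem' := by
        rintro _ _ ⟨φ, h, rfl⟩ ⟨ψ, h', rfl⟩
        refine ⟨_, h.add h', ?_⟩
        ext1 i
        exact (h.partialL2_add h' i).symm
      zero_mem' := by
        refine ⟨0, IsTestField.zero U, ?_⟩
        ext1 i
        have := (IsTestField.zero U).partialL2_sub (IsTestField.zero U) i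
        simp only [sub_self] at this
        exact this.symm
      smul_mem' := by
        rintro c _ ⟨φ, h, rfl⟩
        refine ⟨_, h.smul c, ?_⟩
        ext1 i
        exact (h.partialL2_smul c i).symm }

theorem mem_gradClosure_iff {E : GradSpace} : E ∈ gradClosure U ↔
    ∃ (φ : ℕ → Pos → C3) (h : ∀ n, IsTestField U (φ n)),
      ∀ i, Tendsto (fun n => (h n).partialL2 i) atTop (𝓝 (E i)) := by
  rw [gradClosure, ← SetLike.mem_coe, Submodule.topologicalClosure_coe, mem_closure_iff_seq_limit]
  constructor
  · rintro ⟨x, hx, hlim⟩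
    choose φ h hφ using hx
    refine ⟨φ, h, fun i => ?_⟩
    have := ((PiLp.continuous_apply 2 (fun _ : Fin 3 => L2) i).tendsto E).comp hlim
    refine this.congr fun n => ?_
    simp [hφ]
  · rintro ⟨φ, h, hlim⟩
    refine ⟨fun n => WithLp.toLp 2 (h n).partialL2, fun n => ⟨φ n, h n, rfl⟩, ?_⟩
    exact ((PiLp.continuous_toLp 2 fun _ : Fin 3 => L2).tendsto E.ofLp).comp
      (tendsto_pi_nhds.2 hlim)

theorem MemH10.grad_mem {f : L2} (hf : MemH10 U f) : WithLp.toLp 2 (grad f) ∈ gradClosure U := by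
  obtain ⟨-, φ, h, -, h2⟩ := memH10_iff.1 hf
  exact mem_gradClosure_iff.2 ⟨φ, h, h2⟩

/-- By Poincaré, convergence of gradients makes the test fields themselves Cauchy, and the weak
derivative is a closed operator. The limit is thus a field with the prescribed gradient. -/
theorem exists_memH10_of_mem_gradClosure (hU : Bornology.IsBounded U) {E : GradSpace}
    (hE : E ∈ gradClosure U) : ∃ f, MemH10 U f ∧ ∀ i, weakPartial i f = E i := by
  obtain ⟨C, hC, hP⟩ := exists_poincare hU
  obtain ⟨φ, h, hlim⟩ := mem_gradClosure_iff.1 hE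
  have hsum : CauchySeq fun n => fun i => (h n).partialL2 i :=
    (tendsto_pi_nhds.2 hlim).cauchySeq
  have hcau : CauchySeq fun n => (h n).toL2 := by
    rw [Metric.cauchySeq_iff] at hsum ⊢
    intro ε hε
    -- Three components and the constant `C` give `3Cε / (3C + 1) < ε`; the extra `1` covers `C =
    -- 0`.
    obtain ⟨N, hN⟩ := hsum (ε / (3 * C + 1)) (by positivity)
    refine ⟨N, fun m hm n hn => ?_⟩
    have h1 := hN m hm n hn
    rw [dist_pi_lt_iff (by positivity)] at h1
    have h2 := hP _ ((h m).sub (h n))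
    rw [IsTestField.toL2_sub] at h2
    rw [dist_eq_norm]
    refine h2.trans_lt ?_
    have h3 : ∑ i, ‖((h m).sub (h n)).partialL2 i‖ ≤ ∑ i : Fin 3, ε / (3 * C + 1) :=
      Finset.sum_le_sum fun i _ => by
        rw [IsTestField.partialL2_sub, ← dist_eq_norm]; exact (h1 i).le
    rw [Finset.sum_const, Finset.card_univ, Fintype.card_fin, nsmul_eq_mul] at h3
    refine (mul_le_mul_of_nonneg_left h3 hC).trans_lt ?_
    have : C * ((3 : ℕ) * (ε / (3 * C + 1))) = ε * (3 * C / (3 * C + 1)) := by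
      push_cast; ring
    rw [this]
    have h4 : 3 * C / (3 * C + 1) < 1 := by rw [div_lt_one (by positivity)]; linarith
    nlinarith
  obtain ⟨f, hf⟩ := cauchySeq_tendsto_of_complete hcau
  have hw : ∀ i, HasWeakPartial i f (E i) := fun i =>
    (isClosed_hasWeakPartial i).mem_of_tendsto (hf.prodMk_nhds (hlim i))
      (Eventually.of_forall fun n => (h n).hasWeakPartial i)
  refine ⟨f, memH10_iff.2 ⟨fun i => ⟨_, hw i⟩, φ, h, hf, fun i => ?_⟩, fun i => (hw i).weakPartial_eq⟩
  rw [(hw i).weakPartial_eq]; exact hlim i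

variable (hl : MemLp lam ∞ volume) (hm : MemLp mu ∞ volume)

theorem tendsto_gradForm {F G : ℕ → Fin 3 → L2} {A B : Fin 3 → L2}
    (hF : Tendsto F atTop (𝓝 A)) (hG : Tendsto G atTop (𝓝 B)) :
    Tendsto (fun n => gradForm hl hm (F n) (G n)) atTop (𝓝 (gradForm hl hm A B)) := by
  unfold gradForm
  refine tendsto_finsetSum _ fun i _ => ?_
  exact (tendsto_pi_nhds.1 hG i).inner (((stress hl hm i).continuous.tendsto A).comp hF)

theorem gradClosure_korn {κ : ℝ} (hκ : 0 < κ) (hc : ∀ x, κ ≤ mu x ∧ κ ≤ 3 * lam x + 2 * mu x)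
    {F : Fin 3 → L2} (hF : WithLp.toLp 2 F ∈ gradClosure U) :
    κ / 2 * ∑ i, ‖F i‖ ^ 2 ≤ (gradForm hl hm F F).re := by
  obtain ⟨φ, h, hlim⟩ := mem_gradClosure_iff.1 hF
  have h1 : Tendsto (fun n => (h n).partialL2) atTop (𝓝 F) := tendsto_pi_nhds.2 hlim
  have h2 : Tendsto (fun n => κ / 2 * ∑ i, ‖(h n).partialL2 i‖ ^ 2) atTop
      (𝓝 (κ / 2 * ∑ i, ‖F i‖ ^ 2)) :=
    (tendsto_finsetSum _ fun i _ => ((hlim i).norm.pow 2)).const_mul _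
  have h4 := (Complex.continuous_re.tendsto (gradForm hl hm F F)).comp
    (tendsto_gradForm hl hm h1 h1)
  exact le_of_tendsto_of_tendsto' h2 h4 fun n => (h n).korn hl hm hκ hc

theorem gradForm_add_left (F F' G : Fin 3 → L2) :
    gradForm hl hm (F + F') G = gradForm hl hm F G + gradForm hl hm F' G := by
  simp only [gradForm, map_add, inner_add_right, Finset.sum_add_distrib]

theorem gradForm_smul_left (c : ℂ) (F G : Fin 3 → L2) :
    gradForm hl hm (c • F) G = c * gradForm hl hm F G := by
  simp only [gradForm, map_smul, inner_smul_right, Finset.mul_sum]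

theorem gradForm_smul_right (c : ℂ) (F G : Fin 3 → L2) :
    gradForm hl hm F (c • G) = conj c * gradForm hl hm F G := by
  simp only [gradForm, Pi.smul_apply, inner_smul_left, Finset.mul_sum]

theorem norm_gradForm_le (F G : GradSpace) :
    ‖gradForm hl hm F.ofLp G.ofLp‖ ≤ (∑ i, ‖stress hl hm i‖) * ‖F‖ * ‖G‖ := by
  rw [gradForm, Finset.sum_mul, Finset.sum_mul]
  refine (norm_sum_le _ _).trans (Finset.sum_le_sum fun i _ => ?_)
  refine (norm_inner_le_norm _ _).trans ?_
  have h1 : ‖stress hl hm i F.ofLp‖ ≤ ‖stress hl hm i‖ * ‖F‖ := by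
    refine ((stress hl hm i).le_opNorm _).trans ?_
    gcongr
    exact (pi_norm_le_iff_of_nonneg (norm_nonneg _)).2 fun i => PiLp.norm_apply_le F i
  rw [mul_comm]
  exact mul_le_mul h1 (PiLp.norm_apply_le G i) (norm_nonneg _) (by positivity)

/-- The gradient closure as a real Hilbert space. -/
abbrev RealGradClosure (U : Set Pos) : Submodule ℝ GradSpace := (gradClosure U).restrictScalars ℝ

instance (U : Set Pos) : CompleteSpace (RealGradClosure U) :=
  (Submodule.isClosed_topologicalClosure _ : IsClosed (gradClosure U : Set GradSpace)).completeSpace_coe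

/-- The real part of the elastic form on the gradient closure. -/
def realForm (U : Set Pos) : RealGradClosure U →L[ℝ] RealGradClosure U →L[ℝ] ℝ :=
  LinearMap.mkContinuous₂
    (LinearMap.mk₂ ℝ (fun F G => (gradForm hl hm F.1.ofLp G.1.ofLp).re)
      (fun F F' G => by
        have := gradForm_add_left hl hm F.1.ofLp F'.1.ofLp G.1.ofLp
        rw [← Complex.add_re, ← this]; rfl)
      (fun c F G => by
        have := gradForm_smul_left hl hm (c : ℂ) F.1.ofLp G.1.ofLp
        rw [smul_eq_mul, ← Complex.re_ofReal_mul, ← this]; rfl)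
      (fun F G G' => by
        have := gradForm_add_right hl hm F.1.ofLp G.1.ofLp G'.1.ofLp
        rw [← Complex.add_re, ← this]; rfl)
      (fun c F G => by
        have := gradForm_smul_right hl hm (c : ℂ) F.1.ofLp G.1.ofLp
        rw [Complex.conj_ofReal] at this
        rw [smul_eq_mul, ← Complex.re_ofReal_mul, ← this]; rfl))
    (∑ i, ‖stress hl hm i‖) fun F G =>
      (Complex.abs_re_le_norm _).trans (norm_gradForm_le hl hm F.1 G.1)

theorem realForm_apply (F G : RealGradClosure U) :
    realForm hl hm U F G = (gradForm hl hm F.1.ofLp G.1.ofLp).re := rfl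

theorem isCoercive_realForm {κ : ℝ} (hκ : 0 < κ)
    (hc : ∀ x, κ ≤ mu x ∧ κ ≤ 3 * lam x + 2 * mu x) : IsCoercive (realForm hl hm U) := by
  refine ⟨κ / 2, by positivity, fun F => ?_⟩
  rw [realForm_apply]
  refine le_trans (le_of_eq ?_) (gradClosure_korn hl hm hκ hc (F := F.1.ofLp) F.2)
  rw [mul_assoc, ← sq]
  congr 1
  exact PiLp.norm_sq_eq_of_L2 _ F.1

/-- Solvability of the Dirichlet problem in variational form. -/
theorem exists_gradClosure_eq {κ : ℝ} (hκ : 0 < κ)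
    (hc : ∀ x, κ ≤ mu x ∧ κ ≤ 3 * lam x + 2 * mu x) (U : Set Pos) (K : Fin 3 → L2) :
    ∃ E ∈ gradClosure U, ∀ G ∈ gradClosure U,
      gradForm hl hm (K - E.ofLp) G.ofLp = 0 := by
  -- Lax–Milgram is applied over `ℝ`, to the real part of the sesquilinear form.
  let ℓ : RealGradClosure U →L[ℝ] ℝ := LinearMap.mkContinuous
    { toFun := fun G => (gradForm hl hm K G.1.ofLp).re
      map_add' := fun G G' => by
        have := gradForm_add_right hl hm K G.1.ofLp G'.1.ofLp
        rw [← Complex.add_re, ← this]; rfl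
      map_smul' := fun c G => by
        have := gradForm_smul_right hl hm (c : ℂ) K G.1.ofLp
        rw [Complex.conj_ofReal] at this
        rw [RingHom.id_apply, smul_eq_mul, ← Complex.re_ofReal_mul, ← this]; rfl }
    ((∑ i, ‖stress hl hm i‖) * ‖(WithLp.toLp 2 K : GradSpace)‖) fun G =>
      (Complex.abs_re_le_norm _).trans (norm_gradForm_le hl hm (WithLp.toLp 2 K) G.1)
  have hcoer := isCoercive_realForm (U := U) hl hm hκ hc
  let E := hcoer.continuousLinearEquivOfBilin.symm ((InnerProductSpace.toDual ℝ _).symm ℓ)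
  have hE : ∀ G : RealGradClosure U, (gradForm hl hm E.1.ofLp G.1.ofLp).re =
      (gradForm hl hm K G.1.ofLp).re := by
    intro G
    have h1 := hcoer.continuousLinearEquivOfBilin_apply E G
    rw [ContinuousLinearEquiv.apply_symm_apply, InnerProductSpace.toDual_symm_apply] at h1
    exact h1.symm
  have hre : ∀ G ∈ gradClosure U, (gradForm hl hm (K - E.1.ofLp) G.ofLp).re = 0 := by
    intro G hG
    rw [gradForm_sub_left, Complex.sub_re, hE ⟨G, hG⟩, sub_self]
  refine ⟨E.1, E.2, fun G hG => Complex.ext (hre G hG) ?_⟩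
  -- Testing with `i G` as well shows that the imaginary part vanishes.
  have h2 := hre (Complex.I • G) ((gradClosure U).smul_mem _ hG)
  have h3 := gradForm_smul_right hl hm Complex.I (K - E.1.ofLp) G.ofLp
  rw [WithLp.ofLp_smul, h3] at h2
  simpa using h2

theorem energyInner_eq (h k : CauchyData) :
    energyInner lam mu h k = inner ℂ k.2 h.2 + gradForm hl hm (grad h.1) (grad k.1) := by
  rw [energyInner, pairing_eq_inner, elasticForm_eq hl hm]

theorem grad_sub {f g : L2} (hf : MemH1 f) (hg : MemH1 g) : grad (f - g) = grad f - grad g := by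
  funext i; exact weakPartial_sub hf hg i

/-- The energy product does not mix displacement and velocity: the displacement is projected by a
variational Dirichlet problem, the velocity by restriction to `Θ^⋆`. -/
theorem exists_isOuterProj {Ω Θ Υ : Set Pos} (hLame : IsLame Ω lam mu) (hΥ : IsOpen Υ)
    (hb : Bornology.IsBounded Υ) {k : CauchyData} (hk : MemH1 k.1) :
    ∃ p, IsOuterProj lam mu Θ Υ k p := by
  obtain ⟨κ, hκ, hc⟩ := hLame.convex
  have hl := hLame.memLp_lam
  have hm := hLame.memLp_mu
  have hW : IsOpen (outside Θ Υ) := hΥ.sdiff isClosed_closure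
  obtain ⟨E, hE, hEorth⟩ := exists_gradClosure_eq hl hm hκ hc (outside Θ Υ) (grad k.1)
  obtain ⟨f, hf, hfE⟩ := exists_memH10_of_mem_gradClosure (hb.subset sdiff_subset) hE
  have hind : MemLp ((outside Θ Υ).indicator fun _ : Pos => (1 : ℝ)) ∞ volume :=
    (memLp_top_const 1).indicator hW.measurableSet
  refine ⟨(f, mulOp _ hind k.2), ⟨hf, ?_⟩, fun q hq => ?_⟩
  · filter_upwards [coeFn_mulOp _ hind k.2] with x hx hxW
    rw [hx, indicator_of_notMem hxW, zero_smul]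
  · have hgf : grad f = E.ofLp := funext hfE
    rw [energyInner_eq hl hm, Prod.fst_sub, Prod.snd_sub, grad_sub hk hf.memH1, hgf,
      hEorth _ hq.1.grad_mem, add_zero, L2.inner_def]
    refine integral_eq_zero_of_ae ?_
    filter_upwards [coeFn_mulOp _ hind k.2, hq.2, Lp.coeFn_sub k.2 (mulOp _ hind k.2)]
      with x h1 h2 h3
    rw [h3, Pi.sub_apply, h1]
    by_cases hx : x ∈ outside Θ Υ
    · rw [indicator_of_mem hx, one_smul, sub_self, inner_zero_right]; rfl
    · rw [h2 hx, inner_zero_left]; rfl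

theorem MemH10.eq_zero_of_grad {f : L2} (hU : Bornology.IsBounded U) (hf : MemH10 U f)
    (h0 : grad f = 0) : f = 0 := by
  obtain ⟨C, hC, hP⟩ := exists_poincare hU
  obtain ⟨-, φ, h, h1, h2⟩ := memH10_iff.1 hf
  have h3 : Tendsto (fun n => C * ∑ i, ‖(h n).partialL2 i‖) atTop (𝓝 (C * ∑ _i : Fin 3, 0)) := by
    refine (tendsto_finsetSum _ fun i _ => ?_).const_mul C
    have := (h2 i).norm
    rwa [show weakPartial i f = 0 from congrFun h0 i, norm_zero] at this
  have h4 := le_of_tendsto_of_tendsto' h1.norm h3 fun n => hP _ (h n)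
  simpa using h4

include hl hm in
theorem MemH10.eq_zero_of_energy {κ : ℝ} (hκ : 0 < κ)
    (hc : ∀ x, κ ≤ mu x ∧ κ ≤ 3 * lam x + 2 * mu x) {f g : L2} (hU : Bornology.IsBounded U)
    (hf : MemH10 U f) (h : inner ℂ g g + gradForm hl hm (grad f) (grad f) = 0) :
    f = 0 ∧ g = 0 := by
  have h4 : κ / 2 * ∑ i, ‖grad f i‖ ^ 2 ≤ (gradForm hl hm (grad f) (grad f)).re :=
    gradClosure_korn hl hm hκ hc hf.grad_mem
  have h5 : (inner ℂ g g : ℂ).re + (gradForm hl hm (grad f) (grad f)).re = 0 := by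
    rw [← Complex.add_re, h, Complex.zero_re]
  have h6 : (inner ℂ g g : ℂ).re = ‖g‖ ^ 2 := inner_self_eq_norm_sq (𝕜 := ℂ) g
  rw [h6] at h5
  have h7 : 0 ≤ ∑ i, ‖grad f i‖ ^ 2 := Finset.sum_nonneg fun i _ => sq_nonneg _
  have h8 := sq_nonneg ‖g‖
  have h9 : 0 ≤ κ / 2 * ∑ i, ‖grad f i‖ ^ 2 := mul_nonneg (by linarith) h7
  have h10 : ∑ i, ‖grad f i‖ ^ 2 = 0 := by
    have h0 : κ / 2 * ∑ i, ‖grad f i‖ ^ 2 = 0 := le_antisymm (by linarith) h9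
    exact (mul_eq_zero.1 h0).resolve_left (by linarith)
  refine ⟨hf.eq_zero_of_grad hU (funext fun i => ?_), ?_⟩
  · have := (Finset.sum_eq_zero_iff_of_nonneg fun i _ => sq_nonneg ‖grad f i‖).1 h10 i
      (Finset.mem_univ i)
    exact norm_eq_zero.1 (pow_eq_zero_iff two_ne_zero |>.1 this)
  · have : ‖g‖ ^ 2 = 0 := le_antisymm (by linarith) h8
    exact norm_eq_zero.1 (pow_eq_zero_iff two_ne_zero |>.1 this)

/-- The difference of two projections lies in the space and is orthogonal to itself. The energy is
definite there by Korn and Poincaré, as `Υ` is bounded. -/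
theorem IsOuterProj.unique {Ω Θ Υ : Set Pos} (hLame : IsLame Ω lam mu)
    (hb : Bornology.IsBounded Υ) {k p p' : CauchyData} (hk : MemH1 k.1)
    (hp : IsOuterProj lam mu Θ Υ k p) (hp' : IsOuterProj lam mu Θ Υ k p') : p = p' := by
  obtain ⟨κ, hκ, hc⟩ := hLame.convex
  have hl := hLame.memLp_lam
  have hm := hLame.memLp_mu
  have hd := DataIn.sub hp'.1 hp.1
  have h1 := hp.2 _ hd
  have h2 := hp'.2 _ hd
  rw [energyInner_eq hl hm] at h1 h2
  simp only [Prod.fst_sub, Prod.snd_sub, grad_sub hk hp.1.1.memH1, grad_sub hk hp'.1.1.memH1,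
    gradForm_sub_left, inner_sub_right] at h1 h2
  have h3 : inner ℂ (p'.2 - p.2) (p'.2 - p.2) +
      gradForm hl hm (grad (p'.1 - p.1)) (grad (p'.1 - p.1)) = 0 := by
    have e : gradForm hl hm (grad (p'.1 - p.1)) (grad (p'.1 - p.1)) =
        gradForm hl hm (grad p'.1) (grad (p'.1 - p.1)) -
        gradForm hl hm (grad p.1) (grad (p'.1 - p.1)) := by
      rw [← gradForm_sub_left, ← grad_sub hp'.1.1.memH1 hp.1.1.memH1]
    rw [e, inner_sub_right]
    linear_combination h1 - h2
  obtain ⟨e1, e2⟩ := MemH10.eq_zero_of_energy hl hm hκ hc (hb.subset sdiff_subset) hd.1 h3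
  exact Prod.ext (sub_eq_zero.1 e1).symm (sub_eq_zero.1 e2).symm

theorem outerProj_spec {Ω Θ Υ : Set Pos} (hLame : IsLame Ω lam mu) (hΥ : IsOpen Υ)
    (hb : Bornology.IsBounded Υ) {k : CauchyData} (hk : MemH1 k.1) :
    IsOuterProj lam mu Θ Υ k (outerProj lam mu Θ Υ k) := by
  have H := exists_isOuterProj (Θ := Θ) hLame hΥ hb hk
  rw [outerProj, dif_pos H]
  exact H.choose_spec

theorem IsOuterProj.outerProj_eq {Ω Θ Υ : Set Pos} (hLame : IsLame Ω lam mu)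
    (hb : Bornology.IsBounded Υ) {k p : CauchyData} (hk : MemH1 k.1)
    (hp : IsOuterProj lam mu Θ Υ k p) : outerProj lam mu Θ Υ k = p := by
  have H : ∃ p, IsOuterProj lam mu Θ Υ k p := ⟨p, hp⟩
  rw [outerProj, dif_pos H]
  exact IsOuterProj.unique hLame hb hk H.choose_spec hp

end Projection


/-! ### Travel distances -/

/-- The concatenation of two paths. -/
def concatPath (γ₁ γ₂ : ℝ → Pos) (t : ℝ) : Pos :=
  if t ≤ 1 / 2 then γ₁ (2 * t) else γ₂ (2 * t + -1)

variable {γ₁ γ₂ : ℝ → Pos}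

theorem concatPath_of_le {t : ℝ} (h : t ≤ 1 / 2) : concatPath γ₁ γ₂ t = γ₁ (2 * t) := if_pos h

theorem concatPath_of_ge (h12 : γ₁ 1 = γ₂ 0) {t : ℝ} (h : 1 / 2 ≤ t) :
    concatPath γ₁ γ₂ t = γ₂ (2 * t + -1) := by
  rcases h.eq_or_lt with rfl | h
  · rw [concatPath_of_le le_rfl]; norm_num; exact h12
  · exact if_neg (not_le.2 h)

theorem deriv_concatPath_of_lt {t : ℝ} (h : t < 1 / 2) :
    deriv (concatPath γ₁ γ₂) t = (2 : ℝ) • deriv γ₁ (2 * t) := by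
  rw [← deriv_comp_mul_left]
  refine Filter.EventuallyEq.deriv_eq ?_
  filter_upwards [Iio_mem_nhds h] with s hs using concatPath_of_le (le_of_lt hs)

theorem deriv_concatPath_of_gt {t : ℝ} (h : 1 / 2 < t) :
    deriv (concatPath γ₁ γ₂) t = (2 : ℝ) • deriv γ₂ (2 * t + -1) := by
  rw [← deriv_comp_add_const γ₂, ← deriv_comp_mul_left 2 (fun x => γ₂ (x + -1))]
  refine Filter.EventuallyEq.deriv_eq ?_
  filter_upwards [Ioi_mem_nhds h] with s hs using if_neg (not_le.2 hs)

theorem IsPiecewiseSmoothPath.concat (h₁ : IsPiecewiseSmoothPath γ₁)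
    (h₂ : IsPiecewiseSmoothPath γ₂) (h12 : γ₁ 1 = γ₂ 0) :
    IsPiecewiseSmoothPath (concatPath γ₁ γ₂) := by
  obtain ⟨c1, F1, hF1⟩ := h₁
  obtain ⟨c2, F2, hF2⟩ := h₂
  constructor
  · have e : Icc (0 : ℝ) 1 = Icc 0 (1 / 2) ∪ Icc (1 / 2) 1 :=
      (Icc_union_Icc_eq_Icc (by norm_num) (by norm_num)).symm
    rw [e]
    refine ContinuousOn.union_of_isClosed ?_ ?_ isClosed_Icc isClosed_Icc
    · refine ContinuousOn.congr (c1.comp (f := fun t => 2 * t) (by fun_prop) fun t ht => ?_)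
        fun t ht => concatPath_of_le ht.2
      exact ⟨by linarith [ht.1], by linarith [ht.2]⟩
    · refine ContinuousOn.congr (c2.comp (f := fun t => 2 * t + -1) (by fun_prop) fun t ht => ?_)
        fun t ht => concatPath_of_ge h12 ht.1
      exact ⟨by linarith [ht.1], by linarith [ht.2]⟩
  -- With `1/2` among the break points, an interval with no break point in its interior lies in a
  -- single half.
  · refine ⟨insert (1 / 2) (F1.image (fun t => t / 2) ∪ F2.image (fun t => (t + 1) / 2)),
      fun a b hab hsub hF => ?_⟩
    have ha := hsub (left_mem_Icc.2 hab.le)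
    have hb := hsub (right_mem_Icc.2 hab.le)
    have hmid : b ≤ 1 / 2 ∨ 1 / 2 ≤ a := by
      by_contra! h
      exact hF (1 / 2) ⟨h.2, h.1⟩ (Finset.mem_insert_self _ _)
    rcases hmid with h | h
    · have h3 := hF1 (2 * a) (2 * b) (by linarith)
        (Icc_subset_Icc (by linarith [ha.1]) (by linarith)) fun t ht htF => by
          refine hF (t / 2) ⟨by linarith [ht.1], by linarith [ht.2]⟩ ?_
          exact Finset.mem_insert_of_mem (Finset.mem_union_left _ (Finset.mem_image_of_mem _ htF))
      refine (h3.comp (f := fun t => 2 * t) (s := Icc a b) (by fun_prop) fun t ht => ?_).congr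
        fun t ht => concatPath_of_le (ht.2.trans h)
      exact ⟨by linarith [ht.1], by linarith [ht.2]⟩
    · have h3 := hF2 (2 * a + -1) (2 * b + -1) (by linarith)
        (Icc_subset_Icc (by linarith) (by linarith [hb.2])) fun t ht htF => by
          refine hF ((t + 1) / 2) ⟨by linarith [ht.1], by linarith [ht.2]⟩ ?_
          exact Finset.mem_insert_of_mem (Finset.mem_union_right _
            (Finset.mem_image_of_mem (fun t : ℝ => (t + 1) / 2) htF))
      refine (h3.comp (f := fun t => 2 * t + -1) (s := Icc a b) (by fun_prop) fun t ht => ?_).congr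
        fun t ht => concatPath_of_ge h12 (h.trans ht.1)
      exact ⟨by linarith [ht.1], by linarith [ht.2]⟩

theorem lintegral_affine (g : ℝ → ℝ≥0∞) (a b d : ℝ) :
    ∫⁻ t in Icc a b, ENNReal.ofReal 2 * g (2 * t + d) =
      ∫⁻ t in Icc (2 * a + d) (2 * b + d), g t := by
  have h := lintegral_image_eq_lintegral_abs_deriv_mul (s := Icc a b) (f := fun t => 2 * t + d)
    (f' := fun _ => 2) measurableSet_Icc
    (fun x _ => by simpa using (((hasDerivAt_id x).const_mul 2).add_const d).hasDerivWithinAt)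
    (fun x _ y _ hxy => by simpa using hxy) g
  rw [image_affine_Icc' two_pos] at h
  rw [h, abs_of_pos two_pos]

theorem travelLength_concatPath_le (c : Pos → ℝ) :
    travelLength c (concatPath γ₁ γ₂) ≤ travelLength c γ₁ + travelLength c γ₂ := by
  have e : Icc (0 : ℝ) 1 = Icc 0 (1 / 2) ∪ Icc (1 / 2) 1 :=
    (Icc_union_Icc_eq_Icc (by norm_num) (by norm_num)).symm
  have hne : ∀ s : Set ℝ, ∀ᵐ t ∂(volume.restrict s), t ≠ 1 / 2 := fun s =>
    ae_restrict_of_ae (Measure.ae_ne volume _)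
  have halg : ∀ (r : ℝ) (w : Pos), ENNReal.ofReal (‖(2 : ℝ) • w‖ / r) =
      ENNReal.ofReal 2 * ENNReal.ofReal (‖w‖ / r) := by
    intro r w
    rw [← ENNReal.ofReal_mul zero_le_two, norm_smul]
    congr 1
    norm_num
    ring
  unfold travelLength
  conv_lhs => rw [e]
  refine (lintegral_union_le _ _ _).trans (add_le_add (le_of_eq ?_) (le_of_eq ?_))
  · have h := lintegral_affine (fun t => ENNReal.ofReal (‖deriv γ₁ t‖ / c (γ₁ t))) 0 (1 / 2) 0
    norm_num at h
    rw [← h]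
    refine lintegral_congr_ae ?_
    filter_upwards [ae_restrict_mem measurableSet_Icc, hne _] with t ht hne
    rw [deriv_concatPath_of_lt (lt_of_le_of_ne (by norm_num at ht ⊢; exact ht.2) hne),
      concatPath_of_le (by norm_num at ht ⊢; exact ht.2), halg]
    norm_num
  · have h := lintegral_affine (fun t => ENNReal.ofReal (‖deriv γ₂ t‖ / c (γ₂ t))) (1 / 2) 1 (-1)
    norm_num at h
    rw [← h]
    refine lintegral_congr_ae ?_
    filter_upwards [ae_restrict_mem measurableSet_Icc, hne _] with t ht hne
    have hlt : 1 / 2 < t := lt_of_le_of_ne (by norm_num at ht ⊢; exact ht.1) hne.symm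
    have hval : concatPath γ₁ γ₂ t = γ₂ (2 * t + -1) := if_neg (not_le.2 hlt)
    rw [deriv_concatPath_of_gt hlt, hval, halg]
    norm_num

theorem travelDist_triangle (c : Pos → ℝ) (x y z : Pos) :
    travelDist c x z ≤ travelDist c x y + travelDist c y z := by
  refine ENNReal.le_iInf₂_add_iInf₂ fun γ₁ h₁ γ₂ h₂ => ?_
  have h12 : γ₁ 1 = γ₂ 0 := h₁.2.2.trans h₂.2.1.symm
  refine (iInf₂_le (concatPath γ₁ γ₂) ⟨h₁.1.concat h₂.1 h12, ?_, ?_⟩).trans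
    (travelLength_concatPath_le c)
  · rw [concatPath_of_le (by norm_num), mul_zero, h₁.2.1]
  · rw [concatPath_of_ge h12 (by norm_num), ← h₂.2.2]; norm_num

theorem travelDist_le_segment {c : Pos → ℝ} {s : ℝ} {x y : Pos}
    (h : ∀ z ∈ segment ℝ x y, 1 / c z ≤ s) :
    travelDist c x y ≤ ENNReal.ofReal (s * ‖y - x‖) := by
  have hd : ∀ t : ℝ, HasDerivAt (fun t : ℝ => x + t • (y - x)) (y - x) t := fun t => by
    simpa using ((hasDerivAt_id t).smul_const (y - x)).const_add x
  have hsm : ContDiff ℝ ∞ fun t : ℝ => x + t • (y - x) := by fun_prop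
  refine (iInf₂_le (fun t : ℝ => x + t • (y - x)) ⟨⟨hsm.continuous.continuousOn, ∅,
    fun a b _ _ _ => hsm.contDiffOn⟩, by simp, by simp⟩).trans ?_
  unfold travelLength
  have hle : ∀ t ∈ Icc (0 : ℝ) 1, ENNReal.ofReal (‖deriv (fun t : ℝ => x + t • (y - x)) t‖ /
      c (x + t • (y - x))) ≤ ENNReal.ofReal (s * ‖y - x‖) := by
    intro t ht
    rw [(hd t).deriv]
    refine ENNReal.ofReal_le_ofReal ?_
    have h1 := h (x + t • (y - x)) (by
      rw [segment_eq_image']; exact ⟨t, ht, rfl⟩)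
    rw [div_eq_mul_one_div, mul_comm]
    gcongr
  refine (setLIntegral_mono' measurableSet_Icc hle).trans (le_of_eq ?_)
  simp

theorem distToSet_le (c : Pos → ℝ) (A : Set Pos) (x y : Pos) :
    distToSet c x A ≤ travelDist c x y + distToSet c y A := by
  rw [distToSet, distToSet, ENNReal.add_iInf₂]
  exact le_iInf₂ fun z hz => (iInf₂_le z hz).trans (travelDist_triangle c x y z)

theorem travelDist_self {c : Pos → ℝ} {s : ℝ} {x : Pos} (h : 1 / c x ≤ s) :
    travelDist c x x = 0 := by
  have := travelDist_le_segment (c := c) (s := s) (x := x) (y := x)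
    (by simpa using h)
  simpa using this

theorem distToSet_eq_zero {c : Pos → ℝ} {s : ℝ} {A : Set Pos} {x : Pos} (hx : x ∈ A)
    (h : 1 / c x ≤ s) : distToSet c x A = 0 :=
  le_antisymm ((iInf₂_le x hx).trans (travelDist_self h).le) zero_le

section RealDist

variable {c : Pos → ℝ} {s : ℝ} {A : Set Pos}

theorem distToSet_ne_top (hA : A.Nonempty) (h : ∀ x, 1 / c x ≤ s) (x : Pos) :
    distToSet c x A ≠ ⊤ := by
  obtain ⟨y, hy⟩ := hA
  exact ((iInf₂_le y hy).trans (travelDist_le_segment fun z _ => h z)).trans_lt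
    ENNReal.ofReal_lt_top |>.ne

/-- The triangle inequality along the segment. The global bound `s` only ensures finiteness; the
Lipschitz constant is the local slowness `r`, which is what the eikonal inequality needs. -/
theorem abs_distToSet_sub_le (hA : A.Nonempty) (h : ∀ x, 1 / c x ≤ s) {r : ℝ} (hr : 0 ≤ r)
    {x y : Pos} (hxy : ∀ z ∈ segment ℝ x y, 1 / c z ≤ r) :
    |(distToSet c x A).toReal - (distToSet c y A).toReal| ≤ r * ‖x - y‖ := by
  have key : ∀ x y, (∀ z ∈ segment ℝ x y, 1 / c z ≤ r) →
      (distToSet c x A).toReal ≤ r * ‖y - x‖ + (distToSet c y A).toReal := by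
    intro x y hxy
    have h1 := (distToSet_le c A x y).trans (add_le_add_left (travelDist_le_segment hxy) _)
    have h2 := ENNReal.toReal_mono (ENNReal.add_ne_top.2 ⟨ENNReal.ofReal_ne_top,
      distToSet_ne_top hA h y⟩) h1
    rwa [ENNReal.toReal_add ENNReal.ofReal_ne_top (distToSet_ne_top hA h y),
      ENNReal.toReal_ofReal (by positivity)] at h2
  have h1 := key x y hxy
  have h2 := key y x (by rw [segment_symm]; exact hxy)
  rw [norm_sub_rev] at h1
  rw [abs_le]
  constructor <;> linarith

end RealDist

/-! ### Wave speeds and the eikonal inequality -/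

section Eikonal

variable {lam mu : Pos → ℝ} {Ω : Set Pos}

theorem IsLame.exists_slowness_bound (hLame : IsLame Ω lam mu) :
    ∃ s : ℝ, 0 < s ∧ ∀ x, 1 / speedP lam mu x ≤ s ∧ 1 / speedS mu x ≤ s := by
  obtain ⟨κ, hκ, hc⟩ := hLame.convex
  refine ⟨1 / √κ, by positivity, fun x => ⟨?_, ?_⟩⟩
  · have : κ ≤ lam x + 2 * mu x := by linarith [hc x]
    unfold speedP
    gcongr
  · unfold speedS
    gcongr
    exact (hc x).1

theorem IsLame.speedP_pos (hLame : IsLame Ω lam mu) (x : Pos) : 0 < speedP lam mu x := by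
  obtain ⟨κ, hκ, hc⟩ := hLame.convex
  exact Real.sqrt_pos.2 (by linarith [hc x])

theorem IsLame.sq_speedP (hLame : IsLame Ω lam mu) (x : Pos) :
    speedP lam mu x ^ 2 = lam x + 2 * mu x := by
  obtain ⟨κ, hκ, hc⟩ := hLame.convex
  exact Real.sq_sqrt (by linarith [hc x])

theorem IsLame.exists_speedP_le (hLame : IsLame Ω lam mu) :
    ∃ C : ℝ, 0 < C ∧ ∀ x, speedP lam mu x ≤ C := by
  obtain ⟨K, hK⟩ := hLame.bounded
  refine ⟨√(3 * K) + 1, by positivity, fun x => ?_⟩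
  have h : lam x + 2 * mu x ≤ 3 * K := by
    linarith [(abs_le.1 (hK x).1).2, (abs_le.1 (hK x).2).2]
  exact (Real.sqrt_le_sqrt h).trans (by linarith)

theorem IsLame.ae_continuousAt_speedP (hLame : IsLame Ω lam mu) :
    ∀ᵐ x, ContinuousAt (speedP lam mu) x := by
  obtain ⟨Γ, hΓ, -, h0, h1, h2⟩ := hLame.smooth
  filter_upwards [measure_eq_zero_iff_ae_notMem.1 h0] with x hx
  have hn : Γᶜ ∈ 𝓝 x := hΓ.isOpen_compl.mem_nhds hx
  exact (((h1.continuousOn.continuousAt hn).add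
    ((h2.continuousOn.continuousAt hn).const_mul 2)).sqrt)

theorem sum_sq_basis_le (A : Pos →L[ℝ] ℝ) : ∑ i, A (basisVec i) ^ 2 ≤ ‖A‖ ^ 2 := by
  set S := ∑ i, A (basisVec i) ^ 2 with hS
  have hS0 : 0 ≤ S := Finset.sum_nonneg fun i _ => sq_nonneg _
  -- `w` is the gradient vector representing `A`, so `A w = |w|²`.
  let w : Pos := ∑ i, A (basisVec i) • basisVec i
  have h1 : A w = S := by
    simp only [w, map_sum, map_smul, smul_eq_mul, hS, sq]
  have h2 : ‖w‖ ^ 2 = S := by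
    rw [EuclideanSpace.norm_sq_eq]
    refine Finset.sum_congr rfl fun k _ => ?_
    simp [w, basisVec, Finset.sum_apply, Pi.single_apply]
  have h3 := A.le_opNorm w
  rw [h1, Real.norm_of_nonneg hS0] at h3
  rcases hS0.eq_or_lt with h0 | h0
  · rw [← h0]; positivity
  · have h4 : S ^ 2 ≤ ‖A‖ ^ 2 * S := by
      calc S ^ 2 ≤ (‖A‖ * ‖w‖) ^ 2 := by gcongr
        _ = ‖A‖ ^ 2 * S := by rw [mul_pow, h2]
    rw [sq] at h4
    exact le_of_mul_le_mul_right h4 h0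

/-- A function whose local Lipschitz constant at almost every point is at most the slowness is a
subsolution of the eikonal equation. -/
theorem IsLame.eikonal_of_local (hLame : IsLame Ω lam mu) {ψ : Pos → ℝ} {K : NNReal}
    (hψ : LipschitzWith K ψ)
    (h : ∀ᵐ x, ∀ r, 1 / speedP lam mu x < r → ∀ᶠ y in 𝓝 x, |ψ y - ψ x| ≤ r * ‖y - x‖) :
    ∀ᵐ x, (lam x + 2 * mu x) * ∑ i, lineDeriv ℝ ψ x (basisVec i) ^ 2 ≤ 1 := by
  filter_upwards [h, hψ.ae_differentiableAt] with x hx hd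
  have hc := hLame.speedP_pos x
  have h1 : ‖fderiv ℝ ψ x‖ ≤ 1 / speedP lam mu x := by
    refine le_of_forall_gt_imp_ge_of_dense fun r hr => ?_
    exact hd.hasFDerivAt.le_of_lip' ((by positivity : 0 ≤ 1 / speedP lam mu x).trans hr.le) (hx r hr)
  have h2 := sum_sq_basis_le (fderiv ℝ ψ x)
  simp only [hd.lineDeriv_eq_fderiv]
  rw [← hLame.sq_speedP]
  calc _ ≤ speedP lam mu x ^ 2 * ‖fderiv ℝ ψ x‖ ^ 2 := by gcongr
    _ ≤ speedP lam mu x ^ 2 * (1 / speedP lam mu x) ^ 2 := by gcongr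
    _ = 1 := by field_simp

/-- Off the null set `Γ` the speed is continuous, so the slowness stays below `r` on a small ball,
and segments to its centre stay in that ball. -/
theorem IsLame.distToSet_local (hLame : IsLame Ω lam mu) {A : Set Pos} (hA : A.Nonempty) :
    ∀ᵐ x, ∀ r, 1 / speedP lam mu x < r → ∀ᶠ y in 𝓝 x,
      |(distToSet (speedP lam mu) y A).toReal - (distToSet (speedP lam mu) x A).toReal| ≤
        r * ‖y - x‖ := by
  obtain ⟨s, hs, hsb⟩ := hLame.exists_slowness_bound
  filter_upwards [hLame.ae_continuousAt_speedP] with x hx r hr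
  have hc := hLame.speedP_pos x
  have h1 : ContinuousAt (fun z => 1 / speedP lam mu z) x := continuousAt_const.div hx hc.ne'
  obtain ⟨ε, hε, hball⟩ := Metric.eventually_nhds_iff_ball.1 (h1.eventually (gt_mem_nhds hr))
  filter_upwards [Metric.ball_mem_nhds x hε] with y hy
  refine abs_distToSet_sub_le hA (fun z => (hsb z).1)
    ((by positivity : 0 ≤ 1 / speedP lam mu x).trans hr.le) fun z hz => (hball z ?_).le
  exact (convex_ball x ε).segment_subset hy (Metric.mem_ball_self hε) hz

/-- Local finite speed of propagation. -/
theorem IsElasticWave.exists_locally_constant (hLame : IsLame Ω lam mu) {W : Set Pos} {v : ℝ → L2}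
    (hv : IsElasticWave lam mu v) (hW : IsOpen W) {a : ℝ}
    (hstat : IsStationaryOn lam mu W (v a, deriv v a)) {x₀ : Pos} (hx₀ : x₀ ∈ W) :
    ∃ r > 0, ∃ δ > 0, ∀ t, |t - a| ≤ δ → VanishesOn (Metric.ball x₀ r) (v t - v a) := by
  obtain ⟨C, hC, hCb⟩ := hLame.exists_speedP_le
  obtain ⟨r, hr, hrW⟩ := Metric.nhds_basis_closedBall.mem_iff.1 (hW.mem_nhds hx₀)
  -- A cone of slope `1/C`, where `C` bounds the `P`-speed everywhere, is a subsolution of the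
  -- eikonal equation.
  let ψ : Pos → ℝ := fun x => 1 / C * max 0 (r - dist x x₀)
  have hlip : LipschitzWith ⟨1 / C, by positivity⟩ ψ := by
    refine LipschitzWith.of_dist_le_mul fun x y => ?_
    change |1 / C * max 0 (r - dist x x₀) - 1 / C * max 0 (r - dist y x₀)| ≤ 1 / C * dist x y
    rw [← mul_sub, abs_mul, abs_of_pos (by positivity : 0 < 1 / C)]
    gcongr
    refine (abs_max_sub_max_le_max _ _ _ _).trans ?_
    rw [sub_self, abs_zero, max_eq_right (abs_nonneg _)]
    have := abs_dist_sub_le x y x₀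
    rw [abs_sub_comm]
    simpa [abs_sub_comm] using this
  have hsupp : tsupport ψ ⊆ Metric.closedBall x₀ r := by
    refine closure_minimal (fun x hx => ?_) Metric.isClosed_closedBall
    by_contra hx'
    rw [Metric.mem_closedBall, not_le] at hx'
    apply hx
    simp only [ψ]
    rw [max_eq_left (by linarith), mul_zero]
  have heik := hLame.eikonal_of_local hlip (Eventually.of_forall fun x q hq =>
    Eventually.of_forall fun y => by
      refine (hlip.dist_le_mul y x).trans ?_
      rw [dist_eq_norm]
      gcongr
      refine le_trans ?_ hq.le
      exact one_div_le_one_div_of_le (hLame.speedP_pos x) (hCb x))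
  refine ⟨r / 2, by positivity, 1 / C * (r / 4), by positivity, fun t ht => ?_⟩
  refine (hv.vanishesOn_of_eikonal_abs hLame hW hstat hlip (fun x => by positivity)
    ((isCompact_closedBall x₀ r).of_isClosed_subset (isClosed_tsupport ψ) hsupp)
    (hsupp.trans hrW) heik t).mono fun x hx => ?_
  rw [Metric.mem_ball] at hx
  refine lt_of_le_of_lt ht ?_
  simp only [ψ]
  gcongr
  exact lt_of_lt_of_le (by linarith) (le_max_right _ _)

/-- The tent function of the travel time to `A`, cut off outside `Υ`. -/
theorem IsLame.exists_tent (hLame : IsLame Ω lam mu) {A Υ : Set Pos} (hA : A.Nonempty)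
    (hΥ : IsOpen Υ) (hb : Bornology.IsBounded Υ) {a b : ℝ} (ha : 0 < a)
    (hfr : ∀ x ∈ frontier Υ, b < (distToSet (speedP lam mu) x A).toReal) :
    ∃ (ψ : Pos → ℝ) (K : NNReal), LipschitzWith K ψ ∧ (∀ x, 0 ≤ ψ x) ∧ HasCompactSupport ψ ∧
      tsupport ψ ⊆ Υ \ A ∧
      (∀ᵐ x, (lam x + 2 * mu x) * ∑ i, lineDeriv ℝ ψ x (basisVec i) ^ 2 ≤ 1) ∧
      ∀ x ∈ Υ, min ((distToSet (speedP lam mu) x A).toReal - a)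
        (b - (distToSet (speedP lam mu) x A).toReal) ≤ ψ x := by
  classical
  obtain ⟨s, hs, hsb⟩ := hLame.exists_slowness_bound
  set D : Pos → ℝ := fun x => (distToSet (speedP lam mu) x A).toReal with hD
  have hDlip : ∀ x y, |D x - D y| ≤ s * ‖x - y‖ := fun x y =>
    abs_distToSet_sub_le hA (fun z => (hsb z).1) hs.le fun z _ => (hsb z).1
  have hDc : Continuous D :=
    (LipschitzWith.of_dist_le_mul (K := ⟨s, hs.le⟩) fun x y => by
      rw [Real.dist_eq, dist_eq_norm]; exact hDlip x y).continuous
  -- A 1-Lipschitz tent over `[a, b]`: composed with the travel time `D` it inherits the eikonal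
  -- inequality.
  let τ : ℝ → ℝ := fun d => max 0 (min (d - a) (b - d))
  have hτ : ∀ d e, |τ d - τ e| ≤ |d - e| := by
    intro d e
    refine (abs_max_sub_max_le_max _ _ _ _).trans (max_le (by simp) ?_)
    refine (abs_min_sub_min_le_max _ _ _ _).trans (max_le (by simp) ?_)
    rw [sub_sub_sub_cancel_left, abs_sub_comm]
  have hτ0 : ∀ d, b ≤ d → τ d = 0 := fun d hd =>
    max_eq_left ((min_le_right _ _).trans (by linarith))
  let ψ : Pos → ℝ := fun x => if x ∈ Υ then τ (D x) else 0
  have hψ1 : ∀ x ∈ Υ, ψ x = τ (D x) := fun x hx => if_pos hx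
  have hψ2 : ∀ x ∉ Υ, ψ x = 0 := fun x hx => if_neg hx
  have hψ0 : ∀ x, 0 ≤ ψ x := by
    intro x
    by_cases hx : x ∈ Υ
    · rw [hψ1 x hx]; exact le_max_left _ _
    · rw [hψ2 x hx]
  -- On `∂Υ` one has `D > b`, so the tent already vanishes near it and cutting off outside `Υ`
  -- creates no jump.
  have hloc : ∀ x, ∀ᶠ y in 𝓝 x, |ψ y - ψ x| ≤ |D y - D x| := by
    intro x
    by_cases hx : x ∈ Υ
    · filter_upwards [hΥ.mem_nhds hx] with y hy
      rw [hψ1 x hx, hψ1 y hy]; exact hτ _ _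
    · by_cases hx' : x ∈ closure Υ
      · have hxf : x ∈ frontier Υ := by rw [hΥ.frontier_eq]; exact ⟨hx', hx⟩
        filter_upwards [hDc.continuousAt.eventually (lt_mem_nhds (hfr x hxf))] with y hy
        have : ψ y = 0 := by
          by_cases hyΥ : y ∈ Υ
          · rw [hψ1 y hyΥ, hτ0 _ (le_of_lt hy)]
          · exact hψ2 y hyΥ
        rw [this, hψ2 x hx]; simp
      · filter_upwards [isClosed_closure.isOpen_compl.mem_nhds hx'] with y hy
        rw [hψ2 y fun h => hy (subset_closure h), hψ2 x hx]; simp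
  -- A segment leaving `Υ` meets `∂Υ`, where the tent vanishes. Comparing with the value there gives
  -- the global Lipschitz bound.
  have hcross : ∀ x ∈ Υ, ∀ y ∉ Υ, ∃ z ∈ segment ℝ x y, z ∈ frontier Υ := by
    intro x hx y hy
    by_contra! hz
    have h1 : segment ℝ x y ⊆ Υ ∪ (closure Υ)ᶜ := by
      intro z hzs
      by_cases h : z ∈ closure Υ
      · left
        by_contra hzΥ
        exact hz z hzs (by rw [hΥ.frontier_eq]; exact ⟨h, hzΥ⟩)
      · exact Or.inr h
    have h2 := (convex_segment x y).isPreconnected.subset_left_of_subset_union hΥ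
      isClosed_closure.isOpen_compl
      (disjoint_compl_right.mono_left subset_closure) h1 ⟨x, left_mem_segment ℝ x y, hx⟩
    exact hy (h2 (right_mem_segment ℝ x y))
  have hlip1 : ∀ x ∈ Υ, ∀ y ∉ Υ, |ψ x - ψ y| ≤ s * ‖x - y‖ := by
    intro x hx y hy
    obtain ⟨z, hz, hzf⟩ := hcross x hx y hy
    have h1 : ψ x - ψ y = τ (D x) - τ (D z) := by
      rw [hψ1 x hx, hψ2 y hy, hτ0 _ (hfr z hzf).le]
    rw [h1]
    refine ((hτ _ _).trans (hDlip x z)).trans ?_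
    gcongr
    rw [← dist_eq_norm, ← dist_eq_norm, ← dist_add_dist_of_mem_segment hz]
    linarith [dist_nonneg (x := z) (y := y)]
  have hlip : LipschitzWith ⟨s, hs.le⟩ ψ := by
    refine LipschitzWith.of_dist_le_mul fun x y => ?_
    rw [Real.dist_eq, dist_eq_norm]
    change _ ≤ s * ‖x - y‖
    by_cases hx : x ∈ Υ <;> by_cases hy : y ∈ Υ
    · rw [hψ1 x hx, hψ1 y hy]; exact (hτ _ _).trans (hDlip x y)
    · exact hlip1 x hx y hy
    · rw [abs_sub_comm, norm_sub_rev]; exact hlip1 y hy x hx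
    · rw [hψ2 x hx, hψ2 y hy, sub_self, abs_zero]; positivity
  have hsupp : tsupport ψ ⊆ closure Υ ∩ (D ⁻¹' Icc a b) := by
    refine closure_minimal (fun x hx => ?_) (isClosed_closure.inter (isClosed_Icc.preimage hDc))
    have hxΥ : x ∈ Υ := by
      by_contra h; exact hx (hψ2 x h)
    refine ⟨subset_closure hxΥ, ?_⟩
    by_contra h
    apply hx
    rw [hψ1 x hxΥ]
    refine max_eq_left ?_
    by_contra! h'
    have h1 := lt_min_iff.1 h'
    exact h ⟨by linarith [h1.1], by linarith [h1.2]⟩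
  refine ⟨ψ, _, hlip, hψ0, ?_, ?_, ?_, fun x hx => ?_⟩
  · exact hb.isCompact_closure.of_isClosed_subset (isClosed_tsupport ψ)
      (hsupp.trans inter_subset_left)
  · intro x hx
    obtain ⟨h1, h2⟩ := hsupp hx
    refine ⟨?_, fun hxA => ?_⟩
    · by_contra hxΥ
      have := hfr x (by rw [hΥ.frontier_eq]; exact ⟨h1, hxΥ⟩)
      exact absurd h2.2 (not_le.2 this)
    · have : D x = 0 := by
        simp only [hD, distToSet_eq_zero hxA (hsb x).1, ENNReal.toReal_zero]
      have h3 : a ≤ D x := h2.1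
      linarith
  · refine hLame.eikonal_of_local hlip ?_
    filter_upwards [hLame.distToSet_local hA] with x hx r hr
    filter_upwards [hx r hr, hloc x] with y h1 h2
    exact h2.trans h1
  · rw [hψ1 x hx]; exact le_max_right _ _

end Eikonal


/-! ### Unique continuation for locally constant waves -/

section UniqueContinuation

variable {lam mu : Pos → ℝ} {Ω : Set Pos} {v : ℝ → L2}

theorem VanishesOn.trans {A : Set Pos} {f g h : L2} (hfg : VanishesOn A (f - g))
    (hgh : VanishesOn A (g - h)) : VanishesOn A (f - h) := by
  simpa using hfg.add hgh

theorem VanishesOn.symm {A : Set Pos} {f g : L2} (h : VanishesOn A (f - g)) :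
    VanishesOn A (g - f) := by
  simpa using h.neg

/-- Unique continuation for the time increments of a wave. -/
theorem UniqueContinuation.constant_cone (hUC : UniqueContinuation lam mu) (hLame : IsLame Ω lam mu)
    (hv : IsElasticWave lam mu v) {N : Set Pos} (hN : IsOpen N) {y : Pos} (hy : y ∈ N)
    {t₀ t₁ : ℝ} (h : ∀ t ∈ Ioo t₀ t₁, ∀ t' ∈ Ioo t₀ t₁, VanishesOn N (v t' - v t)) {η : ℝ}
    (hη : 0 < η) {t t' : ℝ} (ht : t ∈ Icc (t₀ + η) (t₁ - η)) (ht' : t' ∈ Icc (t₀ + η) (t₁ - η)) :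
    VanishesOn {x | travelDist (speedS mu) x y ≤ ENNReal.ofReal η} (v t' - v t) := by
  wlog htt' : t ≤ t' generalizing t t'
  · exact (this ht' ht (not_le.1 htt').le).symm
  -- The increment `v(· + h) - v` with `h = t' - t` is again a wave and vanishes near `y` on `(t₀,
  -- t₁ - h)`. The slice of its double cone at time `t` has `S`-radius at least `η`.
  have hz := (hv.comp_add (t' - t)).sub hLame.memLp_lam hLame.memLp_mu hv
  have hlt : t₀ < t₁ - (t' - t) := by linarith [ht.1, ht'.2]
  have key := hUC _ t₀ (t₁ - (t' - t)) y hz hlt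
    ⟨Ioo t₀ (t₁ - (t' - t)) ×ˢ N, isOpen_Ioo.prod hN, prod_mono_right (singleton_subset_iff.2 hy),
      fun τ => ?_⟩ t
  · rw [show t + (t' - t) = t' by ring] at key
    refine key.mono fun x hx => ?_
    have h2 : |t - (t₀ + (t₁ - (t' - t))) / 2| ≤ (t₁ - (t' - t) - t₀) / 2 - η := by
      rw [abs_le]; constructor <;> linarith [ht.1, ht'.2]
    refine (add_le_add_left (mem_ofPred.1 hx) _).trans ?_
    rw [← ENNReal.ofReal_add hη.le (abs_nonneg _)]
    exact ENNReal.ofReal_le_ofReal (by linarith)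
  · by_cases hτ : τ ∈ Ioo t₀ (t₁ - (t' - t))
    · refine (h τ ⟨hτ.1, by linarith [hτ.2]⟩ (τ + (t' - t))
        ⟨by linarith [hτ.1], by linarith [hτ.2]⟩).mono fun x hx => hx.2
    · filter_upwards with x hx using absurd hx.1 hτ

/-- A version of `UniqueContinuation.constant_cone` on a ball. -/
theorem UniqueContinuation.constant_ball (hUC : UniqueContinuation lam mu) (hLame : IsLame Ω lam mu)
    (hv : IsElasticWave lam mu v) {N : Set Pos} (hN : IsOpen N) {y : Pos} (hy : y ∈ N)
    {t₀ t₁ : ℝ} (h : ∀ t ∈ Ioo t₀ t₁, ∀ t' ∈ Ioo t₀ t₁, VanishesOn N (v t' - v t)) {x : Pos}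
    (hx : travelDist (speedS mu) x y < ENNReal.ofReal ((t₁ - t₀) / 2)) :
    ∃ ρ > 0, ∃ η > 0, ∀ t t', |t - (t₀ + t₁) / 2| ≤ η → |t' - (t₀ + t₁) / 2| ≤ η →
      VanishesOn (Metric.ball x ρ) (v t' - v t) := by
  obtain ⟨s, hs, hsb⟩ := hLame.exists_slowness_bound
  obtain ⟨r, hr0, hr, hr1⟩ := ENNReal.lt_iff_exists_real_btwn.1 hx
  have hr2 : r < (t₁ - t₀) / 2 := (ENNReal.ofReal_lt_ofReal_iff_of_nonneg hr0).1 hr1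
  -- Half of the slack `(t₁ - t₀)/2 - r` pays for moving from `x` to a nearby `z`, the other half
  -- for moving the time away from the midpoint.
  set η := ((t₁ - t₀) / 2 - r) / 2 with hη
  have hη0 : 0 < η := by linarith
  refine ⟨η / s, by positivity, η, hη0, fun t t' ht ht' => ?_⟩
  rw [abs_le] at ht ht'
  refine (hUC.constant_cone hLame hv hN hy h (η := r + η) (by linarith)
    ⟨by linarith, by linarith⟩ ⟨by linarith, by linarith⟩).mono fun z hz => ?_
  have h1 := travelDist_triangle (speedS mu) z x y
  have h2 := travelDist_le_segment (c := speedS mu) (x := z) (y := x) fun w _ => (hsb w).2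
  have h3 : s * ‖x - z‖ ≤ η := by
    rw [← dist_eq_norm, dist_comm, ← le_div_iff₀' hs]
    exact (Metric.mem_ball.1 hz).le
  rw [mem_ofPred, add_comm r, ENNReal.ofReal_add hη0.le hr0]
  exact h1.trans (add_le_add (h2.trans (ENNReal.ofReal_le_ofReal h3)) hr.le)

/-- The wave `v` is constant near `x` during a neighbourhood of the time interval `[0, τ]`. -/
def IsConstantNear (v : ℝ → L2) (τ : ℝ) (x : Pos) : Prop :=
  ∃ N : Set Pos, IsOpen N ∧ x ∈ N ∧ ∃ δ > 0, ∀ t ∈ Icc (-δ) (τ + δ), VanishesOn N (v t - v 0)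

theorem isOpen_isConstantNear (v : ℝ → L2) (τ : ℝ) : IsOpen {x | IsConstantNear v τ x} :=
  isOpen_iff_mem_nhds.2 fun _ ⟨N, hN, hx, h⟩ =>
    mem_of_superset (hN.mem_nhds hx) fun _ hz => ⟨N, hN, hz, h⟩

/-- The set where a wave is locally constant is relatively closed in an open set on which the wave
is stationary at the initial and at the final time. -/
theorem UniqueContinuation.isConstantNear_of_mem_closure (hUC : UniqueContinuation lam mu)
    (hLame : IsLame Ω lam mu) (hv : IsElasticWave lam mu v) {W : Set Pos} (hW : IsOpen W) {τ : ℝ}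
    (hτ : 0 < τ) (h0 : IsStationaryOn lam mu W (v 0, deriv v 0))
    (h1 : IsStationaryOn lam mu W (v τ, deriv v τ)) {x : Pos} (hx : x ∈ W)
    (hcl : x ∈ closure {x | IsConstantNear v τ x}) : IsConstantNear v τ x := by
  obtain ⟨s, hs, hsb⟩ := hLame.exists_slowness_bound
  obtain ⟨r₀, hr₀, δ₀, hδ₀, hc₀⟩ := hv.exists_locally_constant hLame hW h0 hx
  obtain ⟨r₁, hr₁, δ₁, hδ₁, hc₁⟩ := hv.exists_locally_constant hLame hW h1 hx
  set δ := min δ₀ δ₁ with hδ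
  have hδpos : 0 < δ := lt_min hδ₀ hδ₁
  have hδ0 : δ ≤ δ₀ := min_le_left _ _
  have hδ1 : δ ≤ δ₁ := min_le_right _ _
  -- Any two points of the ball of radius `r` about `x` are at `S`-distance at most `2rs ≤ δ/2`.
  set r := min (min r₀ r₁) (δ / (4 * s)) with hr
  have hrpos : 0 < r := lt_min (lt_min hr₀ hr₁) (by positivity)
  obtain ⟨y, ⟨N, hN, hyN, δ', hδ', hNv⟩, hxy⟩ := Metric.mem_closure_iff.1 hcl r hrpos
  have hb0 : Metric.ball x r ⊆ Metric.ball x r₀ :=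
    Metric.ball_subset_ball ((min_le_left _ _).trans (min_le_left _ _))
  have hb1 : Metric.ball x r ⊆ Metric.ball x r₁ :=
    Metric.ball_subset_ball ((min_le_left _ _).trans (min_le_right _ _))
  -- The margin `δ'` belonging to `y` may shrink as `y → x`. Local finite speed at times `0` and `τ`
  -- replaces it by `δ`, which depends only on `x`.
  have hconst : ∀ t ∈ Ioo (-δ) (τ + δ), VanishesOn (N ∩ Metric.ball x r) (v t - v 0) := by
    intro t ht
    rcases le_total t 0 with h | h
    · exact (hc₀ t (by rw [abs_le]; constructor <;> linarith [ht.1])).mono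
        (inter_subset_right.trans hb0)
    rcases le_total t τ with h' | h'
    · exact (hNv t ⟨by linarith, by linarith⟩).mono inter_subset_left
    · exact VanishesOn.trans ((hc₁ t (by rw [abs_le]; constructor <;> linarith [ht.2])).mono
        (inter_subset_right.trans hb1)) ((hNv τ ⟨by linarith, by linarith⟩).mono inter_subset_left)
  refine ⟨Metric.ball x r, Metric.isOpen_ball, Metric.mem_ball_self hrpos, δ / 2, by positivity,
    fun t ht => ?_⟩
  refine (hUC.constant_cone hLame hv (hN.inter Metric.isOpen_ball) ⟨hyN, ?_⟩
    (fun t ht t' ht' => (hconst t' ht').trans (hconst t ht).symm) (η := δ / 2) (by positivity)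
    (t := 0) (t' := t) ⟨by linarith, by linarith⟩ ⟨by linarith [ht.1], by linarith [ht.2]⟩).mono
    fun z hz => ?_
  · rwa [Metric.mem_ball, dist_comm]
  · refine (travelDist_le_segment (c := speedS mu) (x := z) (y := y) fun w _ => (hsb w).2).trans
      (ENNReal.ofReal_le_ofReal ?_)
    have h2 : ‖y - z‖ ≤ 2 * r := by
      rw [← dist_eq_norm]
      have := dist_triangle y x z
      rw [dist_comm y x, dist_comm x z] at this
      linarith [Metric.mem_ball.1 hz]
    have h3 : r ≤ δ / (4 * s) := min_le_right _ _
    calc s * ‖y - z‖ ≤ s * (2 * (δ / (4 * s))) := by gcongr; linarith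
      _ = δ / 2 := by field_simp; norm_num

end UniqueContinuation


/-! ### Locally constant waves are stationary -/

section Stationary

variable {lam mu : Pos → ℝ} {Ω : Set Pos} {v : ℝ → L2}

theorem VanishesOn.of_local {U : Set Pos} {f : L2}
    (h : ∀ x ∈ U, ∃ N ∈ 𝓝 x, VanishesOn N f) : VanishesOn U f := by
  have h0 : volume {x | x ∈ U ∧ f x ≠ 0} = 0 := by
    refine measure_null_of_locally_null _ fun x hx => ?_
    obtain ⟨N, hN, hv⟩ := h x hx.1
    refine ⟨N ∩ {x | x ∈ U ∧ f x ≠ 0},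
      inter_mem (mem_nhdsWithin_of_mem_nhds hN) self_mem_nhdsWithin, ?_⟩
    refine measure_mono_null (fun z hz => ?_) (ae_iff.1 hv)
    exact fun h => hz.2.2 (h hz.1)
  refine measure_mono_null (fun x hx => ?_) h0
  simpa using hx

theorem VanishesOn.smul {A : Set Pos} {f : L2} (hf : VanishesOn A f) (r : ℝ) :
    VanishesOn A (r • f) := by
  filter_upwards [hf, Lp.coeFn_smul r f] with x h1 h3 hx
  rw [h3, Pi.smul_apply, h1 hx, smul_zero]

theorem VanishesOn.union {A B : Set Pos} {f : L2} (hA : VanishesOn A f) (hB : VanishesOn B f) :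
    VanishesOn (A ∪ B) f := by
  filter_upwards [hA, hB] with x h1 h2 hx using hx.elim h1 h2

theorem VanishesOn.inner_eq_zero {A : Set Pos} {f g : L2} (hf : VanishesOn A f)
    (hg : VanishesOn Aᶜ g) : inner ℂ f g = 0 := by
  rw [L2.inner_def]
  refine integral_eq_zero_of_ae ?_
  filter_upwards [hf, hg] with x h1 h2
  by_cases hx : x ∈ A
  · simp [h1 hx]
  · simp [h2 hx]

theorem VanishesOn.hasDerivAt {A : Set Pos} {f' : L2} {t : ℝ} (hd : HasDerivAt v f' t)
    (h : ∀ᶠ s in 𝓝 t, VanishesOn A (v s - v t)) : VanishesOn A f' := by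
  refine (VanishesOn.isClosed A).mem_of_tendsto (hasDerivAt_iff_tendsto_slope.1 hd) ?_
  filter_upwards [nhdsWithin_le_nhds h] with s hs using hs.smul _

theorem elasticForm_eq_zero_of_testField (hl : MemLp lam ∞ volume) (hm : MemLp mu ∞ volume) {f : L2}
    {U : Set Pos} (h : ∀ (φ : Pos → C3) (hφ : IsTestField U φ), elasticForm lam mu f hφ.toL2 = 0)
    {φ : L2} (hφ : MemH10 U φ) : elasticForm lam mu f φ = 0 := by
  obtain ⟨-, ψ, hψ, -, h2⟩ := memH10_iff.1 hφ
  have h3 := tendsto_gradForm hl hm (tendsto_const_nhds (x := grad f)) (tendsto_pi_nhds.2 h2)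
  rw [elasticForm_eq hl hm]
  refine tendsto_nhds_unique h3 (tendsto_const_nhds.congr fun n => ?_)
  rw [← h _ (hψ n), elasticForm_eq hl hm]
  congr 1
  funext i
  exact (hψ n).weakPartial_toL2 i

/-- Constancy near `(τ, x)` kills the velocity near `x` for all times near `τ`. Against a test
field, `⟨∂ₜ v, φ⟩` then vanishes for times near `τ`, and its derivative at `τ` is `-a(v(τ), φ)`. -/
theorem IsElasticWave.isStationaryOn (hLame : IsLame Ω lam mu) (hv : IsElasticWave lam mu v)
    {U : Set Pos} {τ : ℝ} (h : ∀ x ∈ U, ∃ ρ > 0, ∃ η > 0, ∀ t t', |t - τ| ≤ η → |t' - τ| ≤ η →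
      VanishesOn (Metric.ball x ρ) (v t' - v t)) : IsStationaryOn lam mu U (v τ, deriv v τ) := by
  have hder : ∀ x ∈ U, ∃ N ∈ 𝓝 x, ∃ η > 0, ∀ t, |t - τ| < η → VanishesOn N (deriv v t) := by
    intro x hx
    obtain ⟨ρ, hρ, η, hη, hb⟩ := h x hx
    refine ⟨_, Metric.ball_mem_nhds x hρ, η, hη, fun t ht => ?_⟩
    refine VanishesOn.hasDerivAt (hv.hasDerivAt t) ?_
    have hc : ContinuousAt (fun s : ℝ => |s - τ|) t := by fun_prop
    filter_upwards [hc.eventually (gt_mem_nhds ht)] with s hs using hb t s ht.le (le_of_lt hs)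
  refine ⟨hv.memH1 τ, VanishesOn.of_local fun x hx => ?_, fun φ hφ =>
    elasticForm_eq_zero_of_testField hLame.memLp_lam hLame.memLp_mu (fun φ hφ => ?_) hφ⟩
  · obtain ⟨N, hN, η, hη, hb⟩ := hder x hx
    exact ⟨N, hN, hb τ (by simpa using hη)⟩
  -- The time intervals depend on the point; compactness of the support of `φ` provides a common
  -- one.
  · have hK : ∃ η > 0, ∀ t, |t - τ| < η → VanishesOn (tsupport φ) (deriv v t) := by
      refine IsCompact.induction_on
        (p := fun S => ∃ η > 0, ∀ t, |t - τ| < η → VanishesOn S (deriv v t))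
        hφ.hasCompactSupport ⟨1, one_pos, fun t _ => by filter_upwards with x hx using hx.elim⟩
        (fun S S' hS ⟨η, hη, hb⟩ => ⟨η, hη, fun t ht => (hb t ht).mono hS⟩) ?_ ?_
      · rintro S S' ⟨η, hη, hb⟩ ⟨η', hη', hb'⟩
        exact ⟨min η η', lt_min hη hη', fun t ht => (hb t (ht.trans_le (min_le_left _ _))).union
          (hb' t (ht.trans_le (min_le_right _ _)))⟩
      · intro x hx
        obtain ⟨N, hN, hb⟩ := hder x (hφ.tsupport_subset hx)
        exact ⟨N, mem_nhdsWithin_of_mem_nhds hN, hb⟩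
    obtain ⟨η, hη, hb⟩ := hK
    have hφ' : IsTestField (tsupport φ) φ := ⟨hφ.contDiff, hφ.hasCompactSupport, Subset.rfl⟩
    have h0 : (fun s => pairing (deriv v s) hφ.toL2) =ᶠ[𝓝 τ] fun _ => 0 := by
      filter_upwards [Metric.ball_mem_nhds τ hη] with s hs
      rw [pairing_eq_inner, ← inner_conj_symm,
        (hb s hs).inner_eq_zero (g := hφ.toL2) hφ'.toL2_eq_zero, map_zero]
    have h1 := hv.equation hφ.toL2 hφ.memH1 τ
    exact neg_eq_zero.1 (h1.unique ((hasDerivAt_const τ (0 : ℂ)).congr_of_eventuallyEq h0))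

end Stationary

/-! ### The exterior of the domain -/

section Exterior

variable {lam mu : Pos → ℝ} {Ω Θ Υ : Set Pos} {v : ℝ → L2}

/-- Moving from `y` against the direction `n` leads strictly below the graph, into an open set that
misses `Θ` and hence its closure. Without boundary regularity, a slit in `Θ` would be a
counterexample. -/
theorem IsLipschitzDomain.mem_closure_exterior (hΘ : IsLipschitzDomain Θ) {y : Pos}
    (hy : y ∈ frontier Θ) : y ∈ closure (closure Θ)ᶜ := by
  obtain ⟨n, hn, K, ψ, hψ, hinv, W, hW, hWΘ⟩ := hΘ.2 y hy
  have hyΘ : y ∉ Θ := fun h => (hΘ.1.frontier_eq ▸ hy).2 h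
  have hyn : inner ℝ n y ≤ ψ y := not_lt.1 fun h => hyΘ ((hWΘ y (mem_of_mem_nhds hW)).2 h)
  have hO : IsOpen (interior W ∩ {z | inner ℝ n z < ψ z}) :=
    isOpen_interior.inter (isOpen_lt (by fun_prop) hψ.continuous)
  have hdisj : interior W ∩ {z | inner ℝ n z < ψ z} ⊆ (closure Θ)ᶜ := by
    refine subset_compl_iff_disjoint_right.2 (Disjoint.closure_right ?_ hO)
    refine disjoint_left.2 fun z hz hzΘ => ?_
    exact lt_asymm ((hWΘ z (interior_subset hz.1)).1 hzΘ) hz.2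
  refine closure_mono hdisj ?_
  have hc : Tendsto (fun s : ℝ => y + (-s) • n) (𝓝[>] 0) (𝓝 y) := by
    have : Continuous fun s : ℝ => y + (-s) • n := by fun_prop
    simpa using (this.tendsto 0).mono_left nhdsWithin_le_nhds
  refine mem_closure_of_tendsto hc ?_
  filter_upwards [hc.eventually (interior_mem_nhds.2 hW), self_mem_nhdsWithin] with s hs hs0
  refine ⟨hs, ?_⟩
  rw [mem_ofPred, hinv, inner_add_right, inner_smul_right, real_inner_self_eq_norm_sq, hn]
  have : (0 : ℝ) < s := hs0
  linarith

/-- A wave that is stationary outside `Θ` at times `0` and `2T` is constant during `[0, 2T]` near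
the exterior points that are close to `Θ`. -/
theorem UniqueContinuation.isConstantNear_exterior (hUC : UniqueContinuation lam mu)
    (hLame : IsLame Ω lam mu) (hv : IsElasticWave lam mu v) (hΘ : Θ.Nonempty)
    (hΘc : IsPreconnected (closure Θ)ᶜ) (hΥ : IsOpen Υ) (hΥb : Bornology.IsBounded Υ)
    (hΘΥ : closure Θ ⊆ Υ) {T : ℝ} (hT : 0 < T)
    (hdist : ENNReal.ofReal (2 * T) < setDist (speedP lam mu) (frontier Υ) (closure Θ))
    (h0 : IsStationaryOn lam mu (outside Θ Υ) (v 0, deriv v 0))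
    (h1 : IsStationaryOn lam mu (outside Θ Υ) (v (2 * T), deriv v (2 * T))) {x : Pos}
    (hx : x ∈ outside Θ Υ) (hxT : (distToSet (speedP lam mu) x (closure Θ)).toReal ≤ T) :
    IsConstantNear v (2 * T) x := by
  obtain ⟨s, hs, hsb⟩ := hLame.exists_slowness_bound
  have hW : IsOpen (outside Θ Υ) := hΥ.sdiff isClosed_closure
  have hA : (closure Θ).Nonempty := hΘ.closure
  set D : Pos → ℝ := fun x => (distToSet (speedP lam mu) x (closure Θ)).toReal with hD
  have hDc : Continuous D := by
    refine (LipschitzWith.of_dist_le_mul (K := ⟨s, hs.le⟩) fun x y => ?_).continuous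
    rw [Real.dist_eq, dist_eq_norm]
    exact abs_distToSet_sub_le hA (fun x => (hsb x).1) hs.le fun z _ => (hsb z).1
  obtain ⟨r, hr0, hr, hr1⟩ := ENNReal.lt_iff_exists_real_btwn.1 hdist
  have hr2 : 2 * T < r := (ENNReal.ofReal_lt_ofReal_iff_of_nonneg (by positivity)).1 hr
  have hfr : ∀ x ∈ frontier Υ, r < D x := fun x hx =>
    (ENNReal.ofReal_lt_iff_lt_toReal hr0 (distToSet_ne_top hA (fun x => (hsb x).1) x)).1
      (hr1.trans_le (iInf₂_le x hx))
  -- Since `r = 2T + 3ε`, the tent `min (D - ε) (r - D)` exceeds `T` precisely when `T + ε < D < T +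
  -- 3ε`. There `v` is constant on `[-T, T]` and on `[T, 3T]`, and the two values agree at time `T`.
  set ε := (r - 2 * T) / 3 with hε
  have hε0 : 0 < ε := by linarith
  obtain ⟨ψ, K, hψ, hψ0, hψc, hψW, heik, hψD⟩ :=
    hLame.exists_tent hA hΥ hΥb (a := ε) hε0 hfr
  have hshell : ∀ x ∈ Υ, T + ε < D x → D x < T + 3 * ε → IsConstantNear v (2 * T) x := by
    intro x hxΥ hx1 hx2
    have hψT : T < ψ x := (lt_min (by linarith) (by linarith)).trans_le (hψD x hxΥ)
    have hc0 : ∀ t, |t - 0| ≤ T → VanishesOn {x | T < ψ x} (v t - v 0) := fun t ht =>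
      (hv.vanishesOn_of_eikonal_abs hLame hW h0 hψ hψ0 hψc hψW heik t).mono
        fun z hz => ht.trans_lt hz
    have hc1 : ∀ t, |t - 2 * T| ≤ T → VanishesOn {x | T < ψ x} (v t - v (2 * T)) := fun t ht =>
      (hv.vanishesOn_of_eikonal_abs hLame hW h1 hψ hψ0 hψc hψW heik t).mono
        fun z hz => ht.trans_lt hz
    refine ⟨{x | T < ψ x}, isOpen_lt continuous_const hψ.continuous, hψT, T, hT, fun t ht => ?_⟩
    rcases le_total t T with h | h
    · exact hc0 t (by rw [abs_le]; constructor <;> linarith [ht.1])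
    · refine (hc1 t (by rw [abs_le]; constructor <;> linarith [ht.2])).trans
        ((hc1 T ?_).symm.trans (hc0 T ?_)) <;> rw [abs_le] <;> constructor <;> linarith
  set G := {x | IsConstantNear v (2 * T) x} with hG
  have hGo : IsOpen G := isOpen_isConstantNear v _
  -- A connectedness argument. The exterior is covered by two open sets: the points where `v` is
  -- locally constant or that are far away, and the near points outside the closure of `G`. They can
  -- overlap only in the shell, which lies in `G`, so they are disjoint. The first contains the
  -- complement of the closure of `Υ`, hence everything.
  have hcov : (closure Θ)ᶜ ⊆ (G ∪ ((closure Υ)ᶜ ∪ {x | T + ε < D x})) ∪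
      (outside Θ Υ ∩ {x | D x < T + 3 * ε} ∩ (closure G)ᶜ) := by
    intro x hxE
    by_cases hxD : T + ε < D x
    · exact Or.inl (Or.inr (Or.inr hxD))
    by_cases hxΥ : x ∈ closure Υ
    swap
    · exact Or.inl (Or.inr (Or.inl hxΥ))
    have hxΥ' : x ∈ Υ := by
      by_contra hn
      have := hfr x (hΥ.frontier_eq ▸ ⟨hxΥ, hn⟩)
      linarith
    by_cases hxG : x ∈ closure G
    · exact Or.inl (Or.inl (hUC.isConstantNear_of_mem_closure hLame hv hW (by positivity) h0 h1
        ⟨hxΥ', hxE⟩ hxG))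
    · exact Or.inr ⟨⟨⟨hxΥ', hxE⟩, show D x < T + 3 * ε by linarith⟩, hxG⟩
  have hdisj : Disjoint (G ∪ ((closure Υ)ᶜ ∪ {x | T + ε < D x}))
      (outside Θ Υ ∩ {x | D x < T + 3 * ε} ∩ (closure G)ᶜ) := by
    refine disjoint_left.2 fun x hx1 hx2 => ?_
    rcases hx1 with h | h | h
    · exact hx2.2 (subset_closure h)
    · exact h (subset_closure hx2.1.1.1)
    · exact hx2.2 (subset_closure (hshell x hx2.1.1.1 h hx2.1.2))
  have hne : ((closure Θ)ᶜ ∩ (G ∪ ((closure Υ)ᶜ ∪ {x | T + ε < D x}))).Nonempty := by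
    have hne : (closure Υ)ᶜ.Nonempty := by
      refine nonempty_compl.2 fun h => NormedSpace.unbounded_univ ℝ Pos (h ▸ hΥb.closure)
    obtain ⟨z, hz⟩ := hne
    exact ⟨z, fun h => hz (subset_closure (hΘΥ h)), Or.inr (Or.inl hz)⟩
  have hsub := hΘc.subset_left_of_subset_union
    (hGo.union (isClosed_closure.isOpen_compl.union (isOpen_lt continuous_const hDc)))
    ((hW.inter (isOpen_lt hDc continuous_const)).inter isClosed_closure.isOpen_compl)
    hdisj hcov hne
  rcases hsub hx.2 with h | h | h
  · exact h
  · exact absurd (subset_closure hx.1) h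
  · have h' : T + ε < D x := h
    have h'' : D x ≤ T := hxT
    linarith

/-- A wave that is stationary outside `Θ` at times `0` and `2T` is stationary at time `T` on the
slow domain of influence of the boundary of `Θ`. -/
theorem UniqueContinuation.isStationaryOn_slowDomain (hUC : UniqueContinuation lam mu)
    (hLame : IsLame Ω lam mu) (hv : IsElasticWave lam mu v) (hΘ : IsLipschitzDomain Θ)
    (hΘc : IsPreconnected (closure Θ)ᶜ) (hΥ : IsOpen Υ) (hΥb : Bornology.IsBounded Υ)
    (hΘΥ : closure Θ ⊆ Υ) {T : ℝ} (hT : 0 < T)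
    (hdist : ENNReal.ofReal (2 * T) < setDist (speedP lam mu) (frontier Υ) (closure Θ))
    (h0 : IsStationaryOn lam mu (outside Θ Υ) (v 0, deriv v 0))
    (h1 : IsStationaryOn lam mu (outside Θ Υ) (v (2 * T), deriv v (2 * T))) :
    IsStationaryOn lam mu {x | distToSet (speedS mu) x (frontier Θ) < ENNReal.ofReal T}
      (v T, deriv v T) := by
  refine hv.isStationaryOn hLame fun x hx => ?_
  obtain ⟨s, hs, hsb⟩ := hLame.exists_slowness_bound
  simp only [mem_ofPred, distToSet, iInf_lt_iff] at hx
  obtain ⟨y, hy, hxy⟩ := hx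
  have hyΘ : y ∈ closure Θ := frontier_subset_closure hy
  have hΘne : Θ.Nonempty := closure_nonempty_iff.1 ⟨y, hyΘ⟩
  obtain ⟨r, hr0, hr, hr1⟩ := ENNReal.lt_iff_exists_real_btwn.1 hxy
  have hr2 : r < T := (ENNReal.ofReal_lt_ofReal_iff_of_nonneg hr0).1 hr1
  -- Unique continuation has to start from an exterior point `z`, not from `y` itself. The slack `T
  -- - r` pays for the move, and `s` bounds both slownesses, so `z` is also within `P`-distance `T`
  -- of `Θ`.
  have hnear : ∀ᶠ z in 𝓝 y, z ∈ Υ ∧ s * ‖z - y‖ < T - r := by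
    refine (hΥ.eventually_mem (hΘΥ hyΘ)).and ?_
    have hc : ContinuousAt (fun z => s * ‖z - y‖) y := by fun_prop
    exact hc.eventually (gt_mem_nhds (by simpa using hr2))
  obtain ⟨z, ⟨hzΥ, hzy⟩, hzΘ⟩ :=
    mem_closure_iff_nhds.1 (hΘ.mem_closure_exterior hy) _ hnear
  have hzD : (distToSet (speedP lam mu) z (closure Θ)).toReal ≤ T := by
    refine ENNReal.toReal_le_of_le_ofReal hT.le ?_
    refine (iInf₂_le y hyΘ).trans ((travelDist_le_segment fun w _ => (hsb w).1).trans
      (ENNReal.ofReal_le_ofReal ?_))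
    rw [norm_sub_rev]; linarith
  obtain ⟨N, hN, hzN, δ, hδ, hc⟩ := hUC.isConstantNear_exterior hLame hv hΘne hΘc hΥ hΥb hΘΥ hT
    hdist h0 h1 ⟨hzΥ, hzΘ⟩ hzD
  have key := hUC.constant_ball hLame hv hN hzN (t₀ := 0) (t₁ := 2 * T) (x := x)
    (fun t ht t' ht' => (hc t' ⟨by linarith [ht'.1], by linarith [ht'.2]⟩).trans
      (hc t ⟨by linarith [ht.1], by linarith [ht.2]⟩).symm) ?_
  · rwa [show (0 + 2 * T) / 2 = T by ring] at key
  · rw [show (2 * T - 0) / 2 = r + (T - r) by ring, ENNReal.ofReal_add hr0 (by linarith)]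
    refine (travelDist_triangle _ x y z).trans_lt (ENNReal.add_lt_add hr ?_)
    refine (travelDist_le_segment fun w _ => (hsb w).2).trans_lt ?_
    exact (ENNReal.ofReal_lt_ofReal_iff (by linarith)).2 hzy

end Exterior


/-! ### Orthogonality and stationarity -/

section Orthogonality

variable {lam mu : Pos → ℝ} {Ω Θ Υ : Set Pos}

theorem IsLame.energyInner_sub_left (hLame : IsLame Ω lam mu) {h k q : CauchyData}
    (hh : MemH1 h.1) (hk : MemH1 k.1) :
    energyInner lam mu (h - k) q = energyInner lam mu h q - energyInner lam mu k q := by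
  simp only [energyInner_eq hLame.memLp_lam hLame.memLp_mu, Prod.fst_sub, Prod.snd_sub,
    grad_sub hh hk, gradForm_sub_left, inner_sub_right]
  ring

theorem IsLame.energyInner_eq_zero (hLame : IsLame Ω lam mu) {U W : Set Pos} (hUW : Disjoint U W)
    {h q : CauchyData} (hh : h ∈ DataIn U) (hq : q ∈ DataIn W) : energyInner lam mu h q = 0 := by
  rw [energyInner_eq hLame.memLp_lam hLame.memLp_mu, gradForm_eq_integral,
    VanishesOn.inner_eq_zero (hq.2.mono hUW.subset_compl_right) hh.2, zero_add]
  refine integral_eq_zero_of_ae ?_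
  have h1 : ∀ᵐ x, ∀ i, x ∈ Uᶜ → weakPartial i h.1 x = 0 :=
    ae_all_iff.2 fun i => hh.1.vanishesOn_partial i
  have h2 : ∀ᵐ x, ∀ i, x ∈ Wᶜ → weakPartial i q.1 x = 0 :=
    ae_all_iff.2 fun i => hq.1.vanishesOn_partial i
  filter_upwards [h1, h2] with x hx1 hx2
  by_cases hx : x ∈ U
  · simp [formAt, grad, hx2 _ (hUW.subset_compl_right hx)]
  · simp [formAt_eq, grad, hx1 _ hx]

/-- Testing with the restriction of the velocity to `W` makes that restriction orthogonal to itself;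
testing with `(φ, 0)` is the weak equation. -/
theorem IsLame.isStationaryOn_of_orthogonal (hLame : IsLame Ω lam mu) {W : Set Pos} (hW : IsOpen W)
    {k : CauchyData} (hk : MemH1 k.1) (h : ∀ q ∈ DataIn W, energyInner lam mu k q = 0) :
    IsStationaryOn lam mu W k := by
  have hl := hLame.memLp_lam
  have hm := hLame.memLp_mu
  refine ⟨hk, ?_, fun φ hφ => ?_⟩
  · have hind : MemLp (W.indicator fun _ : Pos => (1 : ℝ)) ∞ volume :=
      (memLp_top_const 1).indicator hW.measurableSet
    set g := mulOp _ hind k.2 with hg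
    have hgW : VanishesOn Wᶜ g := by
      filter_upwards [coeFn_mulOp _ hind k.2] with x hx hxW
      rw [hx, indicator_of_notMem hxW, zero_smul]
    have hkg : VanishesOn W (k.2 - g) := by
      filter_upwards [coeFn_mulOp _ hind k.2, Lp.coeFn_sub k.2 g] with x hx h2 hxW
      rw [h2, Pi.sub_apply, hx, indicator_of_mem hxW, one_smul, sub_self]
    have h1 := h (0, g) ⟨MemH10.zero W, hgW⟩
    have h0 : grad (0 : L2) = 0 := by
      simpa using grad_sub MemH1.zero MemH1.zero
    rw [energyInner_eq hl hm, gradForm_symm, h0, gradForm_zero_left, map_zero, add_zero] at h1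
    have h2 : inner ℂ g (k.2 - g) = 0 := by
      rw [← inner_conj_symm, hkg.inner_eq_zero hgW, map_zero]
    rw [inner_sub_right, h1, zero_sub, neg_eq_zero, inner_self_eq_zero] at h2
    rwa [h2, sub_zero] at hkg
  · have h1 := h (φ, 0) ⟨hφ, VanishesOn.zero _⟩
    rwa [energyInner_eq hl hm, inner_zero_left, zero_add, ← elasticForm_eq] at h1

theorem IsLame.isStationaryOn_zero (hLame : IsLame Ω lam mu) (U : Set Pos) :
    IsStationaryOn lam mu U 0 := by
  refine ⟨MemH1.zero, VanishesOn.zero U, fun φ _ => ?_⟩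
  have h0 : grad (0 : L2) = 0 := by
    simpa using grad_sub MemH1.zero MemH1.zero
  rw [elasticForm_eq hLame.memLp_lam hLame.memLp_mu, Prod.fst_zero, h0, gradForm_zero_left]

/-- `ν` preserves the exterior data and is symmetric for the energy product, so it commutes with
`π^⋆`. -/
theorem IsLame.isOuterProj_timeReversal (hLame : IsLame Ω lam mu) {k p : CauchyData}
    (hp : IsOuterProj lam mu Θ Υ k p) :
    IsOuterProj lam mu Θ Υ (timeReversal k) (timeReversal p) := by
  refine ⟨⟨hp.1.1, hp.1.2.neg⟩, fun q hq => ?_⟩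
  have h := hp.2 (timeReversal q) ⟨hq.1, hq.2.neg⟩
  rw [energyInner_eq hLame.memLp_lam hLame.memLp_mu] at h ⊢
  rw [← h]
  simp only [timeReversal, Prod.fst_sub, Prod.snd_sub, inner_sub_right, inner_neg_right,
    inner_neg_left]

end Orthogonality

/-! ### The scattering control equation -/

section ScatteringControl

variable {lam mu : Pos → ℝ} {Ω Θ Υ : Set Pos}

theorem IsElasticWave.propagate_eq (hLame : IsLame Ω lam mu) {u : ℝ → L2}
    (hu : IsElasticWave lam mu u) {h : CauchyData} (h0 : u 0 = h.1) (h1 : deriv u 0 = h.2) (s : ℝ) :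
    propagate lam mu s h = (u s, deriv u s) := by
  have H : ∃ u : ℝ → L2, IsElasticWave lam mu u ∧ u 0 = h.1 ∧ deriv u 0 = h.2 := ⟨u, hu, h0, h1⟩
  rw [propagate, dif_pos H, IsElasticWave.ext hLame H.choose_spec.1 hu
    (H.choose_spec.2.1.trans h0.symm) (H.choose_spec.2.2.trans h1.symm)]

theorem IsLame.propagate_zero (hLame : IsLame Ω lam mu) (s : ℝ) :
    propagate lam mu s 0 = 0 := by
  by_cases H : ∃ u : ℝ → L2, IsElasticWave lam mu u ∧ u 0 = (0 : CauchyData).1 ∧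
      deriv u 0 = (0 : CauchyData).2
  · obtain ⟨u, hu, h0, h1⟩ := H
    have hz : u = fun _ => 0 := funext fun t => hu.eq_zero hLame h0 h1 t
    rw [hu.propagate_eq hLame h0 h1, hz, deriv_const]
    rfl
  · rw [propagate, dif_neg H]

/-- The wave with the data `π̄ R_{2T} h_∞` at time `0` is orthogonal to the exterior data at time
`-2T`. -/
theorem SolvesScatteringControl.energyInner_eq_zero (hLame : IsLame Ω lam mu) (hΥ : IsOpen Υ)
    (hΥb : Bornology.IsBounded Υ) {T : ℝ} {h₀ h : CauchyData} (hh₀ : h₀ ∈ DataIn Θ)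
    (hSC : SolvesScatteringControl lam mu Θ Υ T h₀ h) {u w : ℝ → L2} (hu : IsElasticWave lam mu u)
    (hu0 : u 0 = h.1) (hu1 : deriv u 0 = h.2) (hw : IsElasticWave lam mu w)
    (hw01 : (w 0, deriv w 0) = innerProj lam mu Θ Υ (u (2 * T), deriv u (2 * T)))
    {q : CauchyData} (hq : q ∈ DataIn (outside Θ Υ)) :
    energyInner lam mu (w (-(2 * T)), deriv w (-(2 * T))) q = 0 := by
  set k : CauchyData := (u (2 * T), deriv u (2 * T)) with hk
  set p := outerProj lam mu Θ Υ k with hp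
  have hkH : MemH1 k.1 := hu.memH1 _
  have hproj : IsOuterProj lam mu Θ Υ k p := outerProj_spec hLame hΥ hΥb hkH
  have hw0 : w 0 = k.1 - p.1 := congrArg Prod.fst hw01
  have hw1 : deriv w 0 = k.2 - p.2 := congrArg Prod.snd hw01
  -- `P` is the wave with data `π^⋆ R_{2T} h_∞` at time `0`.
  let P : ℝ → L2 := fun t => u (t + 2 * T) - w t
  have hP : IsElasticWave lam mu P :=
    (hu.comp_add (2 * T)).sub hLame.memLp_lam hLame.memLp_mu hw
  have hPd : ∀ t, deriv P t = deriv u (t + 2 * T) - deriv w t := fun t =>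
    (((hu.hasDerivAt (t + 2 * T)).comp_add_const t (2 * T)).sub (hw.hasDerivAt t)).deriv
  set b : CauchyData := (P (-(2 * T)), deriv P (-(2 * T))) with hb
  -- The two reversals in `R π^⋆ R` turn forward propagation of `π^⋆ R_{2T} h_∞` into backward
  -- propagation by `2T`.
  have hrefl : reflectOp lam mu T (outerProj lam mu Θ Υ (reflectOp lam mu T h)) = b := by
    rw [reflectOp, reflectOp, hu.propagate_eq hLame hu0 hu1,
      ← hk,
      (hLame.isOuterProj_timeReversal hproj).outerProj_eq (k := timeReversal k) hLame hΥb hkH,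
      hP.reverse.propagate_eq hLame (by simp [P, timeReversal, hw0, k])
        (by rw [deriv_reverse, neg_zero, hPd]; simp [timeReversal, hw1, k])]
    simp only [timeReversal, deriv_reverse, neg_neg, hb]
  have hbproj := outerProj_spec (Θ := Θ) hLame hΥ hΥb (k := b) (hP.memH1 _)
  -- By linearity this state is `h - b`; adding and subtracting `π^⋆ b` brings in `h₀ = h - π^⋆ b`.
  have hw2 : ((w (-(2 * T)), deriv w (-(2 * T))) : CauchyData) =
      h₀ - (b - outerProj lam mu Θ Υ b) := by
    rw [← hSC, hrefl, sub_sub_sub_cancel_right]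
    refine Prod.ext ?_ ?_
    · simp [hb, P, hu0]
    · simp [hb, hPd, hu1]
  have hdisj : Disjoint Θ (outside Θ Υ) :=
    disjoint_left.2 fun x hx hx' => hx'.2 (subset_closure hx)
  rw [hw2, hLame.energyInner_sub_left hh₀.1.memH1 ((hP.memH1 _).sub hbproj.1.1.memH1),
    hLame.energyInner_eq_zero hdisj hh₀ hq, hbproj.2 q hq, sub_zero]

end ScatteringControl

end ElasticControl

end

theorem mainTheorem8
    (Ω Θ Υ : Set ElasticControl.Pos) (lam mu : ElasticControl.Pos → ℝ) (T : ℝ)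
    (h₀ hInf : ElasticControl.CauchyData)
    -- the medium
    (hΩ : IsOpen Ω) (hLame : ElasticControl.IsLame Ω lam mu)
    (hUC : ElasticControl.UniqueContinuation lam mu)
    -- the regions of the initial pulse and of the controls
    (hΩΘ : Ω ⊆ Θ) (hΘ : ElasticControl.IsLipschitzDomain Θ) (hΘc : IsConnected (closure Θ)ᶜ)
    (hΥ : ElasticControl.IsLipschitzDomain Υ) (hΥb : Bornology.IsBounded Υ)
    (hΘΥ : closure Θ ⊆ Υ)
    (hdist : ENNReal.ofReal (2 * T) <
      ElasticControl.setDist (ElasticControl.speedP lam mu) (frontier Υ) (closure Θ))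
    -- the time parameter
    (hT : 0 < T)
    (hTdiam : ENNReal.ofReal (2 * T) <
      ElasticControl.travelDiam (ElasticControl.speedP lam mu) Θ)
    -- the initial pulse and the solution of the scattering control equation
    (hh₀ : h₀ ∈ ElasticControl.DataIn Θ) (hhInf : hInf ∈ ElasticControl.DataIn Υ)
    (hSC : ElasticControl.SolvesScatteringControl lam mu Θ Υ T h₀ hInf) :
    ElasticControl.IsStationaryOn lam mu
      {x | ElasticControl.distToSet (ElasticControl.speedS mu) x (frontier Θ) < ENNReal.ofReal T}
      (ElasticControl.propagate lam mu (-T)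
        (ElasticControl.innerProj lam mu Θ Υ
          (ElasticControl.propagate lam mu (2 * T) hInf))) := by
  open ElasticControl in
  -- Existence of waves is not needed: if there is none with the given data, `propagate` returns
  -- `0`, and zero data are stationary. The same applies below to `Hw`.
  by_cases Hu : ∃ u : ℝ → L2, IsElasticWave lam mu u ∧ u 0 = hInf.1 ∧ deriv u 0 = hInf.2
  swap
  · have hp : IsOuterProj lam mu Θ Υ 0 0 := by
      refine ⟨DataIn.zero _, fun q hq => ?_⟩
      rw [sub_zero, hLame.energyInner_eq_zero (disjoint_bot_left) (DataIn.zero _) hq]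
    rw [show propagate lam mu (2 * T) hInf = 0 from dif_neg Hu, innerProj,
      hp.outerProj_eq hLame hΥb MemH1.zero, sub_zero, hLame.propagate_zero]
    exact hLame.isStationaryOn_zero _
  obtain ⟨u, hu, hu0, hu1⟩ := Hu
  rw [hu.propagate_eq hLame hu0 hu1]
  by_cases Hw : ∃ w : ℝ → L2, IsElasticWave lam mu w ∧
      w 0 = (innerProj lam mu Θ Υ (u (2 * T), deriv u (2 * T))).1 ∧
      deriv w 0 = (innerProj lam mu Θ Υ (u (2 * T), deriv u (2 * T))).2
  swap
  · rw [propagate, dif_neg Hw]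
    exact hLame.isStationaryOn_zero _
  obtain ⟨w, hw, hw0, hw1⟩ := Hw
  have hw01 := Prod.ext (x := (w 0, deriv w 0)) hw0 hw1
  have hW : IsOpen (outside Θ Υ) := hΥ.1.sdiff isClosed_closure
  rw [hw.propagate_eq hLame hw0 hw1]
  -- The clock is shifted so that the two stationary states occur at times `0` and `2T` and the
  -- state of the claim at time `T`.
  have hv := hw.comp_add (-(2 * T))
  have hd : ∀ t, deriv (fun t => w (t + -(2 * T))) t = deriv w (t + -(2 * T)) := fun t => by
    rw [deriv_comp_add_const]
  have key := hUC.isStationaryOn_slowDomain hLame hv hΘ hΘc.isPreconnected hΥ.1 hΥb hΘΥ hT hdist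
    ?_ ?_
  · rwa [hd, show T + -(2 * T) = -T by ring] at key
  · rw [hd, zero_add]
    exact hLame.isStationaryOn_of_orthogonal hW (hw.memH1 _) fun q hq =>
      hSC.energyInner_eq_zero hLame hΥ.1 hΥb hh₀ hu hu0 hu1 hw hw01 hq
  · rw [hd, add_neg_cancel, hw01]
    have hp := outerProj_spec (Θ := Θ) hLame hΥ.1 hΥb (k := (u (2 * T), deriv u (2 * T)))
      (hu.memH1 _)
    exact hLame.isStationaryOn_of_orthogonal hW ((hu.memH1 _).sub hp.1.1.memH1) hp.2
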